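/- Let $N\ge 2$ and $2<\theta<\frac{2N}{N-1}$. Let $f\in C^1(\mathbb{R})$ satisfy $f\ge 0$ on $[0,\infty)$, $f(t)=0$ for $t<0$, $\lim_{t\to 0}|f(t)|/t=0$, $\lim_{t\to\infty}f(t)/t^{\theta-1}=0$, and let $f(t)/t$ be nondecreasing on $(0,\infty)$; put $F(t)=\int_0^t f(s)\,ds$. Let $m>0$ and let $V:\mathbb{R}^N\to\mathbb{R}$ be continuous, with $V+V_0\ge 0$ for some $V_0\in(0,m)$, $\lim_{|y|\to\infty}V(y)=V_\infty>0$, $V\le V_\infty$ and $V\not\equiv V_\infty$. Let $W=W_1+W_2$ be (up to null sets) nonnegative and radial on $\mathbb{R}^N$, where $W_1\in L^r(\mathbb{R}^N)$ for some real $r>\frac{N}{N(2-\theta)+\theta}$ and $W_2\in L^\infty(\mathbb{R}^N)$. Write $\mathbb{R}^{N+1}_+=\{(x,y):x>0,\ y\in\mathbb{R}^N\}$, let $H^1(\mathbb{R}^{N+1}_+)$ be the space of real $u\in L^2(\mathbb{R}^{N+1}_+)$ with weak gradient $\nabla u\in L^2(\mathbb{R}^{N+1}_+)$, and let $\gamma$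 be its trace operator on $\{x=0\}=\mathbb{R}^N$. Let $v\in H^1(\mathbb{R}^{N+1}_+)$ be a weak solution of $$\begin{cases}-\Delta v+m^2v=0&\text{in }\mathbb{R}^{N+1}_+,\\ -\dfrac{\partial v}{\partial x}(0,y)=-V(y)v(0,y)+\big(W*F(v(0,\cdot))\big)(y)\,f(v(0,y))&\text{on }\mathbb{R}^N,\end{cases}$$ that is, for every $\varphi\in H^1(\mathbb{R}^{N+1}_+)$, $$\iint_{\mathbb{R}^{N+1}_+}\big(\nabla v\cdot\nabla\varphi+m^2v\varphi\big)\,dx\,dy+\int_{\mathbb{R}^N}V\,\gamma(v)\gamma(\varphi)\,dy-\int_{\mathbb{R}^N}\big(W*F(\gamma(v))\big)f(\gamma(v))\,\gamma(\varphi)\,dy=0.$$ Then $\gamma(v)\in L^p(\mathbb{R}^N)$ for every $p\in[2,\infty]$, and $v\in L^\infty(\mathbb{R}^{N+1}_+)$. -/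

import Mathlib

open MeasureTheory Filter Topology Set
open scoped ENNReal ContDiff Convolution

namespace Hartree

/-- The boundary space `ℝ^N`, with its Euclidean norm. -/
abbrev Bdry (N : ℕ) : Type := EuclideanSpace ℝ (Fin N)

/-- The ambient space `ℝ^{N+1}`, with points `z = (x, y)`, `x ∈ ℝ`, `y ∈ ℝ^N`.  It carries the
product (Lebesgue) measure; its norm is used only through the topology, the notion of
differentiability and membership in `L²`. -/
abbrev Amb (N : ℕ) : Type := ℝ × Bdry N

/-- The open half-space `ℝ^{N+1}_+ = {(x, y) : x > 0}`. -/
def halfSpace (N : ℕ) : Set (Amb N) := {z | 0 < z.1}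

/-- Lebesgue measure on the half-space. -/
noncomputable def halfMeasure (N : ℕ) : Measure (Amb N) := volume.restrict (halfSpace N)

/-- The Euclidean scalar product of `ℝ^{N+1}`. -/
noncomputable def dot {N : ℕ} (a b : Amb N) : ℝ := a.1 * b.1 + inner ℝ a.2 b.2

/-- `G` is a square integrable weak gradient of `v` in the open half-space:
`∫ v ∂_e φ = - ∫ (G · e) φ` for every `φ ∈ C_c^∞(ℝ^{N+1}_+)` and every direction `e`. -/
def IsWeakGrad {N : ℕ} (v : Amb N → ℝ) (G : Amb N → Amb N) : Prop :=
  MemLp G 2 (halfMeasure N) ∧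
  ∀ φ : Amb N → ℝ, ContDiff ℝ ∞ φ → HasCompactSupport φ → tsupport φ ⊆ halfSpace N →
    ∀ e : Amb N,
      ∫ z, v z * fderiv ℝ φ z e ∂(halfMeasure N) = -∫ z, dot (G z) e * φ z ∂(halfMeasure N)

/-- `v ∈ H¹(ℝ^{N+1}_+)`: `v` is in `L²` and has a weak gradient in `L²`. -/
def MemH1 {N : ℕ} (v : Amb N → ℝ) : Prop :=
  MemLp v 2 (halfMeasure N) ∧ ∃ G : Amb N → Amb N, IsWeakGrad v G

open Classical in
/-- The weak gradient `∇v` of `v ∈ H¹(ℝ^{N+1}_+)` (unique up to null sets). -/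
noncomputable def weakGrad {N : ℕ} (v : Amb N → ℝ) : Amb N → Amb N :=
  if h : ∃ G : Amb N → Amb N, IsWeakGrad v G then h.choose else 0

/-- `u ∈ L²(ℝ^N)` is the trace of `v` on `{x = 0}`: the pair `(v, u)` is a limit in
`H¹(ℝ^{N+1}_+) × L²(ℝ^N)` of pairs `(φ, φ(0, ·))` with `φ ∈ C_c^∞(ℝ^{N+1})`. -/
def IsTrace {N : ℕ} (v : Amb N → ℝ) (u : Bdry N → ℝ) : Prop :=
  MemLp u 2 volume ∧
  ∃ φ : ℕ → Amb N → ℝ,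
    (∀ n, ContDiff ℝ ∞ (φ n) ∧ HasCompactSupport (φ n)) ∧
    Tendsto (fun n => eLpNorm (fun z => φ n z - v z) 2 (halfMeasure N)) atTop (𝓝 0) ∧
    (∀ e : Amb N,
      Tendsto (fun n => eLpNorm (fun z => fderiv ℝ (φ n) z e - dot (weakGrad v z) e) 2
        (halfMeasure N)) atTop (𝓝 0)) ∧
    Tendsto (fun n => eLpNorm (fun y => φ n (0, y) - u y) 2 volume) atTop (𝓝 0)

open Classical in
/-- The trace operator `γ`.  By the trace theorem each `v ∈ H¹(ℝ^{N+1}_+)` has a trace, unique up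
to null sets, so the default value is never used on `H¹(ℝ^{N+1}_+)`. -/
noncomputable def trace {N : ℕ} (v : Amb N → ℝ) : Bdry N → ℝ :=
  if h : ∃ u : Bdry N → ℝ, IsTrace v u then h.choose else 0

/-- The primitive `F(t) = ∫₀ᵗ f(s) ds`. -/
noncomputable def prim (f : ℝ → ℝ) (t : ℝ) : ℝ := ∫ s in (0 : ℝ)..t, f s

/-- The nonlocal coefficient `W * F(u)` on `ℝ^N`. -/
noncomputable def hartree {N : ℕ} (W : Bdry N → ℝ) (f : ℝ → ℝ) (u : Bdry N → ℝ) : Bdry N → ℝ :=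
  W ⋆[ContinuousLinearMap.mul ℝ ℝ, volume] (fun y => prim f (u y))

/-- `v` is a weak solution in `H¹(ℝ^{N+1}_+)` of `-Δv + m²v = 0` in `ℝ^{N+1}_+`,
`-∂v/∂x(0, y) = -V(y) v(0, y) + (W * F(v(0, ·)))(y) f(v(0, y))` on `ℝ^N`. -/
def IsWeakSolution {N : ℕ} (m : ℝ) (V W : Bdry N → ℝ) (f : ℝ → ℝ) (v : Amb N → ℝ) : Prop :=
  MemH1 v ∧ ∀ φ : Amb N → ℝ, MemH1 φ →
    (∫ z, (dot (weakGrad v z) (weakGrad φ z) + m ^ 2 * v z * φ z) ∂(halfMeasure N))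
      + (∫ y, V y * trace v y * trace φ y)
      - (∫ y, hartree W f (trace v) y * f (trace v y) * trace φ y) = 0

end Hartree

/-!
Write `u` for the trace of `v`. Traces of `H¹` functions lie in `L^s(ℝ^N)` with `s = 2N/(N-1)`, so
`F(u)` lies in `L^p` for `1 ≤ p ≤ s/θ`. By Young's inequality and the condition on `r`, the
coefficient `(W * F(u)) f(u) / u` of the boundary condition belongs to `L^∞ + L^q` for some `q > N`.
This is the subcritical range for the linear problem `-∂v/∂x = b u`, so testing with the truncations
`(v - k)⁺` and `(-v - k)⁺` and using the trace inequality, De Giorgi's iteration over the levels `k`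
bounds `u`. Testing once more above the bound of `u`, where the boundary term vanishes, bounds `v`.
-/

namespace Hartree

open scoped NNReal

/-! ### Convergence in `L^p` of unbundled functions -/

section LpConvergence

variable {α E E' : Type*} [MeasurableSpace α] {μ : Measure α} [NormedAddCommGroup E]
  [NormedAddCommGroup E'] {p : ℝ≥0∞}

/-- Convergence `F n → f` in `L^p(μ)`, for unbundled functions; neither `F n` nor `f` is required
to lie in `L^p(μ)`. -/
def TendstoLp (p : ℝ≥0∞) (μ : Measure α) (F : ℕ → α → E) (f : α → E) : Prop :=
  Tendsto (fun n => eLpNorm (fun x => F n x - f x) p μ) atTop (𝓝 0)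

lemma TendstoLp.comp_strictMono {F : ℕ → α → E} {f : α → E} {ns : ℕ → ℕ}
    (h : TendstoLp p μ F f) (hns : StrictMono ns) : TendstoLp p μ (fun n => F (ns n)) f :=
  h.comp hns.tendsto_atTop

lemma TendstoLp.of_norm_le {F : ℕ → α → E} {f : α → E} {G : ℕ → α → E'} {g : α → E'}
    (h : TendstoLp p μ F f) (hle : ∀ n x, ‖G n x - g x‖ ≤ ‖F n x - f x‖) : TendstoLp p μ G g :=
  tendsto_of_tendsto_of_tendsto_of_le_of_le tendsto_const_nhds h (fun _ => zero_le)
    fun n => eLpNorm_mono (hle n)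

lemma TendstoLp.apply_clm {X Y : Type*} [NormedAddCommGroup X] [NormedSpace ℝ X]
    [NormedAddCommGroup Y] [NormedSpace ℝ Y] {L : ℕ → α → X →L[ℝ] Y} {A : α → X →L[ℝ] Y}
    (h : TendstoLp p μ L A) (e : X) : TendstoLp p μ (fun n x => L n x e) fun x => A x e := by
  have hlim : Tendsto (fun n => ENNReal.ofReal ‖e‖ * eLpNorm (fun x => L n x - A x) p μ) atTop
      (𝓝 0) := by
    simpa only [mul_zero] using ENNReal.Tendsto.const_mul h (Or.inr ENNReal.ofReal_ne_top)
  refine tendsto_of_tendsto_of_tendsto_of_le_of_le tendsto_const_nhds hlim (fun _ => zero_le)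
    fun n => eLpNorm_le_mul_eLpNorm_of_ae_le_mul (Eventually.of_forall fun x => ?_) p
  rw [mul_comm]
  exact (L n x - A x).le_opNorm e

lemma TendstoLp.congr_right {F : ℕ → α → E} {f g : α → E} (h : TendstoLp p μ F f)
    (hfg : f =ᵐ[μ] g) : TendstoLp p μ F g := by
  refine Tendsto.congr (fun n => eLpNorm_congr_ae ?_) h
  filter_upwards [hfg] with x hx
  rw [hx]

lemma TendstoLp.add {F G : ℕ → α → E} {f g : α → E} (hp : 1 ≤ p)
    (hFm : ∀ n, AEStronglyMeasurable (F n) μ) (hfm : AEStronglyMeasurable f μ)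
    (hGm : ∀ n, AEStronglyMeasurable (G n) μ) (hgm : AEStronglyMeasurable g μ)
    (hF : TendstoLp p μ F f) (hG : TendstoLp p μ G g) :
    TendstoLp p μ (fun n x => F n x + G n x) fun x => f x + g x := by
  refine tendsto_of_tendsto_of_tendsto_of_le_of_le tendsto_const_nhds
    (by simpa only [add_zero] using Tendsto.add hF hG) (fun _ => zero_le) fun n => ?_
  simp only [add_sub_add_comm]
  exact eLpNorm_add_le ((hFm n).sub hfm) ((hGm n).sub hgm) hp

lemma TendstoLp.neg {F : ℕ → α → E} {f : α → E} (h : TendstoLp p μ F f) :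
    TendstoLp p μ (fun n x => -F n x) fun x => -f x :=
  h.of_norm_le fun n x => by rw [← neg_sub', norm_neg]

lemma TendstoLp.sub {F G : ℕ → α → E} {f g : α → E} (hp : 1 ≤ p)
    (hFm : ∀ n, AEStronglyMeasurable (F n) μ) (hfm : AEStronglyMeasurable f μ)
    (hGm : ∀ n, AEStronglyMeasurable (G n) μ) (hgm : AEStronglyMeasurable g μ)
    (hF : TendstoLp p μ F f) (hG : TendstoLp p μ G g) :
    TendstoLp p μ (fun n x => F n x - G n x) fun x => f x - g x := by
  have h := hF.add (G := fun n x => -G n x) (g := fun x => -g x) hp hFm hfm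
    (fun n => (hGm n).neg) hgm.neg hG.neg
  simpa only [sub_eq_add_neg] using h

lemma eLpNorm_sub_le_eLpNorm_sub_add {F G f : α → E} (hF : AEStronglyMeasurable F μ)
    (hG : AEStronglyMeasurable G μ) (hf : AEStronglyMeasurable f μ) (hp : 1 ≤ p) :
    eLpNorm (fun x => F x - G x) p μ ≤
      eLpNorm (fun x => F x - f x) p μ + eLpNorm (fun x => G x - f x) p μ := by
  calc eLpNorm (fun x => F x - G x) p μ
      = eLpNorm ((fun x => F x - f x) - fun x => G x - f x) p μ := by congr 1; ext x; simp
    _ ≤ _ := eLpNorm_sub_le (hF.sub hf) (hG.sub hf) hp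

lemma TendstoLp.tendsto_eLpNorm {F : ℕ → α → E} {f : α → E} (hp : 1 ≤ p)
    (hF : ∀ n, AEStronglyMeasurable (F n) μ) (hf : MemLp f p μ) (h : TendstoLp p μ F f) :
    Tendsto (fun n => eLpNorm (F n) p μ) atTop (𝓝 (eLpNorm f p μ)) := by
  have hd : ∀ n, AEStronglyMeasurable (fun x => F n x - f x) μ := fun n =>
    (hF n).sub hf.aestronglyMeasurable
  have upper : Tendsto (fun n => eLpNorm f p μ + eLpNorm (fun x => F n x - f x) p μ) atTop
      (𝓝 (eLpNorm f p μ)) := by simpa only [add_zero] using tendsto_const_nhds.add h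
  have lower : Tendsto (fun n => eLpNorm f p μ - eLpNorm (fun x => F n x - f x) p μ) atTop
      (𝓝 (eLpNorm f p μ)) := by
    simpa only [tsub_zero] using ENNReal.Tendsto.sub tendsto_const_nhds h
      (Or.inl hf.eLpNorm_ne_top)
  refine tendsto_of_tendsto_of_tendsto_of_le_of_le lower upper (fun n => ?_) fun n => ?_
  · rw [tsub_le_iff_right]
    calc eLpNorm f p μ = eLpNorm (F n - fun x => F n x - f x) p μ := by congr 1; ext x; simp
      _ ≤ _ := eLpNorm_sub_le (hF n) (hd n) hp
  · calc eLpNorm (F n) p μ = eLpNorm (f + fun x => F n x - f x) p μ := by congr 1; ext x; simp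
      _ ≤ _ := eLpNorm_add_le hf.aestronglyMeasurable (hd n) hp

lemma TendstoLp.exists_seq_tendsto_ae {F : ℕ → α → E} {f : α → E} (hp : p ≠ 0)
    (hF : ∀ n, AEStronglyMeasurable (F n) μ) (hf : AEStronglyMeasurable f μ)
    (h : TendstoLp p μ F f) :
    ∃ ns : ℕ → ℕ, StrictMono ns ∧ ∀ᵐ x ∂μ, Tendsto (fun n => F (ns n) x) atTop (𝓝 (f x)) :=
  (tendstoInMeasure_of_tendsto_eLpNorm hp hF hf h).exists_seq_tendsto_ae

lemma eLpNorm_le_of_tendsto_ae {q a : ℝ≥0∞} {F : ℕ → α → E} {f : α → E} {b : ℕ → ℝ≥0∞}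
    (hF : ∀ n, AEStronglyMeasurable (F n) μ)
    (hlim : ∀ᵐ x ∂μ, Tendsto (fun n => F n x) atTop (𝓝 (f x)))
    (hle : ∀ n, eLpNorm (F n) q μ ≤ b n) (hb : Tendsto b atTop (𝓝 a)) : eLpNorm f q μ ≤ a :=
  calc eLpNorm f q μ ≤ liminf (fun n => eLpNorm (F n) q μ) atTop :=
        Lp.eLpNorm_lim_le_liminf_eLpNorm hF f hlim
    _ ≤ liminf b atTop := liminf_le_liminf (Eventually.of_forall hle)
    _ = a := hb.liminf_eq

lemma TendstoLp.eLpNorm_le {q a : ℝ≥0∞} {F : ℕ → α → E} {f : α → E} {b : ℕ → ℝ≥0∞} (hp : p ≠ 0)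
    (hF : ∀ n, AEStronglyMeasurable (F n) μ) (hf : AEStronglyMeasurable f μ)
    (h : TendstoLp p μ F f) (hle : ∀ n, eLpNorm (F n) q μ ≤ b n) (hb : Tendsto b atTop (𝓝 a)) :
    eLpNorm f q μ ≤ a := by
  obtain ⟨ns, hns, hae⟩ := h.exists_seq_tendsto_ae hp hF hf
  exact eLpNorm_le_of_tendsto_ae (fun n => hF (ns n)) hae (fun n => hle (ns n))
    (hb.comp hns.tendsto_atTop)

lemma TendstoLp.tendsto_integral_mul {F : ℕ → α → ℝ} {f g : α → ℝ} (hF : ∀ n, MemLp (F n) 2 μ)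
    (hf : MemLp f 2 μ) (hg : MemLp g 2 μ) (h : TendstoLp 2 μ F f) :
    Tendsto (fun n => ∫ x, F n x * g x ∂μ) atTop (𝓝 (∫ x, f x * g x ∂μ)) := by
  refine tendsto_integral_of_L1' (fun x => f x * g x) (hf.integrable_mul hg).aestronglyMeasurable
    (Eventually.of_forall fun n => (hF n).integrable_mul hg) ?_
  have hprod : Tendsto (fun n => eLpNorm (fun x => F n x - f x) 2 μ * eLpNorm g 2 μ) atTop
      (𝓝 0) := by
    simpa only [zero_mul] using ENNReal.Tendsto.mul_const h (Or.inr hg.eLpNorm_ne_top)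
  refine tendsto_of_tendsto_of_tendsto_of_le_of_le tendsto_const_nhds hprod (fun _ => zero_le)
    fun n => ?_
  calc eLpNorm ((fun x => F n x * g x) - fun x => f x * g x) 1 μ
      = eLpNorm ((fun x => F n x - f x) • g) 1 μ := by congr 1; ext x; simp [sub_mul]
    _ ≤ _ := eLpNorm_smul_le_mul_eLpNorm hg.aestronglyMeasurable
        ((hF n).sub hf).aestronglyMeasurable

lemma tendstoLp_zero_smul [NormedSpace ℝ E] {F : ℕ → α → ℝ} {g : α → E} {C : ℝ} (hp0 : p ≠ 0)
    (hp : p ≠ ⊤) (hF : ∀ n, AEStronglyMeasurable (F n) μ) (hC : ∀ n x, ‖F n x‖ ≤ C)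
    (hg : MemLp g p μ) (hlim : ∀ᵐ x ∂μ, Tendsto (fun n => F n x) atTop (𝓝 0)) :
    TendstoLp p μ (fun n x => F n x • g x) fun _ => 0 := by
  have hp' : 0 < p.toReal := ENNReal.toReal_pos hp0 hp
  have key : Tendsto (fun n => ∫⁻ x, ‖F n x • g x‖ₑ ^ p.toReal ∂μ) atTop (𝓝 (∫⁻ _, 0 ∂μ)) := by
    refine tendsto_lintegral_of_dominated_convergence' (fun x => ‖C • g x‖ₑ ^ p.toReal)
      (fun n => ((hF n).smul hg.aestronglyMeasurable).enorm.pow_const _)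
      (fun n => Eventually.of_forall fun x => ?_) ?_ ?_
    · beta_reduce
      rw [← ofReal_norm, ← ofReal_norm, norm_smul, norm_smul]
      have hFC : ‖F n x‖ ≤ ‖C‖ := (hC n x).trans (le_abs_self C)
      gcongr
    · exact ((eLpNorm_lt_top_iff_lintegral_rpow_enorm_lt_top hp0 hp).1
        (hg.const_smul C).eLpNorm_lt_top).ne
    · filter_upwards [hlim] with x hx
      have := ((hx.smul_const (g x)).enorm).ennrpow_const p.toReal
      rwa [zero_smul, enorm_zero, ENNReal.zero_rpow_of_pos hp'] at this
  have := key.ennrpow_const (1 / p.toReal)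
  rw [lintegral_zero, ENNReal.zero_rpow_of_pos (one_div_pos.2 hp')] at this
  simpa only [TendstoLp, sub_zero, eLpNorm_eq_lintegral_rpow_enorm_toReal hp0 hp] using this

end LpConvergence

/-! ### Young's convolution inequality -/

section Young

lemma lintegral_mul_rpow_le {α : Type*} [MeasurableSpace α] {μ : Measure α} {a b : α → ℝ≥0∞}
    (ha : AEMeasurable a μ) (hb : AEMeasurable b μ) {r p s : ℝ} (hr : 1 ≤ r) (hp : 1 ≤ p)
    (hs : 0 < s) (h : r⁻¹ + p⁻¹ = 1 + s⁻¹) :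
    (∫⁻ t, a t * b t ∂μ) ^ s ≤ (∫⁻ t, a t ^ r * b t ^ p ∂μ) *
      ((∫⁻ t, a t ^ r ∂μ) ^ (s / r - 1) * (∫⁻ t, b t ^ p ∂μ) ^ (s / p - 1)) := by
  have hrs : 0 ≤ r⁻¹ - s⁻¹ := by linarith [inv_le_one_of_one_le₀ hp]
  have hps : 0 ≤ p⁻¹ - s⁻¹ := by linarith [inv_le_one_of_one_le₀ hr]
  have hsplit : ∀ t, (a t ^ r * b t ^ p) ^ s⁻¹ * (a t ^ r) ^ (r⁻¹ - s⁻¹) *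
      (b t ^ p) ^ (p⁻¹ - s⁻¹) = a t * b t := fun t => by
    rw [ENNReal.mul_rpow_of_nonneg _ _ (by positivity), mul_right_comm ((a t ^ r) ^ s⁻¹), mul_assoc,
      ← ENNReal.rpow_add_of_nonneg _ _ (by positivity) hrs,
      ← ENNReal.rpow_add_of_nonneg _ _ (by positivity) hps, add_sub_cancel, add_sub_cancel,
      ENNReal.rpow_rpow_inv (by positivity), ENNReal.rpow_rpow_inv (by positivity)]
  have hHolder := ENNReal.lintegral_prod_norm_pow_le (μ := μ) (Finset.univ : Finset (Fin 3))
    (f := ![fun t => a t ^ r * b t ^ p, fun t => a t ^ r, fun t => b t ^ p])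
    (p := ![s⁻¹, r⁻¹ - s⁻¹, p⁻¹ - s⁻¹])
    (fun i _ => by
      fin_cases i
      exacts [(ha.pow_const _).mul (hb.pow_const _), ha.pow_const _, hb.pow_const _])
    (by simp only [Fin.sum_univ_three, Matrix.cons_val]; linarith)
    (fun i _ => by
      fin_cases i
      exacts [inv_nonneg.2 hs.le, hrs, hps])
  simp only [Fin.prod_univ_three, Matrix.cons_val, hsplit] at hHolder
  refine (ENNReal.rpow_le_rpow hHolder hs.le).trans_eq ?_
  rw [ENNReal.mul_rpow_of_nonneg _ _ hs.le, ENNReal.mul_rpow_of_nonneg _ _ hs.le,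
    ENNReal.rpow_inv_rpow hs.ne', ← ENNReal.rpow_mul, ← ENNReal.rpow_mul, mul_assoc]
  congr 3 <;> field_simp

lemma lintegral_enorm_rpow_rpow_div {α E : Type*} [MeasurableSpace α] {μ : Measure α}
    [NormedAddCommGroup E] {w : α → E} {t : ℝ≥0} (ht : t ≠ 0) (s : ℝ) :
    (∫⁻ x, ‖w x‖ₑ ^ (t : ℝ) ∂μ) ^ (s / t : ℝ) = eLpNorm w t μ ^ s := by
  rw [← eLpNorm_nnreal_pow_eq_lintegral ht, ← ENNReal.rpow_mul, mul_div_cancel₀ _ (by simpa)]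

lemma ae_lt_top_of_eLpNorm_ne_top {α : Type*} [MeasurableSpace α] {μ : Measure α} {a : α → ℝ≥0∞}
    (ha : AEMeasurable a μ) {s : ℝ≥0∞} (hs : s ≠ 0) (h : eLpNorm a s μ ≠ ⊤) :
    ∀ᵐ x ∂μ, a x < ⊤ := by
  rcases eq_or_ne s ⊤ with rfl | hs'
  · rw [eLpNorm_exponent_top] at h
    exact ae_lt_of_essSup_lt h.lt_top
  rw [← lt_top_iff_ne_top, eLpNorm_lt_top_iff_lintegral_rpow_enorm_lt_top hs hs'] at h
  filter_upwards [ae_lt_top' (ha.pow_const _) h.ne] with x hx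
  exact (ENNReal.rpow_lt_top_iff_of_pos (ENNReal.toReal_pos hs hs')).1 hx

local notation "mulL" => ContinuousLinearMap.mul ℝ ℝ

lemma enorm_convolution_mul_le {G : Type*} [AddCommGroup G] [MeasurableSpace G] {μ : Measure G}
    (f g : G → ℝ) (y : G) : ‖(f ⋆[mulL, μ] g) y‖ₑ ≤ ∫⁻ t, ‖f t‖ₑ * ‖g (y - t)‖ₑ ∂μ := by
  simpa only [convolution_def, ContinuousLinearMap.mul_apply', enorm_mul] using
    enorm_integral_le_lintegral_enorm fun t => f t * g (y - t)

variable {G : Type*} [AddCommGroup G] [MeasurableSpace G] [MeasurableAdd₂ G] [MeasurableNeg G]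
  {μ : Measure G} [μ.IsAddLeftInvariant] {E F : Type*} [NormedAddCommGroup E]
  [NormedAddCommGroup F] {f : G → E} {g : G → F}

lemma lintegral_enorm_mul_enorm_sub_le [μ.IsNegInvariant] {r p : ℝ≥0∞}
    [ENNReal.HolderConjugate r p]
    (hf : AEStronglyMeasurable f μ) (hg : AEStronglyMeasurable g μ) (y : G) :
    ∫⁻ t, ‖f t‖ₑ * ‖g (y - t)‖ₑ ∂μ ≤ eLpNorm f r μ * eLpNorm g p μ := by
  have hpres := μ.measurePreserving_sub_left y
  have hHolder := eLpNorm_le_eLpNorm_mul_eLpNorm_of_nnnorm (p := r) (q := p) (r := 1) hf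
    (hg.comp_measurePreserving hpres) (fun x z => ‖x‖ * ‖z‖) 1
    (Eventually.of_forall fun t => by simp)
  rw [eLpNorm_comp_measurePreserving hg hpres, ENNReal.coe_one, one_mul,
    eLpNorm_one_eq_lintegral_enorm] at hHolder
  simpa only [Function.comp_apply, enorm_mul, enorm_norm] using hHolder

variable [SFinite μ]

lemma lintegral_lintegral_mul_sub {a b : G → ℝ≥0∞} (ha : AEMeasurable a μ)
    (hb : AEMeasurable b μ) :
    ∫⁻ y, ∫⁻ t, a t * b (y - t) ∂μ ∂μ = (∫⁻ t, a t ∂μ) * ∫⁻ t, b t ∂μ := by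
  have hmeas : AEMeasurable (fun z : G × G => a z.2 * b (z.1 - z.2)) (μ.prod μ) :=
    ha.comp_snd.mul (hb.comp_quasiMeasurePreserving (quasiMeasurePreserving_sub μ μ))
  calc ∫⁻ y, ∫⁻ t, a t * b (y - t) ∂μ ∂μ = ∫⁻ t, ∫⁻ y, a t * b (y - t) ∂μ ∂μ :=
        lintegral_lintegral_swap hmeas
    _ = ∫⁻ t, a t * ∫⁻ y, b y ∂μ ∂μ := lintegral_congr fun t => by
        have hbt : AEMeasurable (fun y => b (y - t)) μ := hb.comp_quasiMeasurePreserving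
          (measurePreserving_sub_right μ t).quasiMeasurePreserving
        rw [lintegral_const_mul'' _ hbt, lintegral_sub_right_eq_self]
    _ = _ := lintegral_mul_const'' _ ha

variable [μ.IsNegInvariant]

lemma lintegral_lintegral_mul_sub_rpow_le {a b : G → ℝ≥0∞} (ha : AEMeasurable a μ)
    (hb : AEMeasurable b μ) {r p s : ℝ} (hr : 1 ≤ r) (hp : 1 ≤ p) (hs : 0 < s)
    (h : r⁻¹ + p⁻¹ = 1 + s⁻¹) :
    ∫⁻ y, (∫⁻ t, a t * b (y - t) ∂μ) ^ s ∂μ ≤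
      (∫⁻ t, a t ^ r ∂μ) ^ (s / r) * (∫⁻ t, b t ^ p ∂μ) ^ (s / p) := by
  set A := ∫⁻ t, a t ^ r ∂μ
  set B := ∫⁻ t, b t ^ p ∂μ
  have hrs : 0 ≤ s / r - 1 := by
    rw [sub_nonneg, one_le_div₀ (by linarith), ← inv_le_inv₀ hs (by linarith)]
    linarith [inv_le_one_of_one_le₀ hp]
  have hps : 0 ≤ s / p - 1 := by
    rw [sub_nonneg, one_le_div₀ (by linarith), ← inv_le_inv₀ hs (by linarith)]
    linarith [inv_le_one_of_one_le₀ hr]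
  have hmeas : AEMeasurable (fun z : G × G => a z.2 ^ r * b (z.1 - z.2) ^ p) (μ.prod μ) :=
    (ha.comp_snd.pow_const _).mul
      ((hb.comp_quasiMeasurePreserving (quasiMeasurePreserving_sub μ μ)).pow_const _)
  calc ∫⁻ y, (∫⁻ t, a t * b (y - t) ∂μ) ^ s ∂μ
      ≤ ∫⁻ y, (∫⁻ t, a t ^ r * b (y - t) ^ p ∂μ) * (A ^ (s / r - 1) * B ^ (s / p - 1)) ∂μ :=
        lintegral_mono fun y => by
          have hHolder := lintegral_mul_rpow_le (b := fun t => b (y - t)) ha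
            (hb.comp_quasiMeasurePreserving (quasiMeasurePreserving_sub_left μ y)) hr hp hs h
          rwa [lintegral_sub_left_eq_self (fun t => b t ^ p) y] at hHolder
    _ = A * B * (A ^ (s / r - 1) * B ^ (s / p - 1)) := by
        rw [lintegral_mul_const'' _ hmeas.lintegral_prod_right',
          lintegral_lintegral_mul_sub (ha.pow_const _) (hb.pow_const _)]
    _ = (A ^ (1 : ℝ) * A ^ (s / r - 1)) * (B ^ (1 : ℝ) * B ^ (s / p - 1)) := by
        rw [ENNReal.rpow_one, ENNReal.rpow_one]; ring
    _ = _ := by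
        rw [← ENNReal.rpow_add_of_nonneg _ _ zero_le_one hrs,
          ← ENNReal.rpow_add_of_nonneg _ _ zero_le_one hps, add_sub_cancel, add_sub_cancel]

theorem eLpNorm_lintegral_enorm_mul_enorm_sub_le {r p s : ℝ≥0∞} (hr : 1 ≤ r) (hp : 1 ≤ p)
    (h : r⁻¹ + p⁻¹ = 1 + s⁻¹) (hf : AEStronglyMeasurable f μ) (hg : AEStronglyMeasurable g μ) :
    eLpNorm (fun y => ∫⁻ t, ‖f t‖ₑ * ‖g (y - t)‖ₑ ∂μ) s μ ≤ eLpNorm f r μ * eLpNorm g p μ := by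
  rcases eq_or_ne s ⊤ with rfl | hs
  · have : ENNReal.HolderConjugate r p := ENNReal.holderConjugate_iff.2 (by simpa using h)
    rw [eLpNorm_exponent_top]
    refine essSup_le_of_ae_le _ (Eventually.of_forall fun y => ?_)
    simpa only [enorm_eq_self] using lintegral_enorm_mul_enorm_sub_le hf hg y
  have hrs : r ≤ s := ENNReal.inv_le_inv.1 <| (ENNReal.add_le_add_iff_left ENNReal.one_ne_top).1 <|
    h.symm.trans_le <| (add_comm _ _).trans_le (by gcongr; exact ENNReal.inv_le_one.2 hp)
  have hps : p ≤ s := ENNReal.inv_le_inv.1 <| (ENNReal.add_le_add_iff_left ENNReal.one_ne_top).1 <|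
    h.symm.trans_le (by gcongr; exact ENNReal.inv_le_one.2 hr)
  lift s to ℝ≥0 using hs
  lift r to ℝ≥0 using ne_top_of_le_ne_top ENNReal.coe_ne_top hrs
  lift p to ℝ≥0 using ne_top_of_le_ne_top ENNReal.coe_ne_top hps
  norm_cast at hr hp hrs
  have hr0 : r ≠ 0 := (zero_lt_one.trans_le hr).ne'
  have hp0 : p ≠ 0 := (zero_lt_one.trans_le hp).ne'
  have hs0 : s ≠ 0 := (zero_lt_one.trans_le (hr.trans hrs)).ne'
  rw [← ENNReal.rpow_le_rpow_iff (z := s) (by positivity), eLpNorm_nnreal_pow_eq_lintegral hs0,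
    ENNReal.mul_rpow_of_nonneg _ _ s.coe_nonneg, ← lintegral_enorm_rpow_rpow_div hr0,
    ← lintegral_enorm_rpow_rpow_div hp0]
  rw [← ENNReal.coe_inv hr0, ← ENNReal.coe_inv hp0, ← ENNReal.coe_inv hs0] at h
  exact lintegral_lintegral_mul_sub_rpow_le hf.enorm hg.enorm (by exact_mod_cast hr)
    (by exact_mod_cast hp) (by positivity) (by exact_mod_cast h)

variable {f g : G → ℝ}

theorem eLpNorm_convolution_mul_le {r p s : ℝ≥0∞} (hr : 1 ≤ r) (hp : 1 ≤ p)
    (h : r⁻¹ + p⁻¹ = 1 + s⁻¹) (hf : AEStronglyMeasurable f μ) (hg : AEStronglyMeasurable g μ) :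
    eLpNorm (f ⋆[mulL, μ] g) s μ ≤ eLpNorm f r μ * eLpNorm g p μ :=
  (eLpNorm_mono_enorm fun y => enorm_convolution_mul_le f g y).trans
    (eLpNorm_lintegral_enorm_mul_enorm_sub_le hr hp h hf hg)

theorem memLp_convolution_mul {r p s : ℝ≥0∞} (hr : 1 ≤ r) (hp : 1 ≤ p) (h : r⁻¹ + p⁻¹ = 1 + s⁻¹)
    (hf : MemLp f r μ) (hg : MemLp g p μ) : MemLp (f ⋆[mulL, μ] g) s μ :=
  ⟨(hf.1.convolution_integrand mulL hg.1).integral_prod_right',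
    (eLpNorm_convolution_mul_le hr hp h hf.1 hg.1).trans_lt (ENNReal.mul_lt_top hf.2 hg.2)⟩

theorem ae_convolutionExistsAt_mul {r p s : ℝ≥0∞} (hr : 1 ≤ r) (hp : 1 ≤ p)
    (h : r⁻¹ + p⁻¹ = 1 + s⁻¹) (hf : MemLp f r μ) (hg : MemLp g p μ) :
    ∀ᵐ y ∂μ, ConvolutionExistsAt f g y mulL μ := by
  have hbound := (eLpNorm_lintegral_enorm_mul_enorm_sub_le hr hp h hf.1 hg.1).trans_lt
    (ENNReal.mul_lt_top hf.2 hg.2)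
  have hmeas : AEMeasurable (fun y => ∫⁻ t, ‖f t‖ₑ * ‖g (y - t)‖ₑ ∂μ) μ :=
    AEMeasurable.lintegral_prod_right' (f := fun z : G × G => ‖f z.2‖ₑ * ‖g (z.1 - z.2)‖ₑ) <|
      hf.1.enorm.comp_snd.mul
        (hg.1.enorm.comp_quasiMeasurePreserving (quasiMeasurePreserving_sub μ μ))
  have hs : s ≠ 0 := by
    rintro rfl
    simp [ENNReal.add_eq_top, (zero_lt_one.trans_le hr).ne', (zero_lt_one.trans_le hp).ne'] at h
  filter_upwards [ae_lt_top_of_eLpNorm_ne_top hmeas hs hbound.ne] with y hy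
  refine ⟨hf.1.mul (hg.1.comp_quasiMeasurePreserving (quasiMeasurePreserving_sub_left μ y)), ?_⟩
  simpa only [HasFiniteIntegral, ContinuousLinearMap.mul_apply', enorm_mul] using hy

end Young

/-! ### Sobolev and trace inequalities for smooth functions on the half-space -/

section HalfSpace

variable {N : ℕ}

lemma halfMeasure_eq_prod (N : ℕ) :
    halfMeasure N = ((volume : Measure ℝ).restrict (Ioi 0)).prod (volume : Measure (Bdry N)) := by
  have h : halfSpace N = Ioi (0 : ℝ) ×ˢ (univ : Set (Bdry N)) := by
    ext z; simp [halfSpace]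
  rw [halfMeasure, h, Measure.volume_eq_prod, ← Measure.prod_restrict, Measure.restrict_univ]

lemma isOpen_halfSpace (N : ℕ) : IsOpen (halfSpace N) :=
  isOpen_lt continuous_const continuous_fst

instance (N : ℕ) : (volume : Measure (Amb N)).IsAddHaarMeasure :=
  Measure.prod.instIsAddHaarMeasure (volume : Measure ℝ) (volume : Measure (Bdry N))

lemma finrank_amb (N : ℕ) : Module.finrank ℝ (Amb N) = N + 1 := by
  simp [add_comm]

lemma lintegral_comp_abs (g : ℝ → ℝ≥0∞) : ∫⁻ x, g |x| = 2 * ∫⁻ x in Ioi 0, g x := by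
  rw [← lintegral_add_compl _ (measurableSet_Ioi (a := (0 : ℝ))), compl_Ioi, two_mul]
  congr 1
  · exact setLIntegral_congr_fun measurableSet_Ioi fun x hx => by rw [abs_of_pos hx]
  · rw [setLIntegral_congr (Iio_ae_eq_Iic (a := (0 : ℝ))).symm]
    have hneg := (Measure.measurePreserving_neg (volume : Measure ℝ)).setLIntegral_comp_preimage_emb
      (MeasurableEquiv.neg ℝ).measurableEmbedding g (Ioi 0)
    simp only [neg_preimage, neg_Ioi, neg_zero] at hneg
    rw [← hneg]
    exact setLIntegral_congr_fun measurableSet_Iio fun x hx => by rw [abs_of_neg hx]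

lemma lintegral_comp_abs_fst {G : Amb N → ℝ≥0∞} (hG : Measurable G) :
    ∫⁻ z : Amb N, G (|z.1|, z.2) = 2 * ∫⁻ z, G z ∂(halfMeasure N) := by
  rw [halfMeasure_eq_prod, lintegral_prod _ hG.aemeasurable, Measure.volume_eq_prod,
    lintegral_prod _ (by fun_prop), lintegral_comp_abs fun x => ∫⁻ y, G (x, y)]

/-- The smooth 1-Lipschitz approximation `(x, y) ↦ (√(x² + ε²), y)` of the reflection
`(x, y) ↦ (|x|, y)`; composition with it extends smooth functions on the half-space to smooth
functions on the whole space. -/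
noncomputable def softAbs (N : ℕ) (ε : ℝ) (z : Amb N) : Amb N := (√(z.1 ^ 2 + ε ^ 2), z.2)

lemma contDiff_softAbs {ε : ℝ} (hε : ε ≠ 0) : ContDiff ℝ ∞ (softAbs N ε) := by
  refine ContDiff.prodMk (ContDiff.sqrt (by fun_prop) fun z => ?_) contDiff_snd
  positivity

lemma norm_le_norm_softAbs (ε : ℝ) (z : Amb N) : ‖z‖ ≤ ‖softAbs N ε z‖ := by
  refine max_le_max ?_ le_rfl
  simp only [softAbs, Real.norm_eq_abs, abs_of_nonneg (Real.sqrt_nonneg _)]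
  exact Real.abs_le_sqrt (by linarith [sq_nonneg ε])

lemma sqrt_sq_add_sq_le (a b ε : ℝ) : √(a ^ 2 + ε ^ 2) ≤ √(b ^ 2 + ε ^ 2) + |a - b| := by
  have hb : |b| ≤ √(b ^ 2 + ε ^ 2) := Real.abs_le_sqrt (by linarith [sq_nonneg ε])
  have hcross : b * (a - b) ≤ √(b ^ 2 + ε ^ 2) * |a - b| :=
    (le_abs_self _).trans (by rw [abs_mul]; gcongr)
  refine Real.sqrt_le_iff.2 ⟨by positivity, ?_⟩
  nlinarith [sq_abs (a - b), Real.sq_sqrt (show 0 ≤ b ^ 2 + ε ^ 2 by positivity)]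

lemma lipschitzWith_softAbs (ε : ℝ) : LipschitzWith 1 (softAbs N ε) := by
  refine LipschitzWith.of_dist_le_mul fun z w => ?_
  rw [NNReal.coe_one, one_mul]
  refine max_le_max (abs_sub_le_iff.2 ⟨?_, ?_⟩) le_rfl
  · exact sub_le_iff_le_add'.2 (sqrt_sq_add_sq_le z.1 w.1 ε)
  · rw [dist_comm]
    exact sub_le_iff_le_add'.2 (sqrt_sq_add_sq_le w.1 z.1 ε)

lemma tendsto_softAbs (z : Amb N) :
    Tendsto (fun n : ℕ => softAbs N (1 / ((n : ℝ) + 1)) z) atTop (𝓝 (|z.1|, z.2)) := by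
  have hcont : Continuous fun ε : ℝ => softAbs N ε z := by unfold softAbs; fun_prop
  simpa [softAbs, Real.sqrt_sq_eq_abs, Function.comp_def] using
    (hcont.tendsto 0).comp tendsto_one_div_add_atTop_nhds_zero_nat

lemma hasCompactSupport_comp_of_norm_le {E F G : Type*} [NormedAddCommGroup E] [ProperSpace E]
    [NormedAddCommGroup F] [Zero G] {φ : F → G} (hφ : HasCompactSupport φ) {g : E → F}
    (hg : ∀ z, ‖z‖ ≤ ‖g z‖) : HasCompactSupport fun z => φ (g z) := by
  obtain ⟨R, hR⟩ := hφ.isCompact.isBounded.subset_closedBall (0 : F)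
  refine HasCompactSupport.intro (isCompact_closedBall (0 : E) R) fun z hz => ?_
  refine image_eq_zero_of_notMem_tsupport fun h => hz (mem_closedBall_zero_iff.2 ?_)
  exact (hg z).trans (mem_closedBall_zero_iff.1 (hR h))

lemma norm_fderiv_comp_le_of_lipschitzWith_one {E F G : Type*} [NormedAddCommGroup E]
    [NormedSpace ℝ E] [NormedAddCommGroup F] [NormedSpace ℝ F] [NormedAddCommGroup G]
    [NormedSpace ℝ G] {φ : F → G} {g : E → F} {x : E} (hφ : DifferentiableAt ℝ φ (g x))
    (hg : DifferentiableAt ℝ g x) (hlip : LipschitzWith 1 g) :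
    ‖fderiv ℝ (fun z => φ (g z)) x‖ ≤ ‖fderiv ℝ φ (g x)‖ := by
  have hg1 : ‖fderiv ℝ g x‖ ≤ 1 := by simpa using norm_fderiv_le_of_lipschitz ℝ (x₀ := x) hlip
  have hcomp : fderiv ℝ (fun z => φ (g z)) x = (fderiv ℝ φ (g x)).comp (fderiv ℝ g x) :=
    fderiv_comp x hφ hg
  rw [hcomp]
  exact (ContinuousLinearMap.opNorm_comp_le _ _).trans
    (mul_le_of_le_one_right (norm_nonneg _) hg1)

lemma tendsto_lintegral_comp_softAbs {E : Type*} [NormedAddCommGroup E] {g : Amb N → E} {p : ℝ}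
    (hg : Continuous g) (hgc : HasCompactSupport g) (hp : 0 < p) :
    Tendsto (fun n : ℕ => ∫⁻ z : Amb N, ‖g (softAbs N (1 / ((n : ℝ) + 1)) z)‖ₑ ^ p) atTop
      (𝓝 (2 * ∫⁻ z, ‖g z‖ₑ ^ p ∂(halfMeasure N))) := by
  obtain ⟨R, hR⟩ := hgc.isCompact.isBounded.subset_closedBall (0 : Amb N)
  obtain ⟨M, hM⟩ := hg.bounded_above_of_compact_support hgc
  have hGc : Continuous fun z => ‖g z‖ₑ ^ p :=
    ENNReal.continuous_rpow_const.comp hg.enorm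
  rw [← lintegral_comp_abs_fst (G := fun z => ‖g z‖ₑ ^ p) hGc.measurable]
  refine tendsto_lintegral_of_dominated_convergence
    ((Metric.closedBall (0 : Amb N) R).indicator fun _ => ENNReal.ofReal M ^ p)
    (fun n => ?_) (fun n => Eventually.of_forall fun z => ?_) ?_
    (Eventually.of_forall fun z => (hGc.tendsto _).comp (tendsto_softAbs z))
  · exact (hGc.comp (lipschitzWith_softAbs _).continuous).measurable
  · beta_reduce
    by_cases hz : z ∈ Metric.closedBall (0 : Amb N) R
    · rw [indicator_of_mem hz, ← ofReal_norm]
      exact ENNReal.rpow_le_rpow (ENNReal.ofReal_le_ofReal (hM _)) hp.le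
    · have hzero : g (softAbs N (1 / ((n : ℝ) + 1)) z) = 0 :=
        image_eq_zero_of_notMem_tsupport fun h => hz <| mem_closedBall_zero_iff.2 <|
          (norm_le_norm_softAbs _ z).trans (mem_closedBall_zero_iff.1 (hR h))
      rw [hzero, enorm_zero, ENNReal.zero_rpow_of_pos hp]
      exact zero_le
  · rw [lintegral_indicator measurableSet_closedBall, setLIntegral_const]
    exact ENNReal.mul_ne_top (ENNReal.rpow_ne_top_of_nonneg hp.le ENNReal.ofReal_ne_top)
      measure_closedBall_lt_top.ne

lemma tendsto_eLpNorm_comp_softAbs {E : Type*} [NormedAddCommGroup E] {g : Amb N → E} {p : ℝ≥0}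
    (hg : Continuous g) (hgc : HasCompactSupport g) (hp : 0 < p) :
    Tendsto (fun n : ℕ => eLpNorm (fun z => g (softAbs N (1 / ((n : ℝ) + 1)) z)) p volume) atTop
      (𝓝 (2 ^ (1 / (p : ℝ)) * eLpNorm g p (halfMeasure N))) := by
  have hp0 : (p : ℝ≥0∞) ≠ 0 := ENNReal.coe_ne_zero.2 hp.ne'
  have hlim := (tendsto_lintegral_comp_softAbs hg hgc (NNReal.coe_pos.2 hp)).ennrpow_const
    (1 / (p : ℝ))
  rw [ENNReal.mul_rpow_of_nonneg _ _ (by positivity)] at hlim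
  simpa only [eLpNorm_eq_lintegral_rpow_enorm_toReal hp0 ENNReal.coe_ne_top,
    ENNReal.coe_toReal] using hlim

/- The Sobolev inequality on the whole space is applied to the smooth even extensions
`φ ∘ softAbs`. -/
lemma exists_eLpNorm_le_eLpNorm_fderiv_halfMeasure (N : ℕ) {p : ℝ≥0}
    (hp : (p : ℝ)⁻¹ = (2 : ℝ)⁻¹ - ((N : ℝ) + 1)⁻¹) :
    ∃ C : ℝ≥0, ∀ φ : Amb N → ℝ, ContDiff ℝ ∞ φ → HasCompactSupport φ →
      eLpNorm φ p (halfMeasure N) ≤ C * eLpNorm (fderiv ℝ φ) 2 (halfMeasure N) := by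
  set C := SNormLESNormFDerivOfEqConst ℝ (volume : Measure (Amb N)) (2 : ℝ≥0)
  refine ⟨C * 2 ^ (1 / 2 : ℝ), fun φ hφ hφc => ?_⟩
  set S : ℕ → Amb N → Amb N := fun n => softAbs N (1 / ((n : ℝ) + 1))
  have hS : ∀ n, ContDiff ℝ ∞ (S n) := fun n => contDiff_softAbs (by positivity)
  have hext : ∀ n, ContDiff ℝ ∞ fun z => φ (S n z) := fun n => hφ.comp (hS n)
  have sobolev : ∀ n, eLpNorm (fun z => φ (S n z)) p (halfMeasure N) ≤
      C * eLpNorm (fun z => fderiv ℝ φ (S n z)) 2 volume := fun n =>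
    calc eLpNorm (fun z => φ (S n z)) p (halfMeasure N)
        ≤ eLpNorm (fun z => φ (S n z)) p volume := eLpNorm_mono_measure _ Measure.restrict_le_self
      _ ≤ C * eLpNorm (fderiv ℝ fun z => φ (S n z)) 2 volume :=
          eLpNorm_le_eLpNorm_fderiv_of_eq (F := ℝ) (volume : Measure (Amb N))
            ((hext n).of_le (by simp))
            (hasCompactSupport_comp_of_norm_le hφc fun z => norm_le_norm_softAbs _ z)
            (p := 2) (p' := p) (by norm_num) (by rw [finrank_amb]; omega)
            (by rw [finrank_amb, hp]; push_cast; ring)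
      _ ≤ _ := by
          gcongr
          exact eLpNorm_mono fun z => norm_fderiv_comp_le_of_lipschitzWith_one
            (hφ.differentiable (by simp) _) ((hS n).differentiable (by simp) z)
            (lipschitzWith_softAbs _)
  have hlim := tendsto_eLpNorm_comp_softAbs (p := 2) (hφ.continuous_fderiv (by simp))
    (hφc.fderiv (𝕜 := ℝ)) two_pos
  refine (eLpNorm_le_of_tendsto_ae (fun n => (hext n).continuous.aestronglyMeasurable) ?_ sobolev
    (ENNReal.Tendsto.const_mul hlim (Or.inr ENNReal.coe_ne_top))).trans_eq ?_
  · filter_upwards [ae_restrict_mem (isOpen_halfSpace N).measurableSet] with z hz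
    have := (hφ.continuous.tendsto _).comp (tendsto_softAbs z)
    rwa [abs_of_pos hz] at this
  · rw [ENNReal.coe_mul, ENNReal.coe_rpow_of_nonneg _ (by norm_num), mul_assoc]
    simp

lemma enorm_rpow_le_lintegral_Ioi {ψ : ℝ → ℝ} (hψ : ContDiff ℝ 1 ψ) (hψc : HasCompactSupport ψ)
    {s : ℝ≥0} (hs : 1 < s) (a : ℝ) :
    ‖ψ a‖ₑ ^ (s : ℝ) ≤ ∫⁻ x in Ioi a, s * ‖ψ x‖ₑ ^ ((s : ℝ) - 1) * ‖fderiv ℝ ψ x‖ₑ := by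
  have hs0 : (0 : ℝ) < s := zero_lt_one.trans (NNReal.coe_lt_coe.2 hs)
  have hpow : ContDiff ℝ 1 fun x => ‖ψ x‖ ^ (s : ℝ) := (contDiff_norm_rpow (E := ℝ) hs).comp hψ
  have hpowc : HasCompactSupport fun x => ‖ψ x‖ ^ (s : ℝ) :=
    hψc.comp_left (g := fun t : ℝ => ‖t‖ ^ (s : ℝ)) (by simp [hs0.ne'])
  calc ‖ψ a‖ₑ ^ (s : ℝ) = ‖∫ x in Ioi a, deriv (fun x => ‖ψ x‖ ^ (s : ℝ)) x‖ₑ := by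
        rw [hpowc.integral_Ioi_deriv_eq hpow a, enorm_neg,
          Real.enorm_rpow_of_nonneg (norm_nonneg _) hs0.le, enorm_norm]
    _ ≤ ∫⁻ x in Ioi a, ‖deriv (fun x => ‖ψ x‖ ^ (s : ℝ)) x‖ₑ := enorm_integral_le_lintegral_enorm _
    _ ≤ _ := lintegral_mono fun x => by
        refine Eq.trans_le ?_
          (enorm_fderiv_norm_rpow_le (F := ℝ) (hψ.differentiable (by simp)) (x := x) hs)
        rw [← ofReal_norm, ← ofReal_norm, norm_deriv_eq_norm_fderiv]

lemma enorm_trace_rpow_le_lintegral_Ioi {s : ℝ≥0} (hs : 1 < s) {φ : Amb N → ℝ}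
    (hφ : ContDiff ℝ 1 φ) (hφc : HasCompactSupport φ) (y : Bdry N) :
    ‖φ (0, y)‖ₑ ^ (s : ℝ) ≤
      ∫⁻ x in Ioi (0 : ℝ), s * ‖φ (x, y)‖ₑ ^ ((s : ℝ) - 1) * ‖fderiv ℝ φ (x, y)‖ₑ := by
  have hline : LipschitzWith 1 fun x : ℝ => (x, y) :=
    LipschitzWith.of_dist_le_mul fun x x' => by simp
  refine (enorm_rpow_le_lintegral_Ioi (ψ := fun x => φ (x, y)) (hφ.comp (by fun_prop))
    (hasCompactSupport_comp_of_norm_le hφc fun x => le_max_left _ _) hs 0).trans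
    (lintegral_mono fun x => ?_)
  rw [← ofReal_norm (fderiv ℝ _ x), ← ofReal_norm (fderiv ℝ φ _)]
  gcongr
  exact norm_fderiv_comp_le_of_lipschitzWith_one (hφ.differentiable (by simp) _)
    (by fun_prop) hline

lemma lintegral_trace_rpow_le {s : ℝ≥0} (hs : 1 < s) {φ : Amb N → ℝ}
    (hφ : ContDiff ℝ 1 φ) (hφc : HasCompactSupport φ) :
    ∫⁻ y, ‖φ ((0 : ℝ), y)‖ₑ ^ (s : ℝ) ≤
      s * (eLpNorm φ ↑(2 * (s - 1)) (halfMeasure N) ^ ((s : ℝ) - 1) *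
        eLpNorm (fderiv ℝ φ) 2 (halfMeasure N)) := by
  have hs' : (1 : ℝ) < s := NNReal.coe_lt_coe.2 hs
  have hφ' : Continuous (fderiv ℝ φ) := hφ.continuous_fderiv (by simp)
  have hpow : Continuous fun z => ‖φ z‖ ^ ((s : ℝ) - 1) :=
    hφ.continuous.norm.rpow_const fun _ => Or.inr (by linarith)
  have hmeas : Measurable fun z : Amb N => (s : ℝ≥0∞) * ‖φ z‖ₑ ^ ((s : ℝ) - 1) * ‖fderiv ℝ φ z‖ₑ :=
    ((hφ.continuous.enorm.measurable.pow_const _).const_mul _).mul hφ'.enorm.measurable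
  calc ∫⁻ y, ‖φ ((0 : ℝ), y)‖ₑ ^ (s : ℝ)
      ≤ ∫⁻ y : Bdry N, ∫⁻ x in Ioi (0 : ℝ),
        s * ‖φ (x, y)‖ₑ ^ ((s : ℝ) - 1) * ‖fderiv ℝ φ (x, y)‖ₑ :=
        lintegral_mono (enorm_trace_rpow_le_lintegral_Ioi hs hφ hφc)
    _ = ∫⁻ z, s * ‖φ z‖ₑ ^ ((s : ℝ) - 1) * ‖fderiv ℝ φ z‖ₑ ∂(halfMeasure N) := by
        rw [halfMeasure_eq_prod, lintegral_prod_symm _ hmeas.aemeasurable]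
    _ = s * eLpNorm ((fun z => ‖φ z‖ ^ ((s : ℝ) - 1)) • fderiv ℝ φ) 1 (halfMeasure N) := by
        rw [eLpNorm_one_eq_lintegral_enorm, ← lintegral_const_mul' _ _ ENNReal.coe_ne_top]
        simp only [Pi.smul_apply', enorm_smul, mul_assoc]
        simp only [Real.enorm_rpow_of_nonneg (norm_nonneg _) (sub_nonneg.2 hs'.le), enorm_norm]
    _ ≤ s * (eLpNorm (fun z => ‖φ z‖ ^ ((s : ℝ) - 1)) 2 (halfMeasure N) *
          eLpNorm (fderiv ℝ φ) 2 (halfMeasure N)) := by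
        gcongr
        exact eLpNorm_smul_le_mul_eLpNorm hφ'.aestronglyMeasurable hpow.aestronglyMeasurable
    _ = _ := by
        have hsub : (s : ℝ) - 1 = (s - 1 : ℝ≥0) := (NNReal.coe_sub hs.le).symm
        rw [eLpNorm_norm_rpow _ (sub_pos.2 hs'), hsub, ENNReal.ofReal_coe_nnreal, ENNReal.coe_mul,
          ENNReal.coe_ofNat]

/-- The exponent `2N/(N-1)` of the trace embedding `H¹(ℝ^{N+1}_+) → L^s(ℝ^N)`; subtraction is
truncated, so the value at `N ≤ 1` is junk. -/
noncomputable def traceExponent (N : ℕ) : ℝ≥0 := 2 * N / (N - 1)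

lemma coe_traceExponent (hN : 1 ≤ N) : (traceExponent N : ℝ) = 2 * N / (N - 1) := by
  rw [traceExponent, NNReal.coe_div, NNReal.coe_sub (by exact_mod_cast hN)]
  push_cast
  rfl

lemma two_mul_inv_traceExponent (hN : 1 ≤ N) :
    2 * (traceExponent N : ℝ)⁻¹ = 1 - (N : ℝ)⁻¹ := by
  rw [coe_traceExponent hN]
  field_simp

lemma two_lt_traceExponent (hN : 2 ≤ N) : 2 < traceExponent N := by
  have hN' : (2 : ℝ) ≤ N := by exact_mod_cast hN
  rw [← NNReal.coe_lt_coe, coe_traceExponent (by omega), NNReal.coe_ofNat,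
    lt_div_iff₀ (by linarith)]
  linarith

lemma exists_eLpNorm_trace_le_eLpNorm_fderiv (hN : 2 ≤ N) :
    ∃ C : ℝ≥0, ∀ φ : Amb N → ℝ, ContDiff ℝ ∞ φ → HasCompactSupport φ →
      eLpNorm (fun y => φ (0, y)) (traceExponent N) volume ≤
        C * eLpNorm (fderiv ℝ φ) 2 (halfMeasure N) := by
  have hN' : (2 : ℝ) ≤ N := by exact_mod_cast hN
  set s := traceExponent N
  have hs1 : 1 < s := one_lt_two.trans (two_lt_traceExponent hN)
  have hs1' : (1 : ℝ) < s := NNReal.coe_lt_coe.2 hs1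
  have hs0 : (0 : ℝ) < s := zero_lt_one.trans hs1'
  obtain ⟨C, hC⟩ := exists_eLpNorm_le_eLpNorm_fderiv_halfMeasure N (p := 2 * (s - 1)) (by
    rw [NNReal.coe_mul, NNReal.coe_sub hs1.le, coe_traceExponent (by omega), NNReal.coe_ofNat,
      NNReal.coe_one]
    have hN1 : (N : ℝ) - 1 ≠ 0 := by linarith
    have hN2 : 2 * (N : ℝ) - (N - 1) ≠ 0 := by linarith
    field_simp
    ring)
  refine ⟨(s * C ^ ((s : ℝ) - 1)) ^ (1 / (s : ℝ)), fun φ hφ hφc => ?_⟩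
  set D := eLpNorm (fderiv ℝ φ) 2 (halfMeasure N)
  rw [← ENNReal.rpow_le_rpow_iff hs0, eLpNorm_nnreal_pow_eq_lintegral (zero_lt_one.trans hs1).ne']
  calc ∫⁻ y, ‖φ ((0 : ℝ), y)‖ₑ ^ (s : ℝ)
      ≤ s * (eLpNorm φ ↑(2 * (s - 1)) (halfMeasure N) ^ ((s : ℝ) - 1) * D) :=
        lintegral_trace_rpow_le hs1 (hφ.of_le (by simp)) hφc
    _ ≤ s * ((C * D) ^ ((s : ℝ) - 1) * D) := by
        gcongr
        exact hC φ hφ hφc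
    _ = s * C ^ ((s : ℝ) - 1) * D ^ (s : ℝ) := by
        rw [ENNReal.mul_rpow_of_nonneg _ _ (by linarith), mul_assoc, mul_assoc]
        congr 2
        nth_rewrite 2 [← ENNReal.rpow_one D]
        rw [← ENNReal.rpow_add_of_nonneg _ _ (by linarith) zero_le_one, sub_add_cancel]
    _ = _ := by
        rw [ENNReal.mul_rpow_of_nonneg _ _ hs0.le, ENNReal.coe_rpow_of_nonneg _ (by positivity),
          ← ENNReal.rpow_mul, one_div_mul_cancel hs0.ne', ENNReal.rpow_one, ENNReal.coe_mul,
          ENNReal.coe_rpow_of_nonneg _ (by linarith)]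

end HalfSpace

/-! ### Weak gradients and traces as limits of test functions -/

section WeakGradient

variable {N : ℕ} {v : Amb N → ℝ} {G H : Amb N → Amb N} {φ : ℕ → Amb N → ℝ}

/-- The scalar product `dot` as a continuous bilinear map. -/
noncomputable def dotL (N : ℕ) : Amb N →L[ℝ] Amb N →L[ℝ] ℝ :=
  (ContinuousLinearMap.mul ℝ ℝ).bilinearComp (.fst ℝ ℝ (Bdry N)) (.fst ℝ ℝ (Bdry N)) +
    (isBoundedBilinearMap_inner (𝕜 := ℝ)).toContinuousLinearMap.bilinearComp
      (.snd ℝ ℝ (Bdry N)) (.snd ℝ ℝ (Bdry N))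

@[simp]
lemma dotL_apply (a b : Amb N) : dotL N a b = dot a b := rfl

lemma dot_self_eq (a : Amb N) : dot a a = a.1 ^ 2 + ‖a.2‖ ^ 2 := by
  rw [dot, real_inner_self_eq_norm_sq, ← sq]

lemma dot_self_nonneg (a : Amb N) : 0 ≤ dot a a := by
  rw [dot_self_eq]
  positivity

lemma norm_dotL_sq_le (a : Amb N) : ‖dotL N a‖ ^ 2 ≤ 2 * dot a a := by
  have hop : ‖dotL N a‖ ≤ |a.1| + ‖a.2‖ := by
    refine ContinuousLinearMap.opNorm_le_bound _ (by positivity) fun b => ?_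
    calc ‖dotL N a b‖ ≤ |a.1 * b.1| + |inner ℝ a.2 b.2| := abs_add_le _ _
      _ ≤ |a.1| * ‖b‖ + ‖a.2‖ * ‖b‖ := by
          rw [abs_mul]
          gcongr
          · exact norm_fst_le b
          · exact (abs_real_inner_le_norm _ _).trans (by gcongr; exact norm_snd_le b)
      _ = _ := by ring
  calc ‖dotL N a‖ ^ 2 ≤ (|a.1| + ‖a.2‖) ^ 2 := by gcongr
    _ ≤ 2 * (|a.1| ^ 2 + ‖a.2‖ ^ 2) := by linarith [sq_nonneg (|a.1| - ‖a.2‖)]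
    _ = 2 * dot a a := by rw [dot_self_eq, sq_abs]

lemma eq_zero_of_dotL_eq_zero {a : Amb N} (ha : dotL N a = 0) : a = 0 := by
  have h : a.1 ^ 2 + ‖a.2‖ ^ 2 = 0 := by rw [← dot_self_eq, ← dotL_apply, ha]; rfl
  have h1 : a.1 = 0 := by nlinarith [sq_nonneg a.1, sq_nonneg ‖a.2‖]
  have h2 : ‖a.2‖ = 0 := by nlinarith [sq_nonneg a.1, sq_nonneg ‖a.2‖]
  exact Prod.ext h1 (norm_eq_zero.1 h2)

lemma eLpNorm_dotL_sq_le {μ : Measure (Amb N)} (hG : MemLp G 2 μ) :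
    eLpNorm (fun z => dotL N (G z)) 2 μ ^ 2 ≤ 2 * ENNReal.ofReal (∫ z, dot (G z) (G z) ∂μ) := by
  have hint : Integrable (fun z => dot (G z) (G z)) μ :=
    memLp_one_iff_integrable.1 ((dotL N).memLp_of_bilin 1 hG hG)
  rw [ofReal_integral_eq_lintegral_ofReal hint (Eventually.of_forall fun z => dot_self_nonneg _),
    ← lintegral_const_mul' _ _ ENNReal.ofNat_ne_top]
  have hpow := eLpNorm_nnreal_pow_eq_lintegral (μ := μ) (f := fun z => dotL N (G z)) (two_ne_zero)
  simp only [ENNReal.coe_ofNat, NNReal.coe_ofNat, ENNReal.rpow_ofNat] at hpow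
  rw [hpow]
  refine lintegral_mono fun z => ?_
  calc ‖dotL N (G z)‖ₑ ^ 2 = ENNReal.ofReal (‖dotL N (G z)‖ ^ 2) := by
        rw [← ofReal_norm, ENNReal.ofReal_pow (norm_nonneg _)]
    _ ≤ ENNReal.ofReal (2 * dot (G z) (G z)) := ENNReal.ofReal_le_ofReal (norm_dotL_sq_le _)
    _ = 2 * ENNReal.ofReal (dot (G z) (G z)) := by
        rw [ENNReal.ofReal_mul zero_le_two, ENNReal.ofReal_ofNat]

/- The operator norm is controlled by the values on a basis. -/
lemma tendstoLp_of_forall_apply {α E F : Type*} [MeasurableSpace α] {μ : Measure α}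
    [NormedAddCommGroup E] [NormedSpace ℝ E] [FiniteDimensional ℝ E] [NormedAddCommGroup F]
    [NormedSpace ℝ F] {p : ℝ≥0∞} (hp : 1 ≤ p) {L : ℕ → α → E →L[ℝ] F} {A : α → E →L[ℝ] F}
    (hL : ∀ n, AEStronglyMeasurable (L n) μ) (hA : AEStronglyMeasurable A μ)
    (h : ∀ e, TendstoLp p μ (fun n x => L n x e) fun x => A x e) : TendstoLp p μ L A := by
  obtain ⟨C, -, hC⟩ := (Module.finBasis ℝ E).exists_opNorm_le (F := F)
  set b := Module.finBasis ℝ E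
  have hbound : ∀ n x, ‖L n x - A x‖ ≤ C * ‖(∑ i, fun x => ‖(L n x - A x) (b i)‖) x‖ := by
    intro n x
    rw [Finset.sum_apply, Real.norm_of_nonneg (Finset.sum_nonneg fun _ _ => norm_nonneg _)]
    exact hC (Finset.sum_nonneg fun _ _ => norm_nonneg _) fun i =>
      Finset.single_le_sum (f := fun i => ‖(L n x - A x) (b i)‖) (fun _ _ => norm_nonneg _)
        (Finset.mem_univ i)
  have hlim : Tendsto (fun n => ENNReal.ofReal C *
      ∑ i, eLpNorm (fun x => L n x (b i) - A x (b i)) p μ) atTop (𝓝 0) := by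
    simpa only [Finset.sum_const_zero, mul_zero] using ENNReal.Tendsto.const_mul
      (tendsto_finsetSum Finset.univ fun i _ => h (b i)) (Or.inr ENNReal.ofReal_ne_top)
  refine tendsto_of_tendsto_of_tendsto_of_le_of_le tendsto_const_nhds hlim (fun _ => zero_le)
    fun n => ?_
  calc eLpNorm (fun x => L n x - A x) p μ
      ≤ ENNReal.ofReal C * eLpNorm (∑ i, fun x => ‖(L n x - A x) (b i)‖) p μ :=
        eLpNorm_le_mul_eLpNorm_of_ae_le_mul (Eventually.of_forall (hbound n)) p
    _ ≤ ENNReal.ofReal C * ∑ i, eLpNorm (fun x => ‖(L n x - A x) (b i)‖) p μ := by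
        gcongr
        exact eLpNorm_sum_le (fun i _ => (((hL n).sub hA).apply_continuousLinearMap _).norm) hp
    _ = _ := by simp only [eLpNorm_norm, _root_.sub_apply]

/-- The test functions `φ n` approximate `v`, with gradient `G`, in `H¹(ℝ^{N+1}_+)`.  Derivatives
are compared as linear forms, `G z` standing for `dot (G z)`. -/
structure TestApprox (φ : ℕ → Amb N → ℝ) (v : Amb N → ℝ) (G : Amb N → Amb N) : Prop where
  contDiff : ∀ n, ContDiff ℝ ∞ (φ n)
  hasCompactSupport : ∀ n, HasCompactSupport (φ n)
  memLp : MemLp v 2 (halfMeasure N)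
  memLp_grad : MemLp G 2 (halfMeasure N)
  tendsto : TendstoLp 2 (halfMeasure N) φ v
  tendsto_fderiv : TendstoLp 2 (halfMeasure N) (fun n => fderiv ℝ (φ n)) fun z => dotL N (G z)

lemma TestApprox.comp_strictMono (h : TestApprox φ v G) {ns : ℕ → ℕ} (hns : StrictMono ns) :
    TestApprox (fun n => φ (ns n)) v G where
  contDiff n := h.contDiff (ns n)
  hasCompactSupport n := h.hasCompactSupport (ns n)
  memLp := h.memLp
  memLp_grad := h.memLp_grad
  tendsto := h.tendsto.comp_strictMono hns
  tendsto_fderiv := h.tendsto_fderiv.comp_strictMono hns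

lemma memLp_halfMeasure {E : Type*} [NormedAddCommGroup E] {g : Amb N → E}
    (hg : Continuous g) (hgc : HasCompactSupport g) (p : ℝ≥0∞) : MemLp g p (halfMeasure N) :=
  (hg.memLp_of_hasCompactSupport hgc).restrict _

lemma setIntegral_mul_fderiv_eq_neg {ψ η : Amb N → ℝ} (hψ : ContDiff ℝ 1 ψ) (hη : ContDiff ℝ 1 η)
    (hηc : HasCompactSupport η) (hηs : tsupport η ⊆ halfSpace N) (e : Amb N) :
    ∫ z, ψ z * fderiv ℝ η z e ∂(halfMeasure N) = -∫ z, fderiv ℝ ψ z e * η z ∂(halfMeasure N) := by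
  have hη0 : ∀ z ∉ halfSpace N, η z = 0 := fun z hz =>
    image_eq_zero_of_notMem_tsupport fun h => hz (hηs h)
  have hη1 : ∀ z ∉ halfSpace N, fderiv ℝ η z e = 0 := fun z hz => by
    rw [image_eq_zero_of_notMem_tsupport fun h => hz (hηs (tsupport_fderiv_subset ℝ h))]
    rfl
  have hψ' := (hψ.continuous_fderiv (by simp)).clm_apply (continuous_const (y := e))
  have hη' := (hη.continuous_fderiv (by simp)).clm_apply (continuous_const (y := e))
  rw [halfMeasure,
    setIntegral_eq_integral_of_forall_compl_eq_zero fun z h => by rw [hη1 z h, mul_zero],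
    setIntegral_eq_integral_of_forall_compl_eq_zero fun z h => by rw [hη0 z h, mul_zero]]
  exact integral_mul_fderiv_eq_neg_fderiv_mul_of_integrable
    ((hψ'.mul hη.continuous).integrable_of_hasCompactSupport hηc.mul_left)
    ((hψ.continuous.mul hη').integrable_of_hasCompactSupport
      (hηc.fderiv_apply (𝕜 := ℝ) e).mul_left)
    ((hψ.continuous.mul hη.continuous).integrable_of_hasCompactSupport hηc.mul_left)
    (fun z _ => hψ.differentiable (by simp) z) fun z _ => hη.differentiable (by simp) z

namespace TestApprox

lemma memLp_test (h : TestApprox φ v G) (n : ℕ) : MemLp (φ n) 2 (halfMeasure N) :=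
  memLp_halfMeasure (h.contDiff n).continuous (h.hasCompactSupport n) 2

lemma memLp_fderiv (h : TestApprox φ v G) (n : ℕ) : MemLp (fderiv ℝ (φ n)) 2 (halfMeasure N) :=
  memLp_halfMeasure ((h.contDiff n).continuous_fderiv (by simp))
    ((h.hasCompactSupport n).fderiv (𝕜 := ℝ)) 2

lemma memLp_dotL (h : TestApprox φ v G) : MemLp (fun z => dotL N (G z)) 2 (halfMeasure N) :=
  (dotL N).comp_memLp' h.memLp_grad

lemma continuous_trace (h : TestApprox φ v G) (n : ℕ) : Continuous fun y : Bdry N => φ n (0, y) :=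
  (h.contDiff n).continuous.comp (by fun_prop)

lemma isWeakGrad (h : TestApprox φ v G) : IsWeakGrad v G := by
  refine ⟨h.memLp_grad, fun η hη hηc hηs e => ?_⟩
  have hη2 := memLp_halfMeasure hη.continuous hηc 2
  have hη'2 : MemLp (fun z => fderiv ℝ η z e) 2 (halfMeasure N) :=
    memLp_halfMeasure ((hη.continuous_fderiv (by simp)).clm_apply continuous_const)
      (hηc.fderiv_apply (𝕜 := ℝ) e) 2
  have hlim := h.tendsto.tendsto_integral_mul h.memLp_test h.memLp hη'2
  have happly : TendstoLp 2 (halfMeasure N) (fun n z => fderiv ℝ (φ n) z e)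
      fun z => dot (G z) e := h.tendsto_fderiv.apply_clm e
  have hlim' := happly.tendsto_integral_mul
    (fun n => (ContinuousLinearMap.apply ℝ ℝ e).comp_memLp' (h.memLp_fderiv n))
    ((ContinuousLinearMap.apply ℝ ℝ e).comp_memLp' h.memLp_dotL) hη2
  exact tendsto_nhds_unique hlim <| hlim'.neg.congr fun n => (setIntegral_mul_fderiv_eq_neg
    ((h.contDiff n).of_le (by simp)) (hη.of_le (by simp)) hηc hηs e).symm

end TestApprox

lemma MemH1.isWeakGrad (hv : MemH1 v) : IsWeakGrad v (weakGrad v) := by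
  rw [weakGrad, dif_pos hv.2]
  exact hv.2.choose_spec

lemma IsWeakGrad.ae_dot_eq (hG : IsWeakGrad v G) (hH : IsWeakGrad v H) (e : Amb N) :
    ∀ᵐ z ∂(halfMeasure N), dot (G z) e = dot (H z) e := by
  have hGe : MemLp (fun z => dot (G z) e) 2 (halfMeasure N) := ((dotL N).flip e).comp_memLp' hG.1
  have hHe : MemLp (fun z => dot (H z) e) 2 (halfMeasure N) := ((dotL N).flip e).comp_memLp' hH.1
  have : IsLocallyFiniteMeasure (halfMeasure N) := by unfold halfMeasure; infer_instance
  have hzero := (isOpen_halfSpace N).ae_eq_zero_of_integral_contDiff_smul_eq_zero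
    (μ := halfMeasure N)
    (((hGe.sub hHe).locallyIntegrable one_le_two).locallyIntegrableOn _)
    fun η hη hηc hηs => by
      have hη2 := memLp_halfMeasure hη.continuous hηc 2
      have hdiff := integral_sub (hGe.integrable_mul hη2) (hHe.integrable_mul hη2)
      simp only [Pi.mul_apply, ← sub_mul] at hdiff
      simp only [Pi.sub_apply, smul_eq_mul, mul_comm (η _)]
      rw [hdiff, sub_eq_zero, ← neg_inj, ← hG.2 η hη hηc hηs e, hH.2 η hη hηc hηs e]
  filter_upwards [hzero, ae_restrict_mem (isOpen_halfSpace N).measurableSet] with z hz hz'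
  exact sub_eq_zero.1 (hz hz')

lemma IsWeakGrad.ae_eq (hG : IsWeakGrad v G) (hH : IsWeakGrad v H) : G =ᵐ[halfMeasure N] H := by
  filter_upwards [ae_all_iff.2 fun i => hG.ae_dot_eq hH (Module.finBasis ℝ (Amb N) i)] with z hz
  refine sub_eq_zero.1 (eq_zero_of_dotL_eq_zero ?_)
  refine ContinuousLinearMap.coe_injective ((Module.finBasis ℝ (Amb N)).ext fun i => ?_)
  simpa [sub_eq_zero] using hz i

lemma TestApprox.memH1 (h : TestApprox φ v G) : MemH1 v := ⟨h.memLp, G, h.isWeakGrad⟩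

lemma TestApprox.weakGrad_ae_eq (h : TestApprox φ v G) : weakGrad v =ᵐ[halfMeasure N] G :=
  h.memH1.isWeakGrad.ae_eq h.isWeakGrad

lemma isTrace_iff_exists_testApprox (hv : MemH1 v) {u : Bdry N → ℝ} :
    IsTrace v u ↔ MemLp u 2 volume ∧ ∃ φ, TestApprox φ v (weakGrad v) ∧
      TendstoLp 2 volume (fun n y => φ n (0, y)) u := by
  refine and_congr_right fun _ => exists_congr fun φ => ⟨?_, ?_⟩
  · rintro ⟨hφ, hval, hder, htr⟩
    refine ⟨⟨fun n => (hφ n).1, fun n => (hφ n).2, hv.1, hv.isWeakGrad.1, hval, ?_⟩, htr⟩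
    exact tendstoLp_of_forall_apply one_le_two
      (fun n => ((hφ n).1.continuous_fderiv (by simp)).aestronglyMeasurable)
      ((dotL N).continuous.comp_aestronglyMeasurable hv.isWeakGrad.1.aestronglyMeasurable) hder
  · rintro ⟨hφ, htr⟩
    exact ⟨fun n => ⟨hφ.contDiff n, hφ.hasCompactSupport n⟩, hφ.tendsto,
      fun e => hφ.tendsto_fderiv.apply_clm e, htr⟩

lemma TestApprox.isTrace (h : TestApprox φ v G) {u : Bdry N → ℝ} (hu : MemLp u 2 volume)
    (htr : TendstoLp 2 volume (fun n y => φ n (0, y)) u) : IsTrace v u :=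
  have hgrad := h.weakGrad_ae_eq.symm
  (isTrace_iff_exists_testApprox h.memH1).2 ⟨hu, φ, { h with
    memLp_grad := h.memLp_grad.ae_eq hgrad
    tendsto_fderiv := h.tendsto_fderiv.congr_right (hgrad.fun_comp (dotL N)) }, htr⟩

lemma eLpNorm_trace_two_le {ψ : Amb N → ℝ} (hψ : ContDiff ℝ 1 ψ) (hψc : HasCompactSupport ψ) :
    eLpNorm (fun y => ψ (0, y)) 2 volume ≤
      eLpNorm ψ 2 (halfMeasure N) + eLpNorm (fderiv ℝ ψ) 2 (halfMeasure N) := by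
  set a := eLpNorm ψ 2 (halfMeasure N)
  set b := eLpNorm (fderiv ℝ ψ) 2 (halfMeasure N)
  have hpow := eLpNorm_nnreal_pow_eq_lintegral (μ := volume) (f := fun y : Bdry N => ψ (0, y))
    (two_ne_zero)
  have htrace := lintegral_trace_rpow_le one_lt_two hψ hψc
  rw [← hpow, tsub_eq_of_eq_add one_add_one_eq_two.symm, mul_one,
    show ((2 : ℝ≥0) : ℝ) - 1 = 1 by norm_num, ENNReal.rpow_one] at htrace
  simp only [NNReal.coe_ofNat, ENNReal.rpow_ofNat, ENNReal.coe_ofNat] at htrace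
  rw [← ENNReal.pow_le_pow_left_iff two_ne_zero]
  calc _ ≤ 2 * (a * b) := htrace
    _ ≤ 2 * (a * b) + (a ^ 2 + b ^ 2) := le_self_add
    _ = (a + b) ^ 2 := by ring

/-- The distance in `H¹(ℝ^{N+1}_+)` between the test function `ψ` and the function `v` with
gradient `G`. -/
noncomputable def h1Dist (ψ v : Amb N → ℝ) (G : Amb N → Amb N) : ℝ≥0∞ :=
  eLpNorm (fun z => ψ z - v z) 2 (halfMeasure N) +
    eLpNorm (fun z => fderiv ℝ ψ z - dotL N (G z)) 2 (halfMeasure N)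

lemma TestApprox.tendsto_h1Dist (h : TestApprox φ v G) :
    Tendsto (fun n => h1Dist (φ n) v G) atTop (𝓝 0) := by
  simpa only [h1Dist, add_zero] using Tendsto.add h.tendsto h.tendsto_fderiv

lemma TestApprox.eLpNorm_trace_sub_le {ψ : ℕ → Amb N → ℝ} (hφ : TestApprox φ v G)
    (hψ : TestApprox ψ v G) (n k : ℕ) :
    eLpNorm (fun y => φ n (0, y) - ψ k (0, y)) 2 volume ≤
      h1Dist (φ n) v G + h1Dist (ψ k) v G := by
  have hval := eLpNorm_sub_le_eLpNorm_sub_add (hφ.memLp_test n).1 (hψ.memLp_test k).1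
    hφ.memLp.1 one_le_two
  have hder := eLpNorm_sub_le_eLpNorm_sub_add (hφ.memLp_fderiv n).1 (hψ.memLp_fderiv k).1
    hφ.memLp_dotL.1 one_le_two
  rw [← funext fun z => fderiv_fun_sub ((hφ.contDiff n).differentiable (by simp) z)
    ((hψ.contDiff k).differentiable (by simp) z)] at hder
  refine ((eLpNorm_trace_two_le (((hφ.contDiff n).sub (hψ.contDiff k)).of_le (by simp))
    ((hφ.hasCompactSupport n).sub (hψ.hasCompactSupport k))).trans
    (add_le_add hval hder)).trans_eq ?_
  simp only [h1Dist]
  ring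

lemma IsTrace.ae_eq {u u' : Bdry N → ℝ} (hv : MemH1 v) (h : IsTrace v u) (h' : IsTrace v u') :
    u =ᵐ[volume] u' := by
  obtain ⟨hu, φ, hφ, hφu⟩ := (isTrace_iff_exists_testApprox hv).1 h
  obtain ⟨hu', ψ, hψ, hψu⟩ := (isTrace_iff_exists_testApprox hv).1 h'
  have hmφ := fun n => (hφ.continuous_trace n).aestronglyMeasurable (μ := volume)
  have hmψ := fun n => (hψ.continuous_trace n).aestronglyMeasurable (μ := volume)
  have hlim : Tendsto (fun n => h1Dist (φ n) v (weakGrad v) + h1Dist (ψ n) v (weakGrad v)) atTop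
      (𝓝 0) := by
    simpa only [add_zero] using hφ.tendsto_h1Dist.add hψ.tendsto_h1Dist
  have hzero := (hφu.sub one_le_two hmφ hu.1 hmψ hu'.1 hψu).eLpNorm_le two_ne_zero
    (fun n => (hmφ n).sub (hmψ n)) (hu.1.sub hu'.1) (fun n => hφ.eLpNorm_trace_sub_le hψ n n) hlim
  filter_upwards [(eLpNorm_eq_zero_iff (hu.sub hu').1 two_ne_zero).1 (nonpos_iff_eq_zero.1 hzero)]
    with y hy
  exact sub_eq_zero.1 hy

lemma IsTrace.trace_ae_eq {u : Bdry N → ℝ} (hv : MemH1 v) (h : IsTrace v u) :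
    trace v =ᵐ[volume] u := by
  have hex : ∃ u : Bdry N → ℝ, IsTrace v u := ⟨u, h⟩
  rw [trace, dif_pos hex]
  exact hex.choose_spec.ae_eq hv h

/-- The Dirichlet energy `∫ |∇v|²` over the half-space. -/
noncomputable def dirichletEnergy (v : Amb N → ℝ) : ℝ :=
  ∫ z, dot (weakGrad v z) (weakGrad v z) ∂(halfMeasure N)

lemma exists_eLpNorm_trace_sq_le_dirichletEnergy (hN : 2 ≤ N) :
    ∃ C : ℝ≥0, ∀ (v : Amb N → ℝ) (u : Bdry N → ℝ), MemH1 v → IsTrace v u →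
      eLpNorm u (traceExponent N) volume ^ 2 ≤ C * ENNReal.ofReal (dirichletEnergy v) := by
  obtain ⟨C, hC⟩ := exists_eLpNorm_trace_le_eLpNorm_fderiv hN
  refine ⟨C ^ 2 * 2, fun v u hv hu => ?_⟩
  obtain ⟨hu2, φ, hφ, hφu⟩ := (isTrace_iff_exists_testApprox hv).1 hu
  have hgrad := hφ.tendsto_fderiv.tendsto_eLpNorm one_le_two (fun n => (hφ.memLp_fderiv n).1)
    hφ.memLp_dotL
  calc eLpNorm u (traceExponent N) volume ^ 2
      ≤ (C * eLpNorm (fun z => dotL N (weakGrad v z)) 2 (halfMeasure N)) ^ 2 := by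
        gcongr
        exact hφu.eLpNorm_le two_ne_zero (fun n => (hφ.continuous_trace n).aestronglyMeasurable)
          hu2.1 (fun n => hC _ (hφ.contDiff n) (hφ.hasCompactSupport n))
          (ENNReal.Tendsto.const_mul hgrad (Or.inr ENNReal.coe_ne_top))
    _ ≤ C ^ 2 * (2 * ENNReal.ofReal (dirichletEnergy v)) := by
        rw [mul_pow]
        gcongr
        exact eLpNorm_dotL_sq_le hφ.memLp_grad
    _ = _ := by push_cast; ring

end WeakGradient

/-! ### Existence of traces -/

section Mollification

variable {N : ℕ} {f g : Amb N → ℝ} {p : ℝ≥0∞}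

/-- A bump function concentrated near the origin and supported in `{x < 0}`. Convolution with it
evaluates functions on the half-space only at points further inside. -/
noncomputable def shiftedBump (N n : ℕ) : ContDiffBump ((-2 / ((n : ℝ) + 1), 0) : Amb N) where
  rIn := 1 / (2 * ((n : ℝ) + 1))
  rOut := 1 / ((n : ℝ) + 1)
  rIn_pos := by positivity
  rIn_lt_rOut := one_div_lt_one_div_of_lt (by positivity) (by linarith [n.cast_nonneg (α := ℝ)])

/-- The approximate identity on `ℝ^{N+1}` given by the normalised bumps supported in `{x < 0}`. -/
noncomputable def mollifier (N n : ℕ) : Amb N → ℝ := (shiftedBump N n).normed volume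

lemma contDiff_mollifier (N n : ℕ) : ContDiff ℝ ∞ (mollifier N n) :=
  (shiftedBump N n).contDiff_normed (n := ⊤)

lemma hasCompactSupport_mollifier (N n : ℕ) : HasCompactSupport (mollifier N n) :=
  (shiftedBump N n).hasCompactSupport_normed

lemma mollifier_nonneg (N n : ℕ) (z : Amb N) : 0 ≤ mollifier N n z :=
  (shiftedBump N n).nonneg_normed z

lemma integral_mollifier (N n : ℕ) : ∫ z, mollifier N n z = 1 :=
  (shiftedBump N n).integral_normed

lemma eLpNorm_one_mollifier (N n : ℕ) : eLpNorm (mollifier N n) 1 volume = 1 := by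
  have hint : Integrable (mollifier N n) := (shiftedBump N n).integrable_normed
  rw [eLpNorm_one_eq_lintegral_enorm, ← ofReal_integral_norm_eq_lintegral_enorm hint]
  simp only [Real.norm_of_nonneg (mollifier_nonneg N n _), integral_mollifier, ENNReal.ofReal_one]

lemma fst_neg_of_mem_tsupport_mollifier {n : ℕ} {z : Amb N} (hz : z ∈ tsupport (mollifier N n)) :
    z.1 < 0 := by
  rw [mollifier, ContDiffBump.tsupport_normed_eq, mem_closedBall_iff_norm] at hz
  have hdist : |z.1 - -2 / ((n : ℝ) + 1)| ≤ 1 / ((n : ℝ) + 1) := (norm_fst_le _).trans hz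
  have hpos : 0 < 1 / ((n : ℝ) + 1) := by positivity
  have hcenter : -2 / ((n : ℝ) + 1) = -2 * (1 / ((n : ℝ) + 1)) := by ring
  rw [hcenter] at hdist
  linarith [(abs_le.1 hdist).2]

lemma support_mollifier_subset (N n : ℕ) :
    Function.support (mollifier N n) ⊆ Metric.ball 0 (3 / ((n : ℝ) + 1)) := by
  rw [mollifier, ContDiffBump.support_normed_eq]
  refine Metric.ball_subset_ball' ?_
  have hpos : (0 : ℝ) < (n : ℝ) + 1 := by positivity
  rw [dist_zero_right, Prod.norm_def]
  simp only [norm_zero, norm_div, norm_neg, Real.norm_ofNat, Real.norm_of_nonneg hpos.le,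
    shiftedBump]
  rw [max_eq_left (by positivity), ← add_div]
  norm_num

lemma tendsto_support_mollifier (N : ℕ) :
    Tendsto (fun n => Function.support (mollifier N n)) atTop (𝓝 0).smallSets := by
  have hradius : Tendsto (fun n : ℕ => 3 / ((n : ℝ) + 1)) atTop (𝓝 0) := by
    simpa only [mul_zero, mul_one_div] using
      tendsto_one_div_add_atTop_nhds_zero_nat (𝕜 := ℝ) |>.const_mul 3
  refine Metric.nhds_basis_ball.smallSets.tendsto_right_iff.2 fun ε hε => ?_
  filter_upwards [hradius.eventually_lt_const hε] with n hn
  exact (support_mollifier_subset N n).trans (Metric.ball_subset_ball hn.le)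

/-- Regularisation by convolution with `mollifier N n`. -/
noncomputable def mollify (n : ℕ) (f : Amb N → ℝ) : Amb N → ℝ :=
  f ⋆[ContinuousLinearMap.mul ℝ ℝ, volume] mollifier N n

lemma mollify_eq_lsmul (n : ℕ) (f : Amb N → ℝ) :
    mollify n f = mollifier N n ⋆[ContinuousLinearMap.lsmul ℝ ℝ, volume] f := by
  ext z
  rw [convolution_lsmul_swap]
  simp only [mollify, convolution_def, ContinuousLinearMap.mul_apply', smul_eq_mul, mul_comm]

lemma contDiff_mollify {n : ℕ} (hf : LocallyIntegrable f volume) : ContDiff ℝ ∞ (mollify n f) :=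
  (hasCompactSupport_mollifier N n).contDiff_convolution_right _ hf (contDiff_mollifier N n)

lemma mollify_add {n : ℕ} (hf : LocallyIntegrable f volume) (hg : LocallyIntegrable g volume) :
    mollify n (f + g) = mollify n f + mollify n g :=
  have hexists := fun {f : Amb N → ℝ} (hf : LocallyIntegrable f volume) =>
    (hasCompactSupport_mollifier N n).convolutionExists_right (ContinuousLinearMap.mul ℝ ℝ) hf
      (contDiff_mollifier N n).continuous
  (hexists hf).add_distrib (hexists hg)

lemma eLpNorm_mollify_le {n : ℕ} (hp : 1 ≤ p) (hf : AEStronglyMeasurable f volume) :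
    eLpNorm (mollify n f) p volume ≤ eLpNorm f p volume := by
  have hyoung := eLpNorm_convolution_mul_le (s := p) hp le_rfl (by rw [inv_one, add_comm]) hf
    (contDiff_mollifier N n).continuous.aestronglyMeasurable
  rwa [eLpNorm_one_mollifier, mul_one] at hyoung

open scoped Pointwise in
lemma support_mollify_sub_subset (n : ℕ) (f : Amb N → ℝ) :
    Function.support (fun z => mollify n f z - f z) ⊆ tsupport f + Metric.closedBall 0 3 := by
  have hradius : 3 / ((n : ℝ) + 1) ≤ 3 :=
    div_le_self (by norm_num) (by linarith [n.cast_nonneg (α := ℝ)])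
  refine (Function.support_sub _ _).trans (union_subset ?_ ?_)
  · refine (support_convolution_subset _).trans (add_subset_add (subset_tsupport f) ?_)
    exact (support_mollifier_subset N n).trans
      (Metric.ball_subset_closedBall.trans (Metric.closedBall_subset_closedBall hradius))
  · exact fun z hz => ⟨z, subset_tsupport f hz, 0, Metric.mem_closedBall_self (by norm_num),
      add_zero z⟩

lemma tendsto_mollify_of_continuous (hf : Continuous f) (z : Amb N) :
    Tendsto (fun n => mollify n f z) atTop (𝓝 (f z)) := by
  simp only [mollify_eq_lsmul]
  exact convolution_tendsto_right (Eventually.of_forall fun n => mollifier_nonneg N n)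
    (Eventually.of_forall fun n => integral_mollifier N n) (tendsto_support_mollifier N)
    (Eventually.of_forall fun _ => hf.aestronglyMeasurable)
    ((hf.tendsto z).comp tendsto_snd) tendsto_const_nhds

lemma norm_mollify_sub_le {C : ℝ} (hf : Continuous f) (hC : ∀ z, ‖f z‖ ≤ C) (n : ℕ) (z : Amb N) :
    ‖mollify n f z - f z‖ ≤ C + C := by
  have hC0 : 0 ≤ C := (norm_nonneg _).trans (hC z)
  rw [mollify_eq_lsmul, ← dist_eq_norm]
  exact dist_convolution_le (add_nonneg hC0 hC0) (support_mollifier_subset N n)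
    (mollifier_nonneg N n) (integral_mollifier N n) hf.aestronglyMeasurable
    fun w _ => (dist_le_norm_add_norm _ _).trans (add_le_add (hC w) (hC z))

open scoped Pointwise in
lemma tendstoLp_mollify_of_continuous (hp0 : p ≠ 0) (hp : p ≠ ⊤) (hf : Continuous f)
    (hfc : HasCompactSupport f) : TendstoLp p volume (fun n => mollify n f) f := by
  obtain ⟨C, hC⟩ := hf.bounded_above_of_compact_support hfc
  set A := tsupport f + Metric.closedBall (0 : Amb N) 3
  have hA : IsCompact A := hfc.isCompact.add (isCompact_closedBall 0 3)
  have hdiff : TendstoLp p volume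
      (fun n z => (mollify n f z - f z) • A.indicator (fun _ => (1 : ℝ)) z) fun _ => 0 :=
    tendstoLp_zero_smul hp0 hp
      (fun n => ((contDiff_mollify hf.locallyIntegrable).continuous.sub hf).aestronglyMeasurable)
      (norm_mollify_sub_le hf hC)
      (memLp_indicator_const p hA.isClosed.measurableSet 1 (Or.inr hA.measure_ne_top))
      (Eventually.of_forall fun z => by
        simpa only [sub_self] using (tendsto_mollify_of_continuous hf z).sub_const (f z))
  refine hdiff.of_norm_le fun n z => ?_
  by_cases hz : z ∈ A
  · simp only [indicator_of_mem hz, smul_eq_mul, mul_one, sub_zero, le_refl]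
  · rw [show mollify n f z - f z = 0 from
      Function.notMem_support.1 fun h => hz (support_mollify_sub_subset n f h), norm_zero]
    exact norm_nonneg _

lemma tendstoLp_mollify (hp1 : 1 ≤ p) (hp : p ≠ ⊤) (hf : MemLp f p volume) :
    TendstoLp p volume (fun n => mollify n f) f := by
  refine ENNReal.tendsto_nhds_zero.2 fun ε hε => ?_
  have hε3 : 0 < ε / 3 := ENNReal.div_pos hε.ne' ENNReal.ofNat_ne_top
  obtain ⟨k, hkc, hfk, hk, hkp⟩ := hf.exists_hasCompactSupport_eLpNorm_sub_le hp hε3.ne'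
  have hfkm := (hf.sub hkp).aestronglyMeasurable
  have hfkl : LocallyIntegrable (f - k) volume := (hf.sub hkp).locallyIntegrable hp1
  have hlim := tendstoLp_mollify_of_continuous (zero_lt_one.trans_le hp1).ne' hp hk hkc
  filter_upwards [ENNReal.tendsto_nhds_zero.1 hlim _ hε3] with n hn
  have hsplit : (fun z => mollify n f z - f z) =
      (mollify n (f - k) + fun z => mollify n k z - k z) - (f - k) := by
    conv_lhs => rw [← sub_add_cancel f k, mollify_add hfkl hk.locallyIntegrable]
    ext z
    simp only [Pi.sub_apply, Pi.add_apply]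
    ring
  have hm₁ := (contDiff_mollify (n := n) hfkl).continuous.aestronglyMeasurable (μ := volume)
  have hm₂ := ((contDiff_mollify (n := n) hk.locallyIntegrable).continuous.sub
    hk).aestronglyMeasurable (μ := volume)
  calc eLpNorm (fun z => mollify n f z - f z) p volume
      ≤ eLpNorm (mollify n (f - k)) p volume + eLpNorm (fun z => mollify n k z - k z) p volume +
          eLpNorm (f - k) p volume := by
        rw [hsplit]
        exact (eLpNorm_sub_le (hm₁.add hm₂) hfkm hp1).trans
          (add_le_add_left (eLpNorm_add_le hm₁ hm₂ hp1) _)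
    _ ≤ ε / 3 + ε / 3 + ε / 3 := by
        gcongr
        exact (eLpNorm_mollify_le hp1 hfkm).trans hfk
    _ = ε := ENNReal.add_thirds ε

lemma contDiff_mollifier_sub (n : ℕ) (z : Amb N) : ContDiff ℝ ∞ fun w => mollifier N n (z - w) :=
  (contDiff_mollifier N n).comp (contDiff_const.sub contDiff_id)

lemma fderiv_mollifier_sub_apply (n : ℕ) (z w e : Amb N) :
    fderiv ℝ (fun w => mollifier N n (z - w)) w e = -fderiv ℝ (mollifier N n) (z - w) e := by
  have hsub : HasFDerivAt (fun w : Amb N => z - w) (-ContinuousLinearMap.id ℝ (Amb N)) w :=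
    (hasFDerivAt_id w).const_sub z
  have hcomp := ((contDiff_mollifier N n).differentiable (by simp) (z - w)).hasFDerivAt.comp w hsub
  have hfd : fderiv ℝ (fun w => mollifier N n (z - w)) w = _ := hcomp.fderiv
  rw [hfd, ContinuousLinearMap.comp_apply, ← map_neg]
  rfl

lemma tsupport_mollifier_sub_subset {n : ℕ} {z : Amb N} (hz : z ∈ halfSpace N) :
    tsupport (fun w => mollifier N n (z - w)) ⊆ halfSpace N := fun w hw => by
  have hneg : z.1 - w.1 < 0 := fst_neg_of_mem_tsupport_mollifier
    (tsupport_comp_subset_preimage (mollifier N n) (Homeomorph.subLeft z).continuous hw)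
  have hz' : 0 < z.1 := hz
  exact show 0 < w.1 by linarith

lemma mollify_indicator_halfSpace (n : ℕ) (f : Amb N → ℝ) (z : Amb N) :
    mollify n ((halfSpace N).indicator f) z =
      ∫ w, f w * mollifier N n (z - w) ∂(halfMeasure N) := by
  rw [halfMeasure, ← integral_indicator (isOpen_halfSpace N).measurableSet]
  simp only [mollify, convolution_def, ContinuousLinearMap.mul_apply', indicator_mul_left]

lemma fderiv_mollify {n : ℕ} (hf : LocallyIntegrable f volume) (z e : Amb N) :
    fderiv ℝ (mollify n f) z e = ∫ w, f w * fderiv ℝ (mollifier N n) (z - w) e := by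
  have hρ : ContDiff ℝ 1 (mollifier N n) := (contDiff_mollifier N n).of_le (by simp)
  have hρc := hasCompactSupport_mollifier N n
  rw [mollify, (hρc.hasFDerivAt_convolution_right (ContinuousLinearMap.mul ℝ ℝ) hf hρ z).fderiv,
    convolution_precompR_apply _ hf (hρc.fderiv ℝ) (hρ.continuous_fderiv (by simp)),
    convolution_def]
  simp only [ContinuousLinearMap.mul_apply']

/- For `z` in the half-space, `w ↦ mollifier N n (z - w)` is an admissible test function. -/
lemma IsWeakGrad.fderiv_mollify {n : ℕ} {G : Amb N → Amb N} (hG : IsWeakGrad f G)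
    (hf : LocallyIntegrable ((halfSpace N).indicator f) volume) {z : Amb N}
    (hz : z ∈ halfSpace N) (e : Amb N) :
    fderiv ℝ (mollify n ((halfSpace N).indicator f)) z e =
      mollify n ((halfSpace N).indicator fun w => dot (G w) e) z := by
  have hρc : HasCompactSupport fun w => mollifier N n (z - w) :=
    (hasCompactSupport_mollifier N n).comp_homeomorph (Homeomorph.subLeft z)
  have hweak := hG.2 _ (contDiff_mollifier_sub n z) hρc (tsupport_mollifier_sub_subset hz) e
  simp only [fderiv_mollifier_sub_apply, mul_neg, integral_neg, neg_inj] at hweak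
  rw [Hartree.fderiv_mollify hf, mollify_indicator_halfSpace, ← hweak, halfMeasure,
    ← integral_indicator (isOpen_halfSpace N).measurableSet]
  simp only [indicator_mul_left]

end Mollification

section Density

variable {N : ℕ} {v : Amb N → ℝ}

lemma TendstoLp.smul_of_tendsto_one {α E : Type*} [MeasurableSpace α] {μ : Measure α}
    [NormedAddCommGroup E] [NormedSpace ℝ E] {p : ℝ≥0∞} {F : ℕ → α → E} {f : α → E}
    {χ : ℕ → α → ℝ} (hp1 : 1 ≤ p) (hp : p ≠ ⊤) (hFm : ∀ n, AEStronglyMeasurable (F n) μ)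
    (hf : MemLp f p μ) (hF : TendstoLp p μ F f) (hχm : ∀ n, AEStronglyMeasurable (χ n) μ)
    (hχ : ∀ n x, ‖χ n x‖ ≤ 1) (hlim : ∀ x, Tendsto (fun n => χ n x) atTop (𝓝 1)) :
    TendstoLp p μ (fun n x => χ n x • F n x) f := by
  have hdiff : TendstoLp p μ (fun n x => χ n x • (F n x - f x)) fun _ => (0 : E) :=
    hF.of_norm_le fun n x => by
      rw [sub_zero, norm_smul]
      exact mul_le_of_le_one_left (norm_nonneg _) (hχ n x)
  have hcut : TendstoLp p μ (fun n x => (χ n x - 1) • f x) fun _ => 0 :=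
    tendstoLp_zero_smul (zero_lt_one.trans_le hp1).ne' hp
      (fun n => (hχm n).sub aestronglyMeasurable_const)
      (fun n x => (norm_sub_le _ _).trans (by
        rw [norm_one]
        exact add_le_add_left (hχ n x) 1)) hf
      (Eventually.of_forall fun x => by simpa only [sub_self] using (hlim x).sub_const 1)
  refine (hdiff.add hp1 (fun n => (hχm n).smul ((hFm n).sub hf.1)) aestronglyMeasurable_const
    (fun n => ((hχm n).sub aestronglyMeasurable_const).smul hf.1) aestronglyMeasurable_const
    hcut).of_norm_le fun n x => (congrArg norm ?_).le
  simp only [Pi.smul_apply', Pi.sub_apply]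
  module

lemma tendstoLp_zero_of_norm_le_mul {α E : Type*} [MeasurableSpace α] {μ : Measure α}
    [NormedAddCommGroup E] {p C : ℝ≥0∞} {F G : ℕ → α → E} {c : ℕ → ℝ} (hC : C ≠ ⊤)
    (hG : ∀ n, eLpNorm (G n) p μ ≤ C) (hle : ∀ n x, ‖F n x‖ ≤ c n * ‖G n x‖)
    (hc : Tendsto c atTop (𝓝 0)) : TendstoLp p μ F fun _ => 0 := by
  have hlim : Tendsto (fun n => ENNReal.ofReal (c n) * C) atTop (𝓝 0) := by
    simpa only [ENNReal.ofReal_zero, zero_mul] using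
      ENNReal.Tendsto.mul_const (ENNReal.tendsto_ofReal hc) (Or.inr hC)
  refine tendsto_of_tendsto_of_tendsto_of_le_of_le tendsto_const_nhds hlim (fun _ => zero_le)
    fun n => ?_
  simp only [sub_zero]
  exact (eLpNorm_le_mul_eLpNorm_of_ae_le_mul (Eventually.of_forall (hle n)) p).trans
    (by gcongr; exact hG n)

/-- A smooth function equal to `1` on the unit ball and supported in the ball of radius `2`. -/
noncomputable def unitBump (N : ℕ) : ContDiffBump (0 : Amb N) := ⟨1, 2, one_pos, one_lt_two⟩

/-- Smooth cutoff functions of growing balls. -/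
noncomputable def cutoff (N n : ℕ) (z : Amb N) : ℝ := unitBump N (((n : ℝ) + 1)⁻¹ • z)

lemma contDiff_cutoff (N n : ℕ) : ContDiff ℝ ∞ (cutoff N n) :=
  ((unitBump N).contDiff (n := ⊤)).comp (by fun_prop)

lemma hasCompactSupport_cutoff (N n : ℕ) : HasCompactSupport (cutoff N n) :=
  (unitBump N).hasCompactSupport.comp_smul (inv_ne_zero n.cast_add_one_ne_zero)

lemma norm_cutoff_le_one (N n : ℕ) (z : Amb N) : ‖cutoff N n z‖ ≤ 1 := by
  rw [cutoff, Real.norm_of_nonneg (unitBump N).nonneg]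
  exact (unitBump N).le_one

lemma tendsto_cutoff (z : Amb N) : Tendsto (fun n => cutoff N n z) atTop (𝓝 1) := by
  obtain ⟨n₀, hn₀⟩ := exists_nat_ge ‖z‖
  refine tendsto_const_nhds.congr' ?_
  filter_upwards [eventually_ge_atTop n₀] with n hn
  have hpos : (0 : ℝ) < (n : ℝ) + 1 := n.cast_add_one_pos
  refine ((unitBump N).one_of_mem_closedBall (mem_closedBall_zero_iff.2 ?_)).symm
  rw [norm_smul, norm_inv, Real.norm_of_nonneg hpos.le]
  refine (inv_mul_le_iff₀ hpos).2 (hn₀.trans ?_)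
  have hn' : (n₀ : ℝ) ≤ n := Nat.cast_le.2 hn
  change (n₀ : ℝ) ≤ (n + 1) * 1
  linarith

lemma exists_norm_fderiv_cutoff_le (N : ℕ) :
    ∃ K : ℝ, ∀ n z, ‖fderiv ℝ (cutoff N n) z‖ ≤ ((n : ℝ) + 1)⁻¹ * K := by
  have hsmooth : ContDiff ℝ ∞ (unitBump N) := (unitBump N).contDiff (n := ⊤)
  obtain ⟨K, hK⟩ := (hsmooth.continuous_fderiv (by simp)).bounded_above_of_compact_support
    ((unitBump N).hasCompactSupport.fderiv (𝕜 := ℝ))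
  refine ⟨K, fun n z => ?_⟩
  have hfd : fderiv ℝ (cutoff N n) z = _ :=
    fderiv_comp_smul (f := unitBump N) (((n : ℝ) + 1)⁻¹)
  rw [hfd, norm_smul, norm_inv, Real.norm_of_nonneg n.cast_add_one_pos.le]
  gcongr
  exact hK _

lemma memLp_indicator_halfSpace {f : Amb N → ℝ} {p : ℝ≥0∞} (hf : MemLp f p (halfMeasure N)) :
    MemLp ((halfSpace N).indicator f) p volume :=
  (memLp_indicator_iff_restrict (isOpen_halfSpace N).measurableSet).2 hf

lemma continuous_mollify_indicator {f : Amb N → ℝ} (hf : MemLp f 2 (halfMeasure N)) (n : ℕ) :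
    Continuous (mollify n ((halfSpace N).indicator f)) :=
  (contDiff_mollify ((memLp_indicator_halfSpace hf).locallyIntegrable one_le_two)).continuous

lemma tendstoLp_mollify_halfMeasure {f : Amb N → ℝ} (hf : MemLp f 2 (halfMeasure N)) :
    TendstoLp 2 (halfMeasure N) (fun n => mollify n ((halfSpace N).indicator f)) f := by
  have hlim := tendstoLp_mollify one_le_two ENNReal.ofNat_ne_top (memLp_indicator_halfSpace hf)
  have hrestrict : TendstoLp 2 (halfMeasure N)
      (fun n => mollify n ((halfSpace N).indicator f)) ((halfSpace N).indicator f) :=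
    tendsto_of_tendsto_of_tendsto_of_le_of_le tendsto_const_nhds hlim (fun _ => zero_le)
      fun n => eLpNorm_mono_measure _ Measure.restrict_le_self
  exact hrestrict.congr_right (indicator_ae_eq_restrict (isOpen_halfSpace N).measurableSet)

lemma tendstoLp_cutoff_mul_mollify {f : Amb N → ℝ} (hf : MemLp f 2 (halfMeasure N)) :
    TendstoLp 2 (halfMeasure N)
      (fun n z => cutoff N n z * mollify n ((halfSpace N).indicator f) z) f :=
  (tendstoLp_mollify_halfMeasure hf).smul_of_tendsto_one one_le_two ENNReal.ofNat_ne_top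
    (fun n => (continuous_mollify_indicator hf n).aestronglyMeasurable) hf
    (fun n => (contDiff_cutoff N n).continuous.aestronglyMeasurable)
    (norm_cutoff_le_one N) tendsto_cutoff

lemma tendstoLp_fderiv_cutoff_mul_mollify {f : Amb N → ℝ} (hf : MemLp f 2 (halfMeasure N))
    (e : Amb N) : TendstoLp 2 (halfMeasure N)
      (fun n z => fderiv ℝ (cutoff N n) z e * mollify n ((halfSpace N).indicator f) z)
      fun _ => 0 := by
  obtain ⟨K, hK⟩ := exists_norm_fderiv_cutoff_le N
  have hext := memLp_indicator_halfSpace hf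
  have hc : Tendsto (fun n : ℕ => ((n : ℝ) + 1)⁻¹ * K * ‖e‖) atTop (𝓝 0) := by
    simpa only [one_div, zero_mul] using
      ((tendsto_one_div_add_atTop_nhds_zero_nat (𝕜 := ℝ)).mul_const K).mul_const ‖e‖
  refine tendstoLp_zero_of_norm_le_mul hext.eLpNorm_ne_top
    (fun n => (eLpNorm_mono_measure _ Measure.restrict_le_self).trans
      (eLpNorm_mollify_le (n := n) one_le_two hext.1)) (fun n z => ?_) hc
  rw [norm_mul]
  gcongr
  exact (fderiv ℝ (cutoff N n) z).le_of_opNorm_le (hK n z) e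

lemma MemH1.exists_testApprox (hv : MemH1 v) : ∃ φ, TestApprox φ v (weakGrad v) := by
  have hG := hv.isWeakGrad
  have hGe : ∀ e, MemLp (fun z => dot (weakGrad v z) e) 2 (halfMeasure N) := fun e =>
    ((dotL N).flip e).comp_memLp' hG.1
  have hvl : LocallyIntegrable ((halfSpace N).indicator v) volume :=
    (memLp_indicator_halfSpace hv.1).locallyIntegrable one_le_two
  set w : ℕ → Amb N → ℝ := fun n => mollify n ((halfSpace N).indicator v)
  have hw : ∀ n, ContDiff ℝ ∞ (w n) := fun n => contDiff_mollify hvl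
  have hφ : ∀ n, ContDiff ℝ ∞ fun z => cutoff N n z * w n z := fun n =>
    (contDiff_cutoff N n).mul (hw n)
  have hχ' : ∀ n e, Continuous fun z => fderiv ℝ (cutoff N n) z e := fun n e =>
    ((contDiff_cutoff N n).continuous_fderiv (by simp)).clm_apply continuous_const
  refine ⟨fun n z => cutoff N n z * w n z, ⟨hφ, fun n => (hasCompactSupport_cutoff N n).mul_right,
    hv.1, hG.1, tendstoLp_cutoff_mul_mollify hv.1, tendstoLp_of_forall_apply one_le_two
      (fun n => ((hφ n).continuous_fderiv (by simp)).aestronglyMeasurable)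
      ((dotL N).continuous.comp_aestronglyMeasurable hG.1.1) fun e => ?_⟩⟩
  have hlim := (tendstoLp_cutoff_mul_mollify (hGe e)).add one_le_two
    (fun n => ((contDiff_cutoff N n).continuous.mul
      (continuous_mollify_indicator (hGe e) n)).aestronglyMeasurable) (hGe e).1
    (fun n => ((hχ' n e).mul (hw n).continuous).aestronglyMeasurable) aestronglyMeasurable_const
    (tendstoLp_fderiv_cutoff_mul_mollify hv.1 e)
  refine Tendsto.congr (fun n => eLpNorm_congr_ae ?_) hlim
  filter_upwards [ae_restrict_mem (isOpen_halfSpace N).measurableSet] with z hz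
  have hwe : fderiv ℝ (w n) z e = _ := hG.fderiv_mollify hvl hz e
  rw [fderiv_fun_mul ((contDiff_cutoff N n).differentiable (by simp) z)
    ((hw n).differentiable (by simp) z)]
  simp only [_root_.add_apply, _root_.smul_apply, Pi.mul_apply, smul_eq_mul, dotL_apply,
    add_zero, hwe]
  ring

lemma TestApprox.memLp_trace {φ : ℕ → Amb N → ℝ} {G : Amb N → Amb N} (h : TestApprox φ v G)
    (n : ℕ) (p : ℝ≥0∞) : MemLp (fun y : Bdry N => φ n (0, y)) p volume :=
  (h.continuous_trace n).memLp_of_hasCompactSupport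
    (hasCompactSupport_comp_of_norm_le (h.hasCompactSupport n) fun _ => le_max_right _ _)

lemma MemH1.exists_isTrace (hv : MemH1 v) : ∃ u, IsTrace v u := by
  obtain ⟨φ, hφ⟩ := hv.exists_testApprox
  have hmem := fun n => hφ.memLp_trace n 2
  have hcauchy : CauchySeq fun n => (hmem n).toLp fun y => φ n (0, y) := by
    refine EMetric.cauchySeq_iff.2 fun ε hε => ?_
    obtain ⟨n₀, hn₀⟩ := eventually_atTop.1
      (hφ.tendsto_h1Dist.eventually_lt_const (ENNReal.half_pos hε.ne'))
    refine ⟨n₀, fun n hn k hk => ?_⟩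
    rw [Lp.edist_toLp_toLp]
    calc _ ≤ h1Dist (φ n) v (weakGrad v) + h1Dist (φ k) v (weakGrad v) :=
          hφ.eLpNorm_trace_sub_le hφ n k
      _ < ε / 2 + ε / 2 := ENNReal.add_lt_add (hn₀ n hn) (hn₀ k hk)
      _ = ε := ENNReal.add_halves ε
  obtain ⟨U, hU⟩ := cauchySeq_tendsto_of_complete hcauchy
  refine ⟨U, hφ.isTrace (Lp.memLp U) ?_⟩
  exact (Lp.tendsto_Lp_iff_tendsto_eLpNorm'' _ hmem U (Lp.memLp U)).1
    (by simpa only [Lp.toLp_coeFn] using hU)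

lemma MemH1.isTrace_trace (hv : MemH1 v) : IsTrace v (trace v) := by
  rw [trace, dif_pos hv.exists_isTrace]
  exact hv.exists_isTrace.choose_spec

end Density

/-! ### The chain rule and the energy inequality -/

section ChainRule

variable {N : ℕ} {v : Amb N → ℝ} {G : Amb N → Amb N} {φ : ℕ → Amb N → ℝ} {Φ : ℝ → ℝ}

lemma lipschitzWith_one_of_norm_deriv_le (hΦ : Differentiable ℝ Φ) (hΦ' : ∀ t, ‖deriv Φ t‖ ≤ 1) :
    LipschitzWith 1 Φ :=
  lipschitzWith_of_nnnorm_deriv_le hΦ fun t => by exact_mod_cast hΦ' t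

lemma TestApprox.tendsto_fderiv_comp (h : TestApprox φ v G) (hΦ : ContDiff ℝ ∞ Φ)
    (hΦ' : ∀ t, ‖deriv Φ t‖ ≤ 1)
    (hae : ∀ᵐ z ∂(halfMeasure N), Tendsto (fun n => φ n z) atTop (𝓝 (v z))) :
    TendstoLp 2 (halfMeasure N) (fun n => fderiv ℝ fun z => Φ (φ n z))
      fun z => dotL N (deriv Φ (v z) • G z) := by
  have hdc : Continuous (deriv Φ) := hΦ.continuous_deriv (by simp)
  have hφm : ∀ n, AEStronglyMeasurable (fun z => deriv Φ (φ n z)) (halfMeasure N) := fun n =>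
    (hdc.comp (h.contDiff n).continuous).aestronglyMeasurable
  have hvm : AEStronglyMeasurable (fun z => deriv Φ (v z)) (halfMeasure N) :=
    hdc.comp_aestronglyMeasurable h.memLp.1
  have hdiff : TendstoLp 2 (halfMeasure N)
      (fun n z => deriv Φ (φ n z) • (fderiv ℝ (φ n) z - dotL N (G z))) fun _ => 0 := by
    refine h.tendsto_fderiv.of_norm_le fun n z => ?_
    rw [sub_zero, norm_smul]
    exact mul_le_of_le_one_left (norm_nonneg _) (hΦ' _)
  have hcoeff : TendstoLp 2 (halfMeasure N)
      (fun n z => (deriv Φ (φ n z) - deriv Φ (v z)) • dotL N (G z)) fun _ => 0 := by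
    refine tendstoLp_zero_smul (C := 1 + 1) two_ne_zero ENNReal.ofNat_ne_top
      (fun n => (hφm n).sub hvm) (fun n z => norm_sub_le_of_le (hΦ' _) (hΦ' _)) h.memLp_dotL ?_
    filter_upwards [hae] with z hz
    have hlim : Tendsto (fun n => deriv Φ (φ n z)) atTop (𝓝 (deriv Φ (v z))) :=
      (hdc.tendsto _).comp hz
    simpa only [sub_self] using hlim.sub_const (deriv Φ (v z))
  have hsum := hdiff.add one_le_two
    (fun n => (hφm n).smul ((h.memLp_fderiv n).1.sub h.memLp_dotL.1))
    aestronglyMeasurable_const (fun n => ((hφm n).sub hvm).smul h.memLp_dotL.1)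
    aestronglyMeasurable_const hcoeff
  refine hsum.of_norm_le fun n z => le_of_eq ?_
  have hchain : fderiv ℝ (fun z => Φ (φ n z)) z = deriv Φ (φ n z) • fderiv ℝ (φ n) z :=
    ((hΦ.differentiable (by simp) _).hasDerivAt.comp_hasFDerivAt z
      ((h.contDiff n).differentiable (by simp) z).hasFDerivAt).fderiv
  rw [hchain, map_smul]
  congr 1
  simp only [Pi.smul_apply', Pi.sub_apply]
  module

lemma TestApprox.comp (h : TestApprox φ v G) (hΦ : ContDiff ℝ ∞ Φ) (hΦ0 : Φ 0 = 0)
    (hΦ' : ∀ t, ‖deriv Φ t‖ ≤ 1)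
    (hae : ∀ᵐ z ∂(halfMeasure N), Tendsto (fun n => φ n z) atTop (𝓝 (v z))) :
    TestApprox (fun n z => Φ (φ n z)) (fun z => Φ (v z)) fun z => deriv Φ (v z) • G z := by
  have hLip := lipschitzWith_one_of_norm_deriv_le (hΦ.differentiable (by simp)) hΦ'
  have hdc : Continuous (deriv Φ) := hΦ.continuous_deriv (by simp)
  refine ⟨fun n => hΦ.comp (h.contDiff n), fun n => (h.hasCompactSupport n).comp_left hΦ0,
    hLip.comp_memLp hΦ0 h.memLp, ?_, ?_, h.tendsto_fderiv_comp hΦ hΦ' hae⟩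
  · refine h.memLp_grad.of_le ((hdc.comp_aestronglyMeasurable h.memLp.1).smul h.memLp_grad.1)
      (Eventually.of_forall fun z => ?_)
    rw [norm_smul]
    exact mul_le_of_le_one_left (norm_nonneg _) (hΦ' _)
  · exact h.tendsto.of_norm_le fun n z => by simpa using hLip.norm_sub_le (φ n z) (v z)

lemma IsTrace.exists_testApprox_comp {u : Bdry N → ℝ} (hv : MemH1 v) (hu : IsTrace v u)
    (hΦ : ContDiff ℝ ∞ Φ) (hΦ0 : Φ 0 = 0) (hΦ' : ∀ t, ‖deriv Φ t‖ ≤ 1) :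
    ∃ ψ, TestApprox ψ (fun z => Φ (v z)) (fun z => deriv Φ (v z) • weakGrad v z) ∧
      IsTrace (fun z => Φ (v z)) fun y => Φ (u y) := by
  obtain ⟨hu2, φ, hφ, htr⟩ := (isTrace_iff_exists_testApprox hv).1 hu
  obtain ⟨ns, hns, hae⟩ := hφ.tendsto.exists_seq_tendsto_ae two_ne_zero
    (fun n => (hφ.memLp_test n).1) hφ.memLp.1
  have hLip := lipschitzWith_one_of_norm_deriv_le (hΦ.differentiable (by simp)) hΦ'
  have hcomp := (hφ.comp_strictMono hns).comp hΦ hΦ0 hΦ' hae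
  refine ⟨_, hcomp, hcomp.isTrace (hLip.comp_memLp hΦ0 hu2) ?_⟩
  exact (htr.comp_strictMono hns).of_norm_le fun n y => by
    simpa using hLip.norm_sub_le (φ (ns n) (0, y)) (u y)

lemma MemH1.integrable_dot {v w : Amb N → ℝ} (hv : MemH1 v) (hw : MemH1 w) :
    Integrable (fun z => dot (weakGrad v z) (weakGrad w z)) (halfMeasure N) :=
  memLp_one_iff_integrable.1 ((dotL N).memLp_of_bilin 1 hv.isWeakGrad.1 hw.isWeakGrad.1)

/-- The pair `(v, u)` of a function on the half-space and its trace solves weakly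
`-Δv + m²v = 0`, `-∂v/∂x(0, ·) = B`. -/
structure IsNeumannSolution (m : ℝ) (v : Amb N → ℝ) (u B : Bdry N → ℝ) : Prop where
  memH1 : MemH1 v
  isTrace : IsTrace v u
  integral_eq : ∀ φ : Amb N → ℝ, MemH1 φ →
    ∫ z, (dot (weakGrad v z) (weakGrad φ z) + m ^ 2 * v z * φ z) ∂(halfMeasure N) =
      ∫ y, B y * trace φ y

lemma IsNeumannSolution.dirichletEnergy_comp_add_le {m : ℝ} {u B : Bdry N → ℝ}
    (h : IsNeumannSolution m v u B) (hΦ : ContDiff ℝ ∞ Φ) (hΦ0 : Φ 0 = 0)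
    (hΦ' : ∀ t, deriv Φ t ∈ Icc 0 1) :
    dirichletEnergy (fun z => Φ (v z)) + m ^ 2 * ∫ z, v z * Φ (v z) ∂(halfMeasure N) ≤
      ∫ y, B y * Φ (u y) := by
  obtain ⟨ψ, hψ, htr⟩ := h.isTrace.exists_testApprox_comp h.memH1 hΦ hΦ0 fun t => by
    rw [Real.norm_of_nonneg (hΦ' t).1]
    exact (hΦ' t).2
  have hdot := h.memH1.integrable_dot hψ.memH1
  have hmul : Integrable (fun z => v z * Φ (v z)) (halfMeasure N) :=
    h.memH1.1.integrable_mul hψ.memLp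
  have henergy : dirichletEnergy (fun z => Φ (v z)) ≤
      ∫ z, dot (weakGrad v z) (weakGrad (fun z => Φ (v z)) z) ∂(halfMeasure N) := by
    refine integral_mono_ae (hψ.memH1.integrable_dot hψ.memH1) hdot ?_
    filter_upwards [hψ.weakGrad_ae_eq] with z hz
    have hle := mul_le_of_le_one_left
      (mul_nonneg (hΦ' (v z)).1 (dot_self_nonneg (weakGrad v z))) (hΦ' (v z)).2
    simpa only [hz, ← dotL_apply, map_smul, smul_apply, smul_eq_mul] using hle
  calc _ ≤ (∫ z, dot (weakGrad v z) (weakGrad (fun z => Φ (v z)) z) ∂(halfMeasure N)) +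
        m ^ 2 * ∫ z, v z * Φ (v z) ∂(halfMeasure N) := by gcongr
    _ = ∫ y, B y * trace (fun z => Φ (v z)) y := by
        rw [← h.integral_eq _ hψ.memH1, ← integral_const_mul,
          ← integral_add hdot (hmul.const_mul _)]
        simp only [mul_assoc]
    _ = ∫ y, B y * Φ (u y) := by
        refine integral_congr_ae ?_
        filter_upwards [htr.trace_ae_eq hψ.memH1] with y hy
        rw [hy]

end ChainRule

/-! ### Smooth truncations -/

section SoftThreshold

open Real

/-- A smooth version of the positive part, up to an error `δ`. -/
noncomputable def ramp (δ t : ℝ) : ℝ := ∫ s in (0 : ℝ)..t, smoothTransition (s / δ)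

/-- A smooth version of the truncation `t ↦ sign t * (|t| - k)⁺`, up to an error `δ`. -/
noncomputable def softThreshold (k δ t : ℝ) : ℝ := ramp δ (t - k) - ramp δ (-t - k)

variable {k δ : ℝ}

lemma continuous_smoothTransition_div (δ : ℝ) : Continuous fun s => smoothTransition (s / δ) :=
  smoothTransition.continuous.comp (continuous_id.div_const δ)

lemma hasDerivAt_ramp (δ t : ℝ) : HasDerivAt (ramp δ) (smoothTransition (t / δ)) t :=
  (continuous_smoothTransition_div δ).integral_hasStrictDerivAt 0 t |>.hasDerivAt

lemma contDiff_ramp (δ : ℝ) : ContDiff ℝ ∞ (ramp δ) := by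
  rw [contDiff_infty_iff_deriv, funext fun t => (hasDerivAt_ramp δ t).deriv]
  exact ⟨fun t => (hasDerivAt_ramp δ t).differentiableAt,
    smoothTransition.contDiff.comp (contDiff_id.div_const δ)⟩

lemma monotone_ramp (δ : ℝ) : Monotone (ramp δ) :=
  monotone_of_hasDerivAt_nonneg (hasDerivAt_ramp δ) fun _ => smoothTransition.nonneg _

lemma ramp_of_nonpos (hδ : 0 < δ) {t : ℝ} (ht : t ≤ 0) : ramp δ t = 0 := by
  refine (intervalIntegral.integral_congr fun s hs => ?_).trans intervalIntegral.integral_zero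
  rw [uIcc_of_ge ht] at hs
  exact smoothTransition.zero_of_nonpos (div_nonpos_of_nonpos_of_nonneg hs.2 hδ.le)

lemma ramp_nonneg (hδ : 0 < δ) (t : ℝ) : 0 ≤ ramp δ t := by
  rcases le_total t 0 with ht | ht
  · exact (ramp_of_nonpos hδ ht).ge
  · exact (ramp_of_nonpos hδ le_rfl).ge.trans (monotone_ramp δ ht)

lemma sub_le_ramp (hδ : 0 < δ) (t : ℝ) : t - δ ≤ ramp δ t := by
  rcases le_total t δ with ht | ht
  · exact (sub_nonpos.2 ht).trans (ramp_nonneg hδ t)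
  have hint := (continuous_smoothTransition_div δ).intervalIntegrable (μ := volume)
  have hone : ∫ s in δ..t, smoothTransition (s / δ) = t - δ := by
    refine (intervalIntegral.integral_congr (g := fun _ => 1) fun s hs => ?_).trans
      integral_one
    rw [uIcc_of_le ht] at hs
    exact smoothTransition.one_of_one_le ((one_le_div hδ).2 hs.1)
  calc t - δ ≤ ramp δ δ + ∫ s in δ..t, smoothTransition (s / δ) := by
        rw [hone]
        exact le_add_of_nonneg_left (ramp_nonneg hδ δ)
    _ = ramp δ t := intervalIntegral.integral_add_adjacent_intervals (hint 0 δ) (hint δ t)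

lemma contDiff_softThreshold (k δ : ℝ) : ContDiff ℝ ∞ (softThreshold k δ) :=
  ((contDiff_ramp δ).comp (contDiff_id.sub contDiff_const)).sub
    ((contDiff_ramp δ).comp (contDiff_neg.sub contDiff_const))

lemma softThreshold_eq_zero (hδ : 0 < δ) {t : ℝ} (ht : |t| ≤ k) : softThreshold k δ t = 0 := by
  rw [softThreshold, ramp_of_nonpos hδ (by linarith [le_abs_self t]),
    ramp_of_nonpos hδ (by linarith [neg_le_abs t]), sub_self]

lemma deriv_softThreshold_mem_Icc (hk : 0 ≤ k) (hδ : 0 < δ) (t : ℝ) :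
    deriv (softThreshold k δ) t ∈ Icc 0 1 := by
  have hpos : HasDerivAt (fun t => ramp δ (t - k)) (smoothTransition ((t - k) / δ)) t :=
    (hasDerivAt_ramp δ (t - k)).comp_sub_const t k
  have hneg : HasDerivAt (fun t => ramp δ (-t - k)) (smoothTransition ((-t - k) / δ) * -1) t :=
    (hasDerivAt_ramp δ (-t - k)).comp (h₂ := ramp δ) t ((hasDerivAt_neg t).sub_const k)
  have hzero : ∀ s, s - k ≤ 0 → smoothTransition ((s - k) / δ) = 0 := fun s hs =>
    smoothTransition.zero_of_nonpos (div_nonpos_of_nonpos_of_nonneg hs hδ.le)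
  rw [show deriv (softThreshold k δ) t = _ from (hpos.sub hneg).deriv, mul_neg_one, sub_neg_eq_add]
  rcases le_total 0 t with ht | ht
  · rw [hzero (-t) (by linarith), add_zero]
    exact ⟨smoothTransition.nonneg _, smoothTransition.le_one _⟩
  · rw [hzero t (by linarith), zero_add]
    exact ⟨smoothTransition.nonneg _, smoothTransition.le_one _⟩

lemma sub_sub_le_abs_softThreshold (hk : 0 ≤ k) (hδ : 0 < δ) (t : ℝ) :
    |t| - k - δ ≤ |softThreshold k δ t| := by
  rcases le_total 0 t with ht | ht
  · rw [softThreshold, ramp_of_nonpos hδ (by linarith : -t - k ≤ 0), sub_zero, abs_of_nonneg ht]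
    exact (sub_le_ramp hδ _).trans (le_abs_self _)
  · rw [softThreshold, ramp_of_nonpos hδ (by linarith : t - k ≤ 0), zero_sub, abs_neg,
      abs_of_nonpos ht]
    exact (sub_le_ramp hδ _).trans (le_abs_self _)

lemma mul_softThreshold_nonneg (hk : 0 ≤ k) (hδ : 0 < δ) (t : ℝ) : 0 ≤ t * softThreshold k δ t := by
  rcases le_total 0 t with ht | ht
  · rw [softThreshold, ramp_of_nonpos hδ (by linarith : -t - k ≤ 0), sub_zero]
    exact mul_nonneg ht (ramp_nonneg hδ _)
  · rw [softThreshold, ramp_of_nonpos hδ (by linarith : t - k ≤ 0), zero_sub]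
    exact mul_nonneg_of_nonpos_of_nonpos ht (neg_nonpos.2 (ramp_nonneg hδ _))

end SoftThreshold

/-! ### De Giorgi iteration over level sets -/

section DeGiorgi

lemma geometric_decay {a : ℕ → ℝ≥0∞} {b R ρ : ℝ≥0∞} {η : ℝ} (hη : 0 ≤ η)
    (hrec : ∀ n, a (n + 1) ≤ b * R ^ n * a n ^ (1 + η)) (hR : R * ρ ^ η ≤ 1)
    (h0 : b * a 0 ^ η ≤ ρ) (n : ℕ) : a n ≤ a 0 * ρ ^ n := by
  induction n with
  | zero => simp
  | succ n ih =>
    calc a (n + 1) ≤ b * R ^ n * a n ^ (1 + η) := hrec n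
      _ ≤ b * R ^ n * (a 0 * ρ ^ n) ^ (1 + η) := by gcongr
      _ = b * a 0 ^ η * (R * ρ ^ η) ^ n * (a 0 * ρ ^ n) := by
          rw [ENNReal.rpow_add_of_nonneg _ _ zero_le_one hη, ENNReal.rpow_one,
            ENNReal.mul_rpow_of_nonneg _ _ hη, mul_pow, ← ENNReal.rpow_natCast (ρ ^ η),
            ← ENNReal.rpow_natCast ρ, ← ENNReal.rpow_mul, ← ENNReal.rpow_mul, mul_comm η]
          ring
      _ ≤ ρ * 1 ^ n * (a 0 * ρ ^ n) := by gcongr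
      _ = a 0 * ρ ^ (n + 1) := by rw [one_pow]; ring

variable {α : Type*} [MeasurableSpace α] {μ : Measure α} {u b w : α → ℝ} {q s : ℝ≥0}

lemma setLIntegral_mul_sq_le (hq : 0 < q) (hs : 0 < s) (hqs : (1 / q + 2 / s : ℝ) ≤ 1)
    (hb : AEStronglyMeasurable b μ) (hw : AEStronglyMeasurable w μ) (A : Set α) :
    ∫⁻ y in A, ‖b y‖ₑ * ‖w y‖ₑ ^ 2 ∂μ ≤
      eLpNorm b q (μ.restrict A) * eLpNorm w s μ ^ 2 * μ A ^ (1 - 1 / q - 2 / s : ℝ) := by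
  have hq' : (q : ℝ) ≠ 0 := by exact_mod_cast hq.ne'
  have hs' : (s : ℝ) ≠ 0 := by exact_mod_cast hs.ne'
  have hholder := ENNReal.lintegral_prod_norm_pow_le (μ := μ.restrict A) Finset.univ
    (f := ![fun y => ‖b y‖ₑ ^ (q : ℝ), fun y => ‖w y‖ₑ ^ (s : ℝ), fun _ => 1])
    (p := ![1 / q, 2 / s, 1 - 1 / q - 2 / s])
    (by simpa [Fin.forall_fin_succ] using
      ⟨hb.restrict.enorm.pow_const _, hw.restrict.enorm.pow_const _⟩)
    (by simp [Fin.sum_univ_three])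
    (by
      simp only [Finset.mem_univ, forall_const, Fin.forall_fin_succ, Matrix.cons_val_zero,
        Matrix.cons_val_succ, IsEmpty.forall_iff, and_true]
      exact ⟨by positivity, by positivity, by linarith⟩)
  simp only [Fin.prod_univ_three, Matrix.cons_val_zero, Matrix.cons_val_one, Matrix.cons_val,
    ← ENNReal.rpow_mul, mul_one_div_cancel hq', mul_div_cancel₀ _ hs', ENNReal.rpow_one,
    ENNReal.rpow_ofNat, ENNReal.one_rpow, mul_one, setLIntegral_one] at hholder
  refine hholder.trans ?_
  rw [eLpNorm_nnreal_eq_lintegral hq.ne', eLpNorm_nnreal_eq_lintegral hs.ne',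
    ← ENNReal.rpow_mul_natCast, Nat.cast_ofNat, one_div_mul_eq_div]
  gcongr
  exact Measure.restrict_le_self

lemma setLIntegral_enorm_le (hq : 1 ≤ q) (hb : AEStronglyMeasurable b μ) (A : Set α) :
    ∫⁻ y in A, ‖b y‖ₑ ∂μ ≤ eLpNorm b q (μ.restrict A) * μ A ^ (1 - 1 / q : ℝ) := by
  simpa [eLpNorm_one_eq_lintegral_enorm] using
    eLpNorm_le_eLpNorm_mul_rpow_measure_univ (p := 1) (ENNReal.one_le_coe_iff.2 hq) hb.restrict

lemma exists_eLpNorm_restrict_add_le {b₁ b₂ : α → ℝ} (hq : 1 ≤ q) (hb₁ : MemLp b₁ ⊤ μ)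
    (hb₂ : MemLp b₂ q μ) :
    ∃ K : ℝ≥0, ∀ A, μ A ≤ 1 → eLpNorm (b₁ + b₂) q (μ.restrict A) ≤ K := by
  refine ⟨(eLpNorm b₁ ⊤ μ + eLpNorm b₂ q μ).toNNReal, fun A hA => ?_⟩
  rw [ENNReal.coe_toNNReal (ENNReal.add_ne_top.2 ⟨hb₁.2.ne, hb₂.2.ne⟩)]
  refine (eLpNorm_add_le hb₁.1.restrict hb₂.1.restrict (ENNReal.one_le_coe_iff.2 hq)).trans ?_
  gcongr
  · calc eLpNorm b₁ q (μ.restrict A) ≤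
          eLpNorm b₁ ⊤ (μ.restrict A) * μ A ^ (1 / (q : ℝ)) := by
          simpa using eLpNorm_le_eLpNorm_mul_rpow_measure_univ (p := q) (q := ⊤) le_top
            hb₁.1.restrict
      _ ≤ eLpNorm b₁ ⊤ μ * 1 := by
          gcongr
          · exact Measure.restrict_le_self
          · exact ENNReal.rpow_le_one hA (by positivity)
      _ = eLpNorm b₁ ⊤ μ := mul_one _
  · exact Measure.restrict_le_self

lemma tendsto_measure_lt_abs (hs : 0 < s) (hu : MemLp u s μ) :
    Tendsto (fun k : ℝ => μ {y | k < |u y|}) atTop (𝓝 0) := by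
  have hbound : ∀ᶠ k : ℝ in atTop,
      μ {y | k < |u y|} ≤ (ENNReal.ofReal k)⁻¹ ^ (s : ℝ) * eLpNorm u s μ ^ (s : ℝ) := by
    filter_upwards [eventually_gt_atTop 0] with k hk
    refine (measure_mono fun y (hy : k < |u y|) => ?_).trans
      (meas_ge_le_mul_pow_eLpNorm_enorm μ (by exact_mod_cast hs.ne') ENNReal.coe_ne_top hu.1
        (ENNReal.ofReal_pos.2 hk).ne' (by simp))
    rw [mem_ofPred_eq, Real.enorm_eq_ofReal_abs]
    exact ENNReal.ofReal_le_ofReal hy.le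
  refine tendsto_of_tendsto_of_tendsto_of_le_of_le' tendsto_const_nhds ?_
    (Eventually.of_forall fun _ => zero_le) hbound
  have hinv := (tendsto_inv_iff.2 ENNReal.tendsto_ofReal_atTop).ennrpow_const (s : ℝ)
  rw [ENNReal.inv_top, ENNReal.zero_rpow_of_pos (by exact_mod_cast hs)] at hinv
  simpa using ENNReal.Tendsto.mul_const hinv (Or.inr
    (ENNReal.rpow_ne_top_of_nonneg s.coe_nonneg hu.2.ne))

variable {k δ : ℝ}

lemma abs_mul_abs_softThreshold_le (hδ : 0 < δ) (hδk : δ ≤ k) (t : ℝ) :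
    |t| * |softThreshold k δ t| ≤ 2 * |softThreshold k δ t| ^ 2 + k ^ 2 := by
  have hle := sub_sub_le_abs_softThreshold (hδ.le.trans hδk) hδ t
  nlinarith [abs_nonneg (softThreshold k δ t), sq_nonneg (|softThreshold k δ t| - k)]

lemma lintegral_mul_softThreshold_le (hδ : 0 < δ) (hδk : δ ≤ k)
    (hb : AEStronglyMeasurable b μ) :
    ∫⁻ y, ‖b y‖ₑ * (‖u y‖ₑ * ‖softThreshold k δ (u y)‖ₑ) ∂μ ≤
      2 * ∫⁻ y in {y | k < |u y|}, ‖b y‖ₑ * ‖softThreshold k δ (u y)‖ₑ ^ 2 ∂μ +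
        ENNReal.ofReal (k ^ 2) * ∫⁻ y in {y | k < |u y|}, ‖b y‖ₑ ∂μ := by
  set A := {y | k < |u y|}
  have hpt : ∀ t, ‖t‖ₑ * ‖softThreshold k δ t‖ₑ ≤
      2 * ‖softThreshold k δ t‖ₑ ^ 2 + ENNReal.ofReal (k ^ 2) := fun t => by
    have := ENNReal.ofReal_le_ofReal (abs_mul_abs_softThreshold_le hδ hδk t)
    simpa [Real.enorm_eq_ofReal_abs, ENNReal.ofReal_mul, ENNReal.ofReal_add, sq_nonneg,
      ← ENNReal.ofReal_pow] using this
  calc _ = ∫⁻ y, A.indicator (fun y => ‖b y‖ₑ * (‖u y‖ₑ * ‖softThreshold k δ (u y)‖ₑ)) y ∂μ := by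
        congr 1 with y
        by_cases hy : y ∈ A
        · rw [indicator_of_mem hy]
        · rw [indicator_of_notMem hy, softThreshold_eq_zero hδ (not_lt.1 hy), enorm_zero, mul_zero,
            mul_zero]
    _ ≤ ∫⁻ y in A, ‖b y‖ₑ * (‖u y‖ₑ * ‖softThreshold k δ (u y)‖ₑ) ∂μ := lintegral_indicator_le _ _
    _ ≤ ∫⁻ y in A, (2 * (‖b y‖ₑ * ‖softThreshold k δ (u y)‖ₑ ^ 2) +
          ENNReal.ofReal (k ^ 2) * ‖b y‖ₑ) ∂μ := by
        refine lintegral_mono fun y => (mul_le_mul_right (hpt (u y)) ‖b y‖ₑ).trans_eq ?_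
        ring
    _ = _ := by
        rw [lintegral_add_right' _ (hb.restrict.enorm.const_mul _),
          lintegral_const_mul' _ _ ENNReal.ofNat_ne_top, lintegral_const_mul' _ _
          ENNReal.ofReal_ne_top]

lemma eLpNorm_softThreshold_sq_le {K : ℝ≥0∞} (hq : 1 ≤ q) (hs : 0 < s)
    (hqs : (1 / q + 2 / s : ℝ) ≤ 1) (hδ : 0 < δ) (hδk : δ ≤ k) (hb : AEStronglyMeasurable b μ)
    (hu : MemLp u s μ) (hK : eLpNorm b q (μ.restrict {y | k < |u y|}) ≤ K)
    (hsmall : 2 * K * μ {y | k < |u y|} ^ (1 - 1 / q - 2 / s : ℝ) ≤ 2⁻¹)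
    (henergy : eLpNorm (fun y => softThreshold k δ (u y)) s μ ^ 2 ≤
      ∫⁻ y, ‖b y‖ₑ * (‖u y‖ₑ * ‖softThreshold k δ (u y)‖ₑ) ∂μ) :
    eLpNorm (fun y => softThreshold k δ (u y)) s μ ^ 2 ≤
      2 * K * ENNReal.ofReal (k ^ 2) * μ {y | k < |u y|} ^ (1 - 1 / q : ℝ) := by
  have hk := hδ.le.trans hδk
  have hw : MemLp (fun y => softThreshold k δ (u y)) s μ := by
    refine (lipschitzWith_one_of_norm_deriv_le
      ((contDiff_softThreshold k δ).differentiable (by simp)) fun t => ?_).comp_memLp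
      (softThreshold_eq_zero hδ (by simpa using hk)) hu
    rw [Real.norm_of_nonneg (deriv_softThreshold_mem_Icc hk hδ t).1]
    exact (deriv_softThreshold_mem_Icc hk hδ t).2
  set A := {y | k < |u y|}
  set X := eLpNorm (fun y => softThreshold k δ (u y)) s μ ^ 2
  set Y := K * ENNReal.ofReal (k ^ 2) * μ A ^ (1 - 1 / q : ℝ)
  have hX : X ≠ ⊤ := ENNReal.pow_ne_top hw.2.ne
  have habsorb : X ≤ 2⁻¹ * X + Y := by
    calc X ≤ 2 * ∫⁻ y in A, ‖b y‖ₑ * ‖softThreshold k δ (u y)‖ₑ ^ 2 ∂μ +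
          ENNReal.ofReal (k ^ 2) * ∫⁻ y in A, ‖b y‖ₑ ∂μ :=
          henergy.trans (lintegral_mul_softThreshold_le hδ hδk hb)
      _ ≤ 2 * (K * X * μ A ^ (1 - 1 / q - 2 / s : ℝ)) +
          ENNReal.ofReal (k ^ 2) * (K * μ A ^ (1 - 1 / q : ℝ)) := by
          gcongr
          · refine (setLIntegral_mul_sq_le (zero_lt_one.trans_le hq) hs hqs hb hw.1 A).trans ?_
            gcongr
          · exact (setLIntegral_enorm_le hq hb A).trans (by gcongr)
      _ = 2 * K * μ A ^ (1 - 1 / q - 2 / s : ℝ) * X + Y := by ring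
      _ ≤ 2⁻¹ * X + Y := by gcongr
  have hhalf : 2⁻¹ * X ≤ Y := by
    refine ENNReal.le_of_add_le_add_left (ENNReal.mul_ne_top (by simp) hX) (le_trans ?_ habsorb)
    rw [← add_mul, ENNReal.inv_two_add_inv_two, one_mul]
  calc X = 2 * (2⁻¹ * X) := by
        rw [← mul_assoc, ENNReal.mul_inv_cancel two_ne_zero ENNReal.ofNat_ne_top, one_mul]
    _ ≤ 2 * Y := by gcongr
    _ = _ := by ring

lemma measure_lt_abs_le_eLpNorm_softThreshold (hs : 0 < s) (hk : 0 ≤ k) (hδ : 0 < δ)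
    (hu : AEStronglyMeasurable u μ) :
    μ {y | k + 2 * δ < |u y|} ≤ (ENNReal.ofReal (δ ^ 2)⁻¹ *
      eLpNorm (fun y => softThreshold k δ (u y)) s μ ^ 2) ^ (s / 2 : ℝ) := by
  have hδ' : ENNReal.ofReal δ ≠ 0 := (ENNReal.ofReal_pos.2 hδ).ne'
  have hsub : {y | k + 2 * δ < |u y|} ⊆ {y | ENNReal.ofReal δ ≤ ‖softThreshold k δ (u y)‖ₑ} :=
    fun y (hy : k + 2 * δ < |u y|) => by
      rw [mem_ofPred_eq, Real.enorm_eq_ofReal_abs]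
      exact ENNReal.ofReal_le_ofReal (by linarith [sub_sub_le_abs_softThreshold hk hδ (u y)])
  calc _ ≤ (ENNReal.ofReal δ)⁻¹ ^ (s : ℝ) *
        eLpNorm (fun y => softThreshold k δ (u y)) s μ ^ (s : ℝ) :=
        (measure_mono hsub).trans (meas_ge_le_mul_pow_eLpNorm_enorm μ (by exact_mod_cast hs.ne')
          ENNReal.coe_ne_top ((contDiff_softThreshold k δ).continuous.comp_aestronglyMeasurable hu)
          hδ' (by simp))
    _ = _ := by
        rw [← ENNReal.mul_rpow_of_nonneg _ _ s.coe_nonneg,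
          ENNReal.ofReal_inv_of_pos (by positivity), ENNReal.ofReal_pow hδ.le, ENNReal.inv_pow,
          ← mul_pow, ← ENNReal.rpow_natCast_mul, Nat.cast_ofNat, mul_div_cancel₀ _ two_ne_zero]

lemma measure_lt_abs_add_le {K : ℝ≥0∞} (hq : 1 ≤ q) (hs : 0 < s)
    (hqs : (1 / q + 2 / s : ℝ) ≤ 1) (hδ : 0 < δ) (hδk : δ ≤ k) (hb : AEStronglyMeasurable b μ)
    (hu : MemLp u s μ) (hK : eLpNorm b q (μ.restrict {y | k < |u y|}) ≤ K)
    (hsmall : 2 * K * μ {y | k < |u y|} ^ (1 - 1 / q - 2 / s : ℝ) ≤ 2⁻¹)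
    (henergy : eLpNorm (fun y => softThreshold k δ (u y)) s μ ^ 2 ≤
      ∫⁻ y, ‖b y‖ₑ * (‖u y‖ₑ * ‖softThreshold k δ (u y)‖ₑ) ∂μ) :
    μ {y | k + 2 * δ < |u y|} ≤
      (2 * K * ENNReal.ofReal ((k / δ) ^ 2)) ^ (s / 2 : ℝ) *
        μ {y | k < |u y|} ^ ((1 - 1 / q) * (s / 2) : ℝ) := by
  refine (measure_lt_abs_le_eLpNorm_softThreshold hs (hδ.le.trans hδk) hδ hu.1).trans ?_
  rw [ENNReal.rpow_mul, ← ENNReal.mul_rpow_of_nonneg _ _ (by positivity)]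
  refine ENNReal.rpow_le_rpow ?_ (by positivity)
  calc _ ≤ ENNReal.ofReal (δ ^ 2)⁻¹ *
        (2 * K * ENNReal.ofReal (k ^ 2) * μ {y | k < |u y|} ^ (1 - 1 / q : ℝ)) := by
        gcongr
        exact eLpNorm_softThreshold_sq_le hq hs hqs hδ hδk hb hu hK hsmall henergy
    _ = _ := by
        rw [div_pow, div_eq_mul_inv (k ^ 2), ENNReal.ofReal_mul (sq_nonneg k)]
        ring

lemma eventually_mul_rpow_le {ι : Type*} {l : Filter ι} {a : ι → ℝ≥0∞} (ha : Tendsto a l (𝓝 0))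
    {c d : ℝ≥0∞} (hc : c ≠ ⊤) (hd : d ≠ 0) {p : ℝ} (hp : 0 < p) :
    ∀ᶠ i in l, c * a i ^ p ≤ d := by
  have hlim := ENNReal.Tendsto.const_mul (ha.ennrpow_const p) (Or.inr hc)
  rw [ENNReal.zero_rpow_of_pos hp, mul_zero] at hlim
  exact hlim.eventually_le_const (pos_iff_ne_zero.2 hd)

/-- The levels `k₀ = l 0 < l 1 < …`, increasing to `2 * k₀`, of the iteration. -/
noncomputable def level (k₀ : ℝ) (n : ℕ) : ℝ := k₀ * (2 - (1 / 2) ^ n)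

lemma level_zero (k₀ : ℝ) : level k₀ 0 = k₀ := by norm_num [level]

lemma level_mem_Icc {k₀ : ℝ} (hk₀ : 0 ≤ k₀) (n : ℕ) : level k₀ n ∈ Icc k₀ (2 * k₀) := by
  have hpos : (0 : ℝ) ≤ (1 / 2) ^ n := by positivity
  have hle : (1 / 2 : ℝ) ^ n ≤ 1 := pow_le_one₀ (by norm_num) (by norm_num)
  constructor <;> simp only [level] <;> nlinarith

lemma level_succ (k₀ : ℝ) (n : ℕ) :
    level k₀ (n + 1) = level k₀ n + 2 * (k₀ * (1 / 2) ^ n / 4) := by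
  simp only [level, pow_succ]
  ring

lemma sq_level_div_le {k₀ : ℝ} (hk₀ : 0 < k₀) (n : ℕ) :
    (level k₀ n / (k₀ * (1 / 2) ^ n / 4)) ^ 2 ≤ 64 * 4 ^ n := by
  have hmem := level_mem_Icc hk₀.le n
  calc _ ≤ (2 * k₀ / (k₀ * (1 / 2) ^ n / 4)) ^ 2 := by
        have := hk₀.le.trans hmem.1
        gcongr
        exact hmem.2
    _ = (8 * 2 ^ n) ^ 2 := by
        rw [one_div, inv_pow]
        field_simp
        norm_num
    _ = 64 * 4 ^ n := by
        rw [mul_pow, ← pow_mul, mul_comm n, pow_mul]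
        norm_num

lemma measure_level_succ_le {K : ℝ≥0∞} {k₀ : ℝ} (hk₀ : 0 < k₀) (hq : 1 ≤ q) (hs : 0 < s)
    (hqs : (1 / q + 2 / s : ℝ) ≤ 1) (hb : AEStronglyMeasurable b μ) (hu : MemLp u s μ)
    (hK : eLpNorm b q (μ.restrict {y | k₀ < |u y|}) ≤ K)
    (hsmall : 2 * K * μ {y | k₀ < |u y|} ^ (1 - 1 / q - 2 / s : ℝ) ≤ 2⁻¹)
    (henergy : ∀ k δ, 0 < k → 0 < δ → eLpNorm (fun y => softThreshold k δ (u y)) s μ ^ 2 ≤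
      ∫⁻ y, ‖b y‖ₑ * (‖u y‖ₑ * ‖softThreshold k δ (u y)‖ₑ) ∂μ) (n : ℕ) :
    μ {y | level k₀ (n + 1) < |u y|} ≤
      (128 * K) ^ (s / 2 : ℝ) * (4 ^ (s / 2 : ℝ)) ^ n *
        μ {y | level k₀ n < |u y|} ^ ((1 - 1 / q) * (s / 2) : ℝ) := by
  obtain ⟨hle, -⟩ := level_mem_Icc hk₀.le n
  have hδ : 0 < k₀ * (1 / 2) ^ n / 4 := by positivity
  have hδk : k₀ * (1 / 2) ^ n / 4 ≤ level k₀ n := by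
    have : (1 / 2 : ℝ) ^ n ≤ 1 := pow_le_one₀ (by norm_num) (by norm_num)
    nlinarith
  have hsub : {y | level k₀ n < |u y|} ⊆ {y | k₀ < |u y|} := fun y hy => hle.trans_lt hy
  have hexp : (0 : ℝ) ≤ 1 - 1 / q - 2 / s := by linarith
  rw [level_succ]
  refine (measure_lt_abs_add_le hq hs hqs hδ hδk hb hu
    ((eLpNorm_mono_measure b (Measure.restrict_mono hsub le_rfl)).trans hK)
    (le_trans (by gcongr) hsmall) (henergy _ _ (hk₀.trans_le hle) hδ)).trans ?_
  gcongr
  calc _ ≤ (2 * K * ENNReal.ofReal (64 * 4 ^ n)) ^ (s / 2 : ℝ) := by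
        gcongr
        exact sq_level_div_le hk₀ n
    _ = (128 * K * 4 ^ n) ^ (s / 2 : ℝ) := by
        rw [ENNReal.ofReal_mul (by norm_num), ENNReal.ofReal_pow (by norm_num),
          ENNReal.ofReal_ofNat, ENNReal.ofReal_ofNat]
        ring_nf
    _ = _ := by
        rw [ENNReal.mul_rpow_of_nonneg _ _ (by positivity), ← ENNReal.rpow_natCast_mul,
          mul_comm (n : ℝ), ENNReal.rpow_mul_natCast]

lemma exists_ae_abs_le_of_energy_le {K : ℝ≥0} (hq : 1 ≤ q) (hs : 0 < s)
    (hqs : (1 / q + 2 / s : ℝ) < 1) (hb : AEStronglyMeasurable b μ) (hu : MemLp u s μ)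
    (hK : ∀ A, μ A ≤ 1 → eLpNorm b q (μ.restrict A) ≤ K)
    (henergy : ∀ k δ, 0 < k → 0 < δ → eLpNorm (fun y => softThreshold k δ (u y)) s μ ^ 2 ≤
      ∫⁻ y, ‖b y‖ₑ * (‖u y‖ₑ * ‖softThreshold k δ (u y)‖ₑ) ∂μ) :
    ∃ M > 0, ∀ᵐ y ∂μ, |u y| ≤ M := by
  have hs' : (0 : ℝ) < s := by exact_mod_cast hs
  obtain ⟨η, hη⟩ : ∃ η : ℝ, (1 - 1 / q) * (s / 2) = 1 + η := ⟨_, (add_sub_cancel _ _).symm⟩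
  have hη0 : 0 < η := by
    have : (2 / s : ℝ) * (s / 2) < (1 - 1 / q) * (s / 2) := by gcongr; linarith
    rw [div_mul_div_cancel₀ hs'.ne', div_self two_ne_zero] at this
    linarith
  set R : ℝ≥0∞ := 4 ^ (s / 2 : ℝ)
  set ρ : ℝ≥0∞ := R ^ (-1 / η)
  have hR1 : 1 < R := ENNReal.one_lt_rpow (by norm_num) (by positivity)
  have hRtop : R ≠ ⊤ := ENNReal.rpow_ne_top_of_nonneg (by positivity) (by simp)
  have hR0 : R ≠ 0 := (zero_lt_one.trans hR1).ne'
  have hρ1 : ρ < 1 := ENNReal.rpow_lt_one_of_one_lt_of_neg hR1 (div_neg_of_neg_of_pos (by simp) hη0)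
  have hRρ : R * ρ ^ η ≤ 1 := by
    rw [← ENNReal.rpow_mul, div_mul_cancel₀ _ hη0.ne', ENNReal.rpow_neg_one,
      ENNReal.mul_inv_cancel hR0 hRtop]
  have hlim := tendsto_measure_lt_abs hs hu
  obtain ⟨k₀, hone, hsmall, hdecay, hk₀⟩ := ((hlim.eventually_le_const zero_lt_one).and <|
    (eventually_mul_rpow_le (c := 2 * K) (d := 2⁻¹) (p := 1 - 1 / q - 2 / s) hlim
      (ENNReal.mul_ne_top (by simp) (by simp)) (by simp) (by linarith)).and <|
    (eventually_mul_rpow_le (c := (128 * K) ^ (s / 2 : ℝ)) (d := ρ) hlim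
      (ENNReal.rpow_ne_top_of_nonneg (by positivity) (ENNReal.mul_ne_top (by simp) (by simp)))
      (ENNReal.rpow_pos (pos_iff_ne_zero.2 hR0) hRtop).ne' hη0).and (eventually_gt_atTop 0)).exists
  have hgeom := geometric_decay (a := fun n => μ {y | level k₀ n < |u y|}) hη0.le
    (fun n => (measure_level_succ_le hk₀ hq hs hqs.le hb hu (hK _ hone) hsmall henergy n).trans_eq
      (by rw [hη])) hRρ (by rwa [level_zero])
  rw [level_zero] at hgeom
  have hnull : μ {y | 2 * k₀ < |u y|} = 0 := by
    have htend := ENNReal.Tendsto.const_mul (ENNReal.tendsto_pow_atTop_nhds_zero_of_lt_one hρ1)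
      (Or.inr (hone.trans_lt ENNReal.one_lt_top).ne)
    rw [mul_zero] at htend
    refine nonpos_iff_eq_zero.1 (ge_of_tendsto' htend fun n => le_trans ?_ (hgeom n))
    exact measure_mono fun y hy => (level_mem_Icc hk₀.le n).2.trans_lt hy
  refine ⟨2 * k₀, by positivity, ?_⟩
  simpa only [ae_iff, not_le] using hnull

end DeGiorgi

/-! ### Boundedness for the linear boundary problem -/

section NeumannSolution

variable {N : ℕ} {m : ℝ} {v : Amb N → ℝ} {u B : Bdry N → ℝ} {k δ : ℝ}

lemma IsNeumannSolution.dirichletEnergy_softThreshold_add_le (h : IsNeumannSolution m v u B)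
    (hk : 0 ≤ k) (hδ : 0 < δ) :
    dirichletEnergy (fun z => softThreshold k δ (v z)) +
        m ^ 2 * ∫ z, v z * softThreshold k δ (v z) ∂(halfMeasure N) ≤
      ∫ y, B y * softThreshold k δ (u y) :=
  h.dirichletEnergy_comp_add_le (contDiff_softThreshold k δ)
    (softThreshold_eq_zero hδ (by simpa using hk)) (deriv_softThreshold_mem_Icc hk hδ)

lemma IsNeumannSolution.memH1_softThreshold (h : IsNeumannSolution m v u B) (hk : 0 ≤ k)
    (hδ : 0 < δ) :
    MemH1 (fun z => softThreshold k δ (v z)) ∧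
      IsTrace (fun z => softThreshold k δ (v z)) fun y => softThreshold k δ (u y) := by
  obtain ⟨ψ, hψ, htr⟩ := h.isTrace.exists_testApprox_comp h.memH1 (contDiff_softThreshold k δ)
    (softThreshold_eq_zero hδ (by simpa using hk)) fun t => by
      rw [Real.norm_of_nonneg (deriv_softThreshold_mem_Icc hk hδ t).1]
      exact (deriv_softThreshold_mem_Icc hk hδ t).2
  exact ⟨hψ.memH1, htr⟩

lemma integral_mul_softThreshold_nonneg (hk : 0 ≤ k) (hδ : 0 < δ) :
    0 ≤ ∫ z, v z * softThreshold k δ (v z) ∂(halfMeasure N) :=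
  integral_nonneg fun z => mul_softThreshold_nonneg hk hδ (v z)

lemma IsNeumannSolution.ofReal_dirichletEnergy_softThreshold_le (h : IsNeumannSolution m v u B)
    (hk : 0 ≤ k) (hδ : 0 < δ) :
    ENNReal.ofReal (dirichletEnergy fun z => softThreshold k δ (v z)) ≤
      ∫⁻ y, ‖B y * softThreshold k δ (u y)‖ₑ := by
  have hle : dirichletEnergy (fun z => softThreshold k δ (v z)) ≤
      ‖∫ y, B y * softThreshold k δ (u y)‖ := by
    refine le_trans ?_ ((h.dirichletEnergy_softThreshold_add_le hk hδ).trans (le_abs_self _))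
    exact le_add_of_nonneg_right
      (mul_nonneg (sq_nonneg m) (integral_mul_softThreshold_nonneg hk hδ))
  refine (ENNReal.ofReal_le_ofReal hle).trans ?_
  rw [ofReal_norm]
  exact enorm_integral_le_lintegral_enorm _

lemma IsTrace.memLp_traceExponent (hu : IsTrace v u) (hv : MemH1 v) (hN : 2 ≤ N) :
    MemLp u (traceExponent N) volume := by
  obtain ⟨C, hC⟩ := exists_eLpNorm_trace_sq_le_dirichletEnergy hN
  refine ⟨hu.1.1, lt_top_iff_ne_top.2 fun htop => ?_⟩
  have hfin := (hC v u hv hu).trans_lt (ENNReal.mul_lt_top ENNReal.coe_lt_top ENNReal.ofReal_lt_top)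
  simp [htop] at hfin

lemma one_div_add_two_div_traceExponent_lt_one (hN : 1 ≤ N) {q : ℝ≥0} (hq : N < q) :
    (1 / q + 2 / traceExponent N : ℝ) < 1 := by
  have hN' : (0 : ℝ) < N := by exact_mod_cast hN
  have hlt : (1 / q : ℝ) < 1 / N := one_div_lt_one_div_of_lt hN' (by exact_mod_cast hq)
  rw [div_eq_mul_inv 2, two_mul_inv_traceExponent hN, ← one_div]
  linarith

lemma IsNeumannSolution.exists_ae_abs_trace_le (h : IsNeumannSolution m v u B) (hN : 2 ≤ N)
    {q : ℝ≥0} (hq : N < q) {b₁ b₂ : Bdry N → ℝ} (hb₁ : MemLp b₁ ⊤ volume)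
    (hb₂ : MemLp b₂ q volume) (hB : ∀ᵐ y, |B y| ≤ |b₁ y + b₂ y| * |u y|) :
    ∃ M > 0, ∀ᵐ y, |u y| ≤ M := by
  obtain ⟨C, hC⟩ := exists_eLpNorm_trace_sq_le_dirichletEnergy hN
  have hN1 : 1 ≤ N := by lia
  have hq1 : 1 ≤ q := le_trans (by exact_mod_cast hN1) hq.le
  have hb₁' := hb₁.const_mul (C : ℝ)
  have hb₂' := hb₂.const_mul (C : ℝ)
  obtain ⟨K, hK⟩ := exists_eLpNorm_restrict_add_le hq1 hb₁' hb₂'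
  refine exists_ae_abs_le_of_energy_le hq1 (zero_lt_two.trans (two_lt_traceExponent hN))
    (one_div_add_two_div_traceExponent_lt_one hN1 hq) (hb₁'.1.add hb₂'.1)
    (h.isTrace.memLp_traceExponent h.memH1 hN) hK fun k δ hk hδ => ?_
  obtain ⟨hw, htr⟩ := h.memH1_softThreshold hk.le hδ
  calc _ ≤ C * ENNReal.ofReal (dirichletEnergy fun z => softThreshold k δ (v z)) :=
        hC _ _ hw htr
    _ ≤ C * ∫⁻ y, ‖B y * softThreshold k δ (u y)‖ₑ := by
        gcongr
        exact h.ofReal_dirichletEnergy_softThreshold_le hk.le hδ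
    _ = ∫⁻ y, C * ‖B y * softThreshold k δ (u y)‖ₑ :=
        (lintegral_const_mul' _ _ ENNReal.coe_ne_top).symm
    _ ≤ _ := by
        refine lintegral_mono_ae (hB.mono fun y hy => ?_)
        have hBu : ‖B y‖ₑ ≤ ‖b₁ y + b₂ y‖ₑ * ‖u y‖ₑ := by
          simpa only [Real.enorm_eq_ofReal_abs, ← ENNReal.ofReal_mul (abs_nonneg _)] using
            ENNReal.ofReal_le_ofReal hy
        calc _ ≤ C * (‖b₁ y + b₂ y‖ₑ * ‖u y‖ₑ * ‖softThreshold k δ (u y)‖ₑ) := by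
              rw [enorm_mul]
              gcongr
          _ = _ := by
              rw [Pi.add_apply, ← mul_add, enorm_mul, NNReal.enorm_eq]
              ring

lemma IsNeumannSolution.ae_abs_le_of_trace (h : IsNeumannSolution m v u B) (hm : 0 < m) {M : ℝ}
    (hM : 0 ≤ M) (hu : ∀ᵐ y, |u y| ≤ M) : ∀ᵐ z ∂(halfMeasure N), |v z| ≤ M := by
  have hdelta : ∀ δ > 0, ∀ᵐ z ∂(halfMeasure N), |v z| ≤ M + δ := fun δ hδ => by
    have hbdry : ∫ y, B y * softThreshold M δ (u y) = 0 :=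
      integral_eq_zero_of_ae (hu.mono fun y hy => by simp [softThreshold_eq_zero hδ hy])
    have henergy := h.dirichletEnergy_softThreshold_add_le hM hδ
    have hnonneg : 0 ≤ dirichletEnergy fun z => softThreshold M δ (v z) :=
      integral_nonneg fun z => dot_self_nonneg _
    have hzero : ∫ z, v z * softThreshold M δ (v z) ∂(halfMeasure N) = 0 := by
      refine le_antisymm (le_of_mul_le_mul_left ?_ (pow_pos hm 2))
        (integral_mul_softThreshold_nonneg hM hδ)
      linarith
    filter_upwards [(integral_eq_zero_iff_of_nonneg
      (fun z => mul_softThreshold_nonneg hM hδ (v z))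
      (h.memH1.1.integrable_mul (h.memH1_softThreshold hM hδ).1.1)).1 hzero] with z hz
    have hle := sub_sub_le_abs_softThreshold hM hδ (v z)
    rcases mul_eq_zero.1 hz with hz | hz
    · rw [hz, abs_zero]
      positivity
    · rw [hz, abs_zero] at hle
      linarith
  have hseq : ∀ᵐ z ∂(halfMeasure N), ∀ n : ℕ, |v z| ≤ M + 1 / (n + 1) :=
    ae_all_iff.2 fun n => hdelta _ Nat.one_div_pos_of_nat
  filter_upwards [hseq] with z hz
  have hlim := (tendsto_one_div_add_atTop_nhds_zero_nat (𝕜 := ℝ)).const_add M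
  rw [add_zero] at hlim
  exact ge_of_tendsto' hlim hz

end NeumannSolution

/-! ### The space `L^∞ + L^q` -/

section MemLinftyAddLp

variable {α E : Type*} [MeasurableSpace α] {μ : Measure α} [NormedAddCommGroup E]

lemma memLp_of_ae_norm_le_one {f : α → E} {p t : ℝ≥0∞} (hf : MemLp f p μ) (hp : p ≠ 0)
    (hf1 : ∀ᵐ x ∂μ, ‖f x‖ ≤ 1) (hpt : p ≤ t) : MemLp f t μ := by
  rcases eq_or_ne t ⊤ with rfl | ht
  · exact memLp_top_of_bound hf.1 1 hf1
  have hp' : p ≠ ⊤ := ne_top_of_le_ne_top ht hpt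
  refine ⟨hf.1, ?_⟩
  rw [eLpNorm_lt_top_iff_lintegral_rpow_enorm_lt_top (hp.bot_lt.trans_le hpt).ne' ht]
  refine (lintegral_mono_ae ?_).trans_lt
    ((eLpNorm_lt_top_iff_lintegral_rpow_enorm_lt_top hp hp').1 hf.2)
  filter_upwards [hf1] with x hx
  exact ENNReal.rpow_le_rpow_of_exponent_ge (by simpa [← ofReal_norm] using hx)
    (ENNReal.toReal_mono ht hpt)

lemma memLp_indicator_compl_lt_norm {f : α → E} {p t : ℝ≥0∞} (hf : MemLp f p μ) (hp : p ≠ 0)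
    (hpt : p ≤ t) : MemLp ({x | 1 < ‖f x‖}ᶜ.indicator f) t μ := by
  have hle : ∀ x, ‖({x | 1 < ‖f x‖}ᶜ.indicator f) x‖ ≤ 1 := fun x => by
    by_cases hx : 1 < ‖f x‖
    · rw [indicator_of_notMem (not_not_intro hx), norm_zero]
      exact zero_le_one
    · rw [indicator_of_mem hx]
      exact not_lt.1 hx
  have hmeas : NullMeasurableSet {x | 1 < ‖f x‖}ᶜ μ :=
    (nullMeasurableSet_lt aemeasurable_const hf.1.norm.aemeasurable).compl
  exact memLp_of_ae_norm_le_one (hf.of_le (hf.1.indicator₀ hmeas) (Eventually.of_forall fun x =>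
    norm_indicator_le_norm_self f x)) hp (Eventually.of_forall hle) hpt

lemma memLp_indicator_lt_norm {f : α → E} {p q t : ℝ≥0∞} (hp : p ≠ 0) (hp' : p ≠ ⊤)
    (hfp : MemLp f p μ) (hfq : MemLp f q μ) (htq : t ≤ q) :
    MemLp ({x | 1 < ‖f x‖}.indicator f) t μ := by
  have hmeas : NullMeasurableSet {x | 1 < ‖f x‖} μ :=
    nullMeasurableSet_lt aemeasurable_const hfp.1.norm.aemeasurable
  refine (hfq.of_le (hfq.1.indicator₀ hmeas) (Eventually.of_forall fun x =>
    norm_indicator_le_norm_self f x)).mono_exponent_of_measure_support_ne_top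
    (fun x hx => indicator_of_notMem hx f) (((measure_mono fun x hx => ?_).trans_lt
      (hfp.meas_ge_lt_top hp hp' one_ne_zero)).ne) htq
  exact le_of_lt (show 1 < ‖f x‖ from hx)

lemma memLp_of_memLp_of_memLp {f : α → E} {p q t : ℝ≥0∞} (hp : p ≠ 0) (hfp : MemLp f p μ)
    (hfq : MemLp f q μ) (hpt : p ≤ t) (htq : t ≤ q) : MemLp f t μ := by
  rcases eq_or_ne p ⊤ with rfl | hp'
  · rwa [top_le_iff.1 hpt]
  rw [← indicator_self_add_compl {x | 1 < ‖f x‖} f]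
  exact (memLp_indicator_lt_norm hp hp' hfp hfq htq).add (memLp_indicator_compl_lt_norm hfp hp hpt)

/-- The space `L^∞ + L^q`. -/
def MemLinftyAddLp (g : α → ℝ) (q : ℝ≥0∞) (μ : Measure α) : Prop :=
  ∃ b₁ b₂ : α → ℝ, MemLp b₁ ⊤ μ ∧ MemLp b₂ q μ ∧ g =ᵐ[μ] b₁ + b₂

variable {f g : α → ℝ} {p q : ℝ≥0∞}

lemma MemLinftyAddLp.add (hf : MemLinftyAddLp f q μ) (hg : MemLinftyAddLp g q μ) :
    MemLinftyAddLp (f + g) q μ := by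
  obtain ⟨a₁, a₂, ha₁, ha₂, hf⟩ := hf
  obtain ⟨b₁, b₂, hb₁, hb₂, hg⟩ := hg
  refine ⟨a₁ + b₁, a₂ + b₂, ha₁.add hb₁, ha₂.add hb₂, ?_⟩
  filter_upwards [hf, hg] with x hfx hgx
  simp only [Pi.add_apply, hfx, hgx, add_add_add_comm]

lemma MemLinftyAddLp.congr (hf : MemLinftyAddLp f q μ) (h : f =ᵐ[μ] g) : MemLinftyAddLp g q μ :=
  let ⟨b₁, b₂, hb₁, hb₂, hfb⟩ := hf
  ⟨b₁, b₂, hb₁, hb₂, h.symm.trans hfb⟩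

lemma MemLinftyAddLp.aestronglyMeasurable (hf : MemLinftyAddLp f q μ) : AEStronglyMeasurable f μ :=
  let ⟨_, _, hb₁, hb₂, hfb⟩ := hf
  (hb₁.1.add hb₂.1).congr hfb.symm

lemma MemLinftyAddLp.const_mul (hf : MemLinftyAddLp f q μ) (c : ℝ) :
    MemLinftyAddLp (fun x => c * f x) q μ := by
  obtain ⟨a₁, a₂, ha₁, ha₂, hf⟩ := hf
  exact ⟨_, _, ha₁.const_mul c, ha₂.const_mul c, hf.mono fun x hx => by
    simp only [Pi.add_apply, hx, mul_add]⟩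

lemma memLinftyAddLp_of_memLp (hf : MemLp f p μ) (hq : q ≠ 0) (hqp : q ≤ p) :
    MemLinftyAddLp f q μ := by
  rcases eq_or_ne p ⊤ with rfl | hp
  · exact ⟨f, 0, hf, MemLp.zero, by simp⟩
  have hp0 : p ≠ 0 := (hq.bot_lt.trans_le hqp).ne'
  refine ⟨_, _, memLp_indicator_compl_lt_norm hf hp0 le_top,
    memLp_indicator_lt_norm hp0 hp hf hf hqp, ?_⟩
  rw [indicator_compl_add_self]

lemma MemLinftyAddLp.mono_exponent (hf : MemLinftyAddLp f p μ) (hq : q ≠ 0) (hqp : q ≤ p) :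
    MemLinftyAddLp f q μ :=
  let ⟨_, _, hb₁, hb₂, hfb⟩ := hf
  ((memLinftyAddLp_of_memLp hb₁ hq le_top).add (memLinftyAddLp_of_memLp hb₂ hq hqp)).congr hfb.symm

lemma MemLinftyAddLp.mul_memLp {s : ℝ≥0∞} (hf : MemLinftyAddLp f p μ) (hg : MemLp g s μ)
    (hq : q ≠ 0) (h : p⁻¹ + s⁻¹ = q⁻¹) : MemLinftyAddLp (f * g) q μ := by
  obtain ⟨b₁, b₂, hb₁, hb₂, hfb⟩ := hf
  have : ENNReal.HolderTriple p s q := ⟨h⟩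
  have hqs : q ≤ s := ENNReal.inv_le_inv.1 (le_add_self.trans_eq h)
  refine ((memLinftyAddLp_of_memLp (hg.mul (r := s) hb₁) hq hqs).add
    (memLinftyAddLp_of_memLp (hg.mul (r := q) hb₂) hq le_rfl)).congr (hfb.mono fun x hx => ?_)
  simp only [Pi.add_apply, Pi.mul_apply, hx, add_mul]

lemma MemLinftyAddLp.integrable_mul {s : ℝ≥0∞} (hg : MemLinftyAddLp g q μ) (hf : MemLp f 1 μ)
    (hfs : MemLp f s μ) (h : q⁻¹ + s⁻¹ ≤ 1) : Integrable (g * f) μ := by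
  obtain ⟨b₁, b₂, hb₁, hb₂, hgb⟩ := hg
  have hq : q.HolderConjugate (1 - q⁻¹)⁻¹ :=
    ENNReal.holderConjugate_iff.2 (by
      rw [inv_inv, add_tsub_cancel_of_le (le_self_add.trans h)])
  have hfq : MemLp f (1 - q⁻¹)⁻¹ μ := memLp_of_memLp_of_memLp one_ne_zero hf hfs
    (ENNReal.one_le_inv.2 tsub_le_self)
    (ENNReal.inv_le_iff_inv_le.2 (ENNReal.le_sub_of_add_le_left
      (ne_top_of_le_ne_top ENNReal.one_ne_top (le_self_add.trans h)) h))
  have hint : Integrable (b₁ * f + b₂ * f) μ := (hb₁.integrable_mul hf).add (hb₂.integrable_mul hfq)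
  refine hint.congr (hgb.mono fun x hx => ?_)
  simp only [Pi.add_apply, Pi.mul_apply, hx, add_mul]

end MemLinftyAddLp

section Convolution

variable {G : Type*} [AddCommGroup G] [MeasurableSpace G] [MeasurableAdd₂ G] [MeasurableNeg G]
  {μ : Measure G} [μ.IsAddLeftInvariant] [SFinite μ] [μ.IsNegInvariant] {f g : G → ℝ}

lemma MemLinftyAddLp.convolution {p r s : ℝ≥0∞} (hr : 1 ≤ r) (hp : 1 ≤ p)
    (h : r⁻¹ + p⁻¹ = 1 + s⁻¹) (hf : MemLinftyAddLp f r μ) (hg : MemLp g 1 μ) (hgp : MemLp g p μ) :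
    MemLinftyAddLp (f ⋆[ContinuousLinearMap.mul ℝ ℝ, μ] g) s μ := by
  obtain ⟨b₁, b₂, hb₁, hb₂, hfb⟩ := hf
  have htop : (⊤ : ℝ≥0∞)⁻¹ + 1⁻¹ = 1 + ⊤⁻¹ := by simp
  refine ⟨_, _, memLp_convolution_mul le_top le_rfl htop hb₁ hg,
    memLp_convolution_mul hr hp h hb₂ hgp, ?_⟩
  filter_upwards [ae_convolutionExistsAt_mul le_top le_rfl htop hb₁ hg,
    ae_convolutionExistsAt_mul hr hp h hb₂ hgp] with x hx₁ hx₂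
  rw [convolution_congr _ hfb EventuallyEq.rfl, hx₁.add_distrib hx₂, Pi.add_apply]

end Convolution

section Growth

variable {f : ℝ → ℝ} {θ K : ℝ}

lemma eq_zero_at_zero_of_eq_zero_of_neg (hf : Continuous f) (hneg : ∀ t, t < 0 → f t = 0) :
    f 0 = 0 := by
  have hzero : EqOn f 0 (closure (Iio 0)) :=
    EqOn.closure (fun t ht => hneg t ht) hf continuous_zero
  exact hzero (by simp)

lemma exists_abs_le_mul_add_rpow (hf : Continuous f) (hneg : ∀ t, t < 0 → f t = 0)
    (hf1 : Tendsto (fun t => |f t| / t) (𝓝[≠] 0) (𝓝 0))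
    (hf2 : Tendsto (fun t => f t / t ^ (θ - 1)) atTop (𝓝 0)) :
    ∃ K, ∀ t, |f t| ≤ K * (|t| + |t| ^ (θ - 1)) := by
  have hsmall : ∀ᶠ t in 𝓝[>] 0, |f t| ≤ t := by
    filter_upwards [(hf1.mono_left (nhdsGT_le_nhdsNE 0)).eventually_lt_const one_pos,
      self_mem_nhdsWithin] with t ht ht0
    exact ((div_lt_one ht0).1 ht).le
  have hlarge : ∀ᶠ t in atTop, |f t| ≤ t ^ (θ - 1) := by
    filter_upwards [hf2.abs.eventually_lt_const (u := 1) (by simp), eventually_gt_atTop 0]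
      with t ht ht0
    rw [abs_div, abs_of_pos (Real.rpow_pos_of_pos ht0 _)] at ht
    exact ((div_lt_one (Real.rpow_pos_of_pos ht0 _)).1 ht).le
  obtain ⟨δ, hδ, hsmall⟩ := mem_nhdsGT_iff_exists_Ioo_subset.1 hsmall
  obtain ⟨R, hlarge⟩ := eventually_atTop.1 hlarge
  obtain ⟨b, hb⟩ := (isCompact_Icc (a := δ) (b := R)).exists_bound_of_continuousOn hf.continuousOn
  have hK : 0 ≤ |b| / δ := by have : 0 < δ := hδ; positivity
  refine ⟨1 + |b| / δ, fun t => ?_⟩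
  have hpow : 0 ≤ |t| ^ (θ - 1) := by positivity
  suffices h : |f t| ≤ |t| + |t| ^ (θ - 1) ∨ |f t| ≤ |b| / δ * |t| by
    rcases h with h | h <;> nlinarith [abs_nonneg t]
  rcases lt_trichotomy t 0 with ht | rfl | ht
  · left; rw [hneg t ht, abs_zero]; positivity
  · left; rw [eq_zero_at_zero_of_eq_zero_of_neg hf hneg]; simpa using hpow
  rw [abs_of_pos ht] at hpow ⊢
  rcases lt_or_ge t δ with htδ | htδ
  · left; linarith [show |f t| ≤ t from hsmall ⟨ht, htδ⟩]
  rcases le_total t R with htR | htR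
  · right
    calc |f t| ≤ |b| := (hb t ⟨htδ, htR⟩).trans (le_abs_self b)
      _ = |b| / δ * δ := (div_mul_cancel₀ _ (ne_of_gt hδ)).symm
      _ ≤ |b| / δ * t := by gcongr
  · left; linarith [hlarge t htR]

lemma continuous_prim (hf : Continuous f) : Continuous (prim f) :=
  intervalIntegral.continuous_primitive (fun _ _ => hf.intervalIntegrable _ _) 0

lemma abs_prim_le (hθ : 1 ≤ θ) (hf : ∀ t, |f t| ≤ K * (|t| + |t| ^ (θ - 1))) (t : ℝ) :
    |prim f t| ≤ K * (|t| ^ (2 : ℝ) + |t| ^ θ) := by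
  have hK : 0 ≤ K := by simpa using (abs_nonneg _).trans (hf 1)
  have hbound : ∀ s ∈ uIoc 0 t, ‖f s‖ ≤ K * (|t| + |t| ^ (θ - 1)) := fun s hs => by
    have hst : |s| ≤ |t| := by simpa using abs_sub_left_of_mem_uIcc (uIoc_subset_uIcc hs)
    exact (hf s).trans (by gcongr)
  calc |prim f t| ≤ K * (|t| + |t| ^ (θ - 1)) * |t - 0| :=
        intervalIntegral.norm_integral_le_of_norm_le_const hbound
    _ = K * (|t| ^ (2 : ℝ) + |t| ^ (θ - 1 + 1)) := by
        rw [Real.rpow_add_one' (abs_nonneg t) (by linarith), Real.rpow_two, sub_zero]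
        ring
    _ = _ := by rw [sub_add_cancel]

end Growth

/-! ### The Hartree coefficient -/

section HartreeCoefficient

variable {N : ℕ} {θ : ℝ≥0} {r K : ℝ} {f : ℝ → ℝ} {W u : Bdry N → ℝ}

lemma aestronglyMeasurable_hartree (hf : Continuous f)
    (hW : AEStronglyMeasurable W volume) (hu : AEStronglyMeasurable u volume) :
    AEStronglyMeasurable (hartree W f u) volume :=
  (AEStronglyMeasurable.convolution_integrand (ContinuousLinearMap.mul ℝ ℝ) hW
    ((continuous_prim hf).comp_aestronglyMeasurable hu)).integral_prod_right'

lemma exists_exponents_real {θ τ : ℝ} (hθ : 2 < θ) (hτ : 1 / 4 ≤ τ) (hθτ : θ * τ < 1)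
    (hr : 0 ≤ r) (hr' : r < 2 - 2 * (θ * τ)) :
    r ≤ 1 ∧ ∃ α β : ℝ, 0 ≤ α ∧ r + β = 1 + α ∧ θ * τ ≤ β ∧ β ≤ 1 ∧
      α + (θ - 2) * τ < 1 - 2 * τ := by
  refine ⟨by nlinarith, max 0 (r + θ * τ - 1), max (1 - r) (θ * τ), le_max_left _ _, ?_,
    le_max_right _ _, max_le (by linarith) hθτ.le, ?_⟩
  · rw [← max_add_add_left, ← max_add_add_left]
    congr 1 <;> ring
  · have hα : max 0 (r + θ * τ - 1) < 1 - θ * τ := max_lt (by linarith) (by linarith)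
    linarith

lemma memLp_abs_rpow {α : Type*} [MeasurableSpace α] {μ : Measure α} {u : α → ℝ} {s : ℝ≥0∞}
    (hu : MemLp u 2 μ) (hus : MemLp u s μ) {a t : ℝ≥0} (ha : a ≠ 0) (hat : 2 ≤ a * t)
    (hats : (a * t : ℝ≥0∞) ≤ s) : MemLp (fun x => |u x| ^ (a : ℝ)) t μ := by
  have hmem := (memLp_of_memLp_of_memLp two_ne_zero hu hus (by exact_mod_cast hat)
    hats).norm_rpow_div a
  rwa [mul_comm, ENNReal.mul_div_cancel_right (by simpa) (by simp)] at hmem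

lemma inv_lt_two_sub_of_div_lt (hN : 1 ≤ N) (hθs : θ < traceExponent N)
    (hr : (N : ℝ) / (N * (2 - θ) + θ) < r) :
    0 < r ∧ r⁻¹ < 2 - 2 * (θ * (traceExponent N : ℝ)⁻¹) := by
  have hN0 : (0 : ℝ) < N := by exact_mod_cast hN
  have hden : (N : ℝ) * (2 - θ) + θ = N * (2 - 2 * (θ * (traceExponent N : ℝ)⁻¹)) := by
    rw [mul_left_comm, two_mul_inv_traceExponent hN]
    field_simp
    ring
  have hs0 : 0 < traceExponent N := hθs.trans_le' (by positivity)
  have hθτ : θ * (traceExponent N : ℝ)⁻¹ < 1 :=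
    (mul_inv_lt_iff₀ (by positivity)).2 (by simpa using hθs)
  have hden0 : 0 < 2 - 2 * (θ * (traceExponent N : ℝ)⁻¹) := by linarith
  rw [hden, div_mul_cancel_left₀ hN0.ne'] at hr
  exact ⟨(inv_pos.2 hden0).trans hr, inv_lt_of_inv_lt₀ hden0 hr⟩

lemma exists_exponents (hN : 2 ≤ N) (hθ : 2 < θ) (hθs : θ < traceExponent N)
    (hr : (N : ℝ) / (N * (2 - θ) + θ) < r) :
    1 ≤ ENNReal.ofReal r ∧ ∃ (σ : ℝ≥0∞) (p q : ℝ≥0), 1 ≤ p ∧ θ * p ≤ traceExponent N ∧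
      (ENNReal.ofReal r)⁻¹ + (p : ℝ≥0∞)⁻¹ = 1 + σ⁻¹ ∧
      σ⁻¹ + (traceExponent N / (θ - 2 : ℝ≥0) : ℝ≥0∞)⁻¹ = (q : ℝ≥0∞)⁻¹ ∧ N < q := by
  have hs0 : traceExponent N ≠ 0 := (zero_lt_two.trans (two_lt_traceExponent hN)).ne'
  have hτN := two_mul_inv_traceExponent (N := N) (by omega)
  obtain ⟨hr0, hr⟩ := inv_lt_two_sub_of_div_lt (by omega) hθs hr
  set s := traceExponent N
  have hN2 : (N : ℝ)⁻¹ ≤ 2⁻¹ := inv_anti₀ two_pos (by exact_mod_cast hN)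
  lift r to ℝ≥0 using hr0.le
  obtain ⟨hr1, α, β, hα, hαβ, hβ, hβ1, hαN⟩ := exists_exponents_real (θ := θ) (r := (r : ℝ)⁻¹)
    (by exact_mod_cast hθ) (by linarith)
    ((mul_inv_lt_iff₀ (by positivity)).2 (by simpa using hθs)) (by positivity) hr
  have hβ0 : 0 < β := hβ.trans_lt' (by positivity)
  lift α to ℝ≥0 using hα
  lift β to ℝ≥0 using hβ0.le
  norm_cast at hr0 hr1 hβ hβ1 hβ0 hαβ
  have hq0 : 0 < α + (θ - 2) * s⁻¹ :=
    add_pos_of_nonneg_of_pos α.2 (mul_pos (tsub_pos_of_lt hθ) (by positivity))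
  rw [ENNReal.ofReal_coe_nnreal]
  refine ⟨by exact_mod_cast (inv_le_one₀ hr0).1 hr1, (α : ℝ≥0∞)⁻¹, β⁻¹, (α + (θ - 2) * s⁻¹)⁻¹,
    (one_le_inv₀ hβ0).2 hβ1, ?_, ?_, ?_, ?_⟩
  · rwa [← div_eq_mul_inv, div_le_comm₀ hβ0 (by positivity), div_eq_mul_inv]
  · rw [inv_inv, ENNReal.coe_inv hβ0.ne', inv_inv, ← ENNReal.coe_inv hr0.ne']
    exact_mod_cast hαβ
  · rw [inv_inv, ENNReal.coe_inv hq0.ne', inv_inv, ENNReal.inv_div (by simp) (.inr (by simp [hs0])),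
      ← ENNReal.coe_div (by positivity), div_eq_mul_inv]
    norm_cast
  · rw [← NNReal.coe_lt_coe, NNReal.coe_inv, NNReal.coe_natCast,
      lt_inv_comm₀ (by positivity) (by exact_mod_cast hq0), ← sub_sub_cancel 1 (N : ℝ)⁻¹, ← hτN]
    simpa [NNReal.coe_sub hθ.le] using hαN

lemma memLp_prim_comp (hθ : 2 < θ) (hf : Continuous f)
    (hfK : ∀ t, |f t| ≤ K * (|t| + |t| ^ ((θ : ℝ) - 1))) {s : ℝ≥0∞} {p : ℝ≥0} (hp : 1 ≤ p)
    (hps : θ * p ≤ s) (hu : MemLp u 2 volume) (hus : MemLp u s volume) :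
    MemLp (fun y => prim f (u y)) p volume := by
  have hθp : 2 * p ≤ θ * p := by gcongr
  have h2p : 2 ≤ 2 * p := by simpa using hp
  have hsq := memLp_abs_rpow hu hus two_ne_zero h2p
    (le_trans (by exact_mod_cast hθp) hps)
  have hpow := memLp_abs_rpow hu hus (zero_lt_two.trans hθ).ne' (h2p.trans hθp) hps
  refine (hsq.add hpow).of_le_mul (c := K) ((continuous_prim hf).comp_aestronglyMeasurable hu.1)
    (Eventually.of_forall fun y => ?_)
  rw [Pi.add_apply, Real.norm_of_nonneg (r := _ + _) (by positivity)]
  exact abs_prim_le (by exact_mod_cast (one_lt_two.trans hθ).le) hfK _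

theorem exists_memLinftyAddLp_hartree_mul (hN : 2 ≤ N) (hθ : 2 < θ) (hθs : θ < traceExponent N)
    (hr : (N : ℝ) / (N * (2 - θ) + θ) < r) (hf : Continuous f)
    (hfK : ∀ t, |f t| ≤ K * (|t| + |t| ^ ((θ : ℝ) - 1)))
    (hW : MemLinftyAddLp W (ENNReal.ofReal r) volume) (hu : MemLp u 2 volume)
    (hus : MemLp u (traceExponent N) volume) :
    ∃ q : ℝ≥0, N < q ∧
      MemLinftyAddLp (fun y => hartree W f u y * (K * (1 + |u y| ^ ((θ : ℝ) - 2)))) q volume := by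
  obtain ⟨hr1, σ, p, q, hp, hps, hσ, hq, hqN⟩ := exists_exponents hN hθ hθs hr
  have hq0 : (q : ℝ≥0∞) ≠ 0 := by
    have : 0 < q := lt_of_le_of_lt (by positivity) hqN
    simpa using this.ne'
  have hF := memLp_prim_comp hθ hf hfK hp (s := traceExponent N) (by exact_mod_cast hps) hu hus
  have hF1 := memLp_prim_comp hθ hf hfK le_rfl (s := traceExponent N)
    (by simpa using hθs.le) hu hus
  have hH : MemLinftyAddLp (hartree W f u) σ volume :=
    hW.convolution hr1 (by exact_mod_cast hp) hσ (by simpa using hF1) hF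
  have hqσ : (q : ℝ≥0∞) ≤ σ := ENNReal.inv_le_inv.1 (le_self_add.trans_eq hq)
  have hU : MemLp (fun y => |u y| ^ ((θ : ℝ) - 2)) (traceExponent N / (θ - 2 : ℝ≥0)) volume := by
    have hnorm := hus.norm_rpow_div (θ - 2 : ℝ≥0)
    rwa [ENNReal.coe_toReal, NNReal.coe_sub hθ.le] at hnorm
  refine ⟨q, hqN, (((hH.mono_exponent hq0 hqσ).add (hH.mul_memLp hU hq0 hq)).const_mul K).congr
    (Eventually.of_forall fun y => ?_)⟩
  simp only [Pi.add_apply, Pi.mul_apply]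
  ring

end HartreeCoefficient

/-! ### Boundedness of weak solutions -/

section WeakSolution

variable {N : ℕ} {m K : ℝ} {θ q : ℝ≥0} {f : ℝ → ℝ} {V W B g u w : Bdry N → ℝ} {v : Amb N → ℝ}

lemma integrable_mul_of_abs_le_mul (hN : 2 ≤ N) (hq : N < q) (hg : MemLinftyAddLp g q volume)
    (hB : AEStronglyMeasurable B volume) (hBg : ∀ᵐ y, |B y| ≤ |g y| * |u y|)
    (hu : MemLp u 2 volume) (hus : MemLp u (traceExponent N) volume)
    (hw : MemLp w 2 volume) (hws : MemLp w (traceExponent N) volume) :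
    Integrable (fun y => B y * w y) volume := by
  have hmul : MemLp (u * w) ((traceExponent N : ℝ≥0∞)⁻¹ + (traceExponent N : ℝ≥0∞)⁻¹)⁻¹ volume :=
    have : ENNReal.HolderTriple (traceExponent N) (traceExponent N) _ := ⟨(inv_inv _).symm⟩
    hws.mul hus
  have hexp : (q : ℝ≥0∞)⁻¹ + ((traceExponent N : ℝ≥0∞)⁻¹ + (traceExponent N : ℝ≥0∞)⁻¹) ≤ 1 := by
    have hlt := one_div_add_two_div_traceExponent_lt_one (one_le_two.trans hN) hq
    have hq0 : q ≠ 0 := (hq.trans_le' (by positivity)).ne'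
    have hs0 : traceExponent N ≠ 0 := (zero_lt_two.trans (two_lt_traceExponent hN)).ne'
    rw [← ENNReal.coe_inv hq0, ← ENNReal.coe_inv hs0, ← two_mul]
    norm_cast
    rw [← NNReal.coe_le_coe]
    push_cast
    simpa only [one_div, div_eq_mul_inv, one_mul] using hlt.le
  have hint := hg.integrable_mul (memLp_one_iff_integrable.2 (hu.integrable_mul hw)) hmul
    (by rwa [inv_inv])
  refine hint.mono (hB.mul hw.1) (hBg.mono fun y hy => ?_)
  simp only [Pi.mul_apply, norm_mul, Real.norm_eq_abs, ← mul_assoc]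
  gcongr

lemma abs_le_mul_one_add_rpow_mul_abs {θ : ℝ} (hθ : 1 < θ)
    (hf : ∀ t, |f t| ≤ K * (|t| + |t| ^ (θ - 1))) (t : ℝ) :
    |f t| ≤ K * (1 + |t| ^ (θ - 2)) * |t| :=
  calc |f t| ≤ K * (|t| + |t| ^ (θ - 2 + 1)) := by convert hf t using 4; ring
    _ = _ := by rw [Real.rpow_add_one' (abs_nonneg t) (by linarith)]; ring

lemma IsWeakSolution.isNeumannSolution (hv : IsWeakSolution m V W f v)
    (hVi : ∀ φ, MemH1 φ → Integrable (fun y => V y * trace v y * trace φ y) volume)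
    (hWi : ∀ φ, MemH1 φ →
      Integrable (fun y => hartree W f (trace v) y * f (trace v y) * trace φ y) volume) :
    IsNeumannSolution m v (trace v)
      fun y => hartree W f (trace v) y * f (trace v y) - V y * trace v y where
  memH1 := hv.1
  isTrace := hv.1.isTrace_trace
  integral_eq φ hφ := by
    simp only [sub_mul]
    rw [integral_sub (hWi φ hφ) (hVi φ hφ)]
    linarith [hv.2 φ hφ]

lemma IsNeumannSolution.exists_ae_abs_le (h : IsNeumannSolution m v u B) (hN : 2 ≤ N) (hm : 0 < m)
    (hq : N < q) (hV : MemLp V ⊤ volume) (hg : MemLinftyAddLp g q volume)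
    (hB : ∀ᵐ y, |B y| ≤ (|g y| + |V y|) * |u y|) :
    ∃ M, (∀ᵐ y, |u y| ≤ M) ∧ ∀ᵐ z ∂(halfMeasure N), |v z| ≤ M := by
  obtain ⟨b₁, b₂, hb₁, hb₂, hgb⟩ := hg
  obtain ⟨M, hM, hMu⟩ := h.exists_ae_abs_trace_le hN hq (hb₁.abs.add hV.abs) hb₂.abs <| by
    filter_upwards [hB, hgb] with y hBy hgy
    refine hBy.trans (mul_le_mul_of_nonneg_right ?_ (abs_nonneg _))
    rw [hgy, Pi.add_apply, Pi.add_apply, add_right_comm]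
    exact (add_le_add_left (abs_add_le _ _) _).trans (le_abs_self _)
  exact ⟨M, hMu, h.ae_abs_le_of_trace hm hM.le hMu⟩

theorem IsWeakSolution.exists_ae_abs_le {r : ℝ} (hN : 2 ≤ N) (hm : 0 < m) (hf : Continuous f)
    (hθ : 2 < θ) (hθs : θ < traceExponent N) (hfK : ∀ t, |f t| ≤ K * (|t| + |t| ^ ((θ : ℝ) - 1)))
    (hV : MemLp V ⊤ volume) (hr : (N : ℝ) / (N * (2 - θ) + θ) < r)
    (hW : MemLinftyAddLp W (ENNReal.ofReal r) volume) (hv : IsWeakSolution m V W f v) :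
    ∃ M, (∀ᵐ y, |trace v y| ≤ M) ∧ ∀ᵐ z ∂(halfMeasure N), |v z| ≤ M := by
  have hmem : ∀ φ : Amb N → ℝ, MemH1 φ →
      MemLp (trace φ) 2 volume ∧ MemLp (trace φ) (traceExponent N) volume := fun φ hφ =>
    ⟨hφ.isTrace_trace.1, hφ.isTrace_trace.memLp_traceExponent hφ hN⟩
  obtain ⟨hu, hus⟩ := hmem v hv.1
  obtain ⟨q, hq, hg⟩ := exists_memLinftyAddLp_hartree_mul hN hθ hθs hr hf hfK hW hu hus
  set u := trace v
  set g := fun y => hartree W f u y * (K * (1 + |u y| ^ ((θ : ℝ) - 2))) with hgdef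
  have hBg : ∀ y, |hartree W f u y * f (u y)| ≤ |g y| * |u y| := fun y => by
    rw [hgdef, abs_mul, abs_mul, mul_assoc]
    gcongr
    exact (abs_le_mul_one_add_rpow_mul_abs (by exact_mod_cast one_lt_two.trans hθ) hfK _).trans
      (by gcongr; exact le_abs_self _)
  have hq0 : (q : ℝ≥0∞) ≠ 0 := by simpa using (hq.trans_le' (by positivity)).ne'
  have hBm : AEStronglyMeasurable (fun y => hartree W f u y * f (u y)) volume :=
    (aestronglyMeasurable_hartree hf hW.aestronglyMeasurable hu.1).mul
      (hf.comp_aestronglyMeasurable hu.1)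
  have hsol := hv.isNeumannSolution
    (fun φ hφ => integrable_mul_of_abs_le_mul hN hq (memLinftyAddLp_of_memLp hV hq0 le_top)
      (hV.1.mul hu.1) (.of_forall fun y => (abs_mul _ _).le) hu hus (hmem φ hφ).1 (hmem φ hφ).2)
    fun φ hφ => integrable_mul_of_abs_le_mul hN hq hg hBm (.of_forall hBg) hu hus
      (hmem φ hφ).1 (hmem φ hφ).2
  exact hsol.exists_ae_abs_le hN hm hq hV hg <| .of_forall fun y =>
    calc |hartree W f u y * f (u y) - V y * u y| ≤ |g y| * |u y| + |V y| * |u y| :=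
          (abs_sub _ _).trans (add_le_add (hBg y) (abs_mul _ _).le)
      _ = (|g y| + |V y|) * |u y| := (add_mul _ _ _).symm

end WeakSolution

end Hartree

open Hartree in
theorem proposition6p3_general (N : ℕ) (hN : 2 ≤ N) (f : ℝ → ℝ) (hf : Continuous f)
    (θ : ℝ) (hθ_lower : 2 < θ) (hθ_upper : θ < 2 * (N : ℝ) / ((N : ℝ) - 1))
    (K : ℝ) (hfK : ∀ t, |f t| ≤ K * (|t| + |t| ^ (θ - 1)))
    (m : ℝ) (hm : 0 < m) (V : Bdry N → ℝ) (hV : MemLp V ⊤ volume)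
    (r : ℝ) (hr : (N : ℝ) / ((N : ℝ) * (2 - θ) + θ) < r)
    (W W₁ W₂ : Bdry N → ℝ) (hW : W =ᵐ[volume] W₁ + W₂)
    (hW₁ : MemLp W₁ (ENNReal.ofReal r) volume) (hW₂ : MemLp W₂ ⊤ volume)
    (v : Amb N → ℝ) (hv : IsWeakSolution m V W f v) :
    (∀ p : ℝ≥0∞, 2 ≤ p → MemLp (trace v) p volume) ∧ MemLp v ⊤ (halfMeasure N) := by
  lift θ to NNReal using (zero_lt_two.trans hθ_lower).le
  have hθs : θ < traceExponent N := by
    rwa [← NNReal.coe_lt_coe, coe_traceExponent (by omega)]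
  obtain ⟨M, hMu, hMv⟩ := hv.exists_ae_abs_le hN hm hf (by exact_mod_cast hθ_lower) hθs hfK hV hr
    ⟨W₂, W₁, hW₂, hW₁, hW.trans (Eventually.of_forall fun y => add_comm (W₁ y) (W₂ y))⟩
  have hu := hv.1.isTrace_trace.1
  have hu_top : MemLp (trace v) ⊤ volume := memLp_top_of_bound hu.1 M hMu
  exact ⟨fun p hp => memLp_of_memLp_of_memLp two_ne_zero hu hu_top hp le_top,
    memLp_top_of_bound hv.1.1.1 M hMv⟩

open Hartree in
theorem proposition6p3 (N : ℕ) (hN : 2 ≤ N)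
    -- the nonlinearity
    (f : ℝ → ℝ) (hf_C1 : ContDiff ℝ 1 f)
    (hf_nonneg : ∀ t, 0 ≤ t → 0 ≤ f t) (hf_neg : ∀ t, t < 0 → f t = 0)
    (θ : ℝ) (hθ_lower : 2 < θ) (hθ_upper : θ < 2 * (N : ℝ) / ((N : ℝ) - 1))
    (hf1 : Tendsto (fun t => |f t| / t) (𝓝[≠] 0) (𝓝 0))
    (hf2 : Tendsto (fun t => f t / t ^ (θ - 1)) atTop (𝓝 0))
    (hf3 : MonotoneOn (fun t => f t / t) (Ioi 0))
    -- the mass and the potential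
    (m V₀ Vinf : ℝ) (hV₀_pos : 0 < V₀) (hV₀_lt : V₀ < m)
    (V : Bdry N → ℝ) (hV_cont : Continuous V) (hV1 : ∀ y, 0 ≤ V y + V₀)
    (hV2 : Tendsto V (cocompact (Bdry N)) (𝓝 Vinf)) (hVinf : 0 < Vinf)
    (hV3 : ∀ y, V y ≤ Vinf) (hV3' : ∃ y, V y ≠ Vinf)
    -- the convolution kernel
    (r : ℝ) (hr : (N : ℝ) / ((N : ℝ) * (2 - θ) + θ) < r)
    (W W₁ W₂ : Bdry N → ℝ) (hW : W =ᵐ[volume] W₁ + W₂)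
    (hW₁ : MemLp W₁ (ENNReal.ofReal r) volume) (hW₂ : MemLp W₂ ∞ volume)
    (hW_nonneg : 0 ≤ᵐ[volume] W)
    (hW_radial : ∃ ρ : ℝ → ℝ, W =ᵐ[volume] fun y => ρ ‖y‖)
    -- the weak solution
    (v : Amb N → ℝ) (hv : IsWeakSolution m V W f v) :
    (∀ p : ℝ≥0∞, 2 ≤ p → MemLp (trace v) p volume) ∧
      MemLp v ∞ (halfMeasure N) := by
  obtain ⟨K, hfK⟩ := exists_abs_le_mul_add_rpow hf_C1.continuous hf_neg hf1 hf2
  have hV : MemLp V ⊤ volume :=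
    memLp_top_of_bound hV_cont.aestronglyMeasurable (Vinf + V₀) (Eventually.of_forall fun y =>
      abs_le.2 ⟨by linarith [hV1 y, hV3 y], by linarith [hV3 y]⟩)
  exact proposition6p3_general N hN f hf_C1.continuous θ hθ_lower hθ_upper K hfK m
    (hV₀_pos.trans hV₀_lt) V hV r hr W W₁ W₂ hW hW₁ hW₂ v hv
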